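/- A point $x\in\{-1,1\}^n$ is identified with the set $\{i : x_i=-1\}$. A function $c:\{-1,1\}^n\to\mathbb{R}_{\ge 0}$ is a coverage function if there are a finite universe $U$ with weights $w:U\to\mathbb{R}_{\ge0}$, sets $A_1,\dots,A_n\subseteq U$ and a constant $a_0\ge 0$ such that $c(x)=a_0+\sum_{u\in\bigcup_{i:x_i=-1}A_i}w(u)$ for all $x$ (the case $a_0=0$ is the usual definition; the constant corresponds to allowing the empty disjunction). Let $\mathcal U$ be the uniform distribution on $\{-1,1\}^n$. Algorithms are programs of a random access machine with exact real arithmetic: it has a memory for natural numbers (unit-cost addition, truncated subtraction and comparison, used for counting and indirect addressing) and a memory for real numbers (unit-cost addition, subtraction, multiplication, division and comparison, no rounding), natural-number constants only, and an instruction that requests the next random example $(x,c(x))$, with $x$ drawn independently from $\mathcal U$, at a cost of $n+1$ steps. **Theorem.** There is a single (deterministic) algorithm which, given $n\ge 2$, real numbers $\gamma,\delta>0$ and access to independent uniform random examples of any coverage function $c$ on $\{-1,1\}^n$, outputs a hypothesis $h:\{-1,1\}^n\to\mathbb{R}$ such that, with probability at least $2/3$ over the examples, $$\Pr_{x\sim\mathcal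 U}\bigl[h(x)\le c(x)\le(1+\gamma)h(x)\bigr]\ge 1-\delta .$$ Put $\bar\gamma=\min(\gamma,1)$ and $\bar\delta=\min(\delta,1)$. For every sequence of examples, the algorithm runs in time $$\tilde O\Bigl(\frac{n}{\bar\gamma^4\bar\delta^4}+\frac1{\bar\gamma^8\bar\delta^8}\Bigr)$$ and uses at most $$\log n\cdot\tilde O\Bigl(\frac1{\bar\gamma^4\bar\delta^4}\Bigr)$$ examples. The hypothesis is output as data in the memory of the machine, from which a second fixed program, which requests no examples, computes $h(x)$ for any given $x\in\{-1,1\}^n$ within the same time bound. Here $\tilde O(F)$, for $F\ge1$, means at most $C\cdot F\cdot(1+\log F)^k$, where $C$ and $k$ are absolute constants. -/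

import Mathlib

open MeasureTheory ProbabilityTheory

noncomputable section

/-- The Boolean hypercube `{-1, 1}ⁿ` (recall that `ℤˣ = {1, -1}`). -/
abbrev Cube (n : ℕ) : Type := Fin n → ℤˣ

instance : DiscreteMeasurableSpace ℤˣ where
  forall_measurableSet s := ⟨Units.val '' s, trivial, Set.preimage_image_eq s Units.val_injective⟩

/-- The uniform distribution on `{-1, 1}ⁿ`. -/
def uniformCube (n : ℕ) : Measure (Cube n) := uniformOn Set.univ

instance (n : ℕ) : IsProbabilityMeasure (uniformCube n) :=
  inferInstanceAs (IsProbabilityMeasure (uniformOn (Set.univ : Set (Cube n))))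

/-- The law of an infinite sequence of independent uniform points of `{-1, 1}ⁿ`. -/
def exampleLaw (n : ℕ) : Measure (ℕ → Cube n) :=
  Measure.infinitePi fun _ : ℕ => uniformCube n

/-- Coverage functions on `{-1, 1}ⁿ`: the point `x` stands for the set of all `i` with `x i = -1`,
and `c x` is the total weight of the union of the corresponding sets `A i` in a finite weighted
universe. A constant `a₀ ≥ 0` (the coefficient of the empty disjunction, which is regarded as the
constant `1`) is also allowed; `a₀ = 0` gives the coverage functions in the narrow sense. -/
def IsCoverage {n : ℕ} (c : Cube n → ℝ) : Prop :=
  ∃ (N : ℕ) (w : Fin N → ℝ) (A : Fin n → Finset (Fin N)) (a₀ : ℝ),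
    (∀ u, 0 ≤ w u) ∧ 0 ≤ a₀ ∧
      ∀ x, c x = a₀ + ∑ u ∈ (Finset.univ.filter fun i => x i = -1).biUnion A, w u

/-! The machine model: a random access machine with a memory for natural numbers (used for
counting and indexing) and a memory for exact real numbers, programmed in a language with
assignments, conditionals and loops. There are arrays `0, 1, 2, …` of either kind; a program
mentions only finitely many of them. Natural numbers can only be added, subtracted and compared,
real numbers can only be added, subtracted, multiplied, divided and compared (there is no rounding),
and the only constants are natural numbers. -/

/-- The memory of the machine, together with the number of examples requested so far (which
programs cannot read). -/
structure State where
  nat : ℕ → ℕ → ℕ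
  real : ℕ → ℕ → ℝ
  used : ℕ

namespace State

/-- Write `v` to entry `i` of the array `a` of natural numbers. -/
def setNat (s : State) (a i v : ℕ) : State :=
  { s with nat := Function.update s.nat a (Function.update (s.nat a) i v) }

/-- Write `v` to entry `i` of the array `a` of real numbers. -/
def setReal (s : State) (a i : ℕ) (v : ℝ) : State :=
  { s with real := Function.update s.real a (Function.update (s.real a) i v) }

/-- Write the coordinates of `x` to the first `n` entries of the array `0` of real numbers. -/
def loadPoint {n : ℕ} (s : State) (x : Cube n) : State :=
  { s with
    real := Function.update s.real 0
      fun i => if h : i < n then ((x ⟨i, h⟩ : ℤ) : ℝ) else s.real 0 i }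

/-- Receive the example `(x, y)`: the point `x` goes to the array `0` of real numbers and its label
`y` to entry `0` of the array `1` of real numbers. -/
def receive {n : ℕ} (s : State) (x : Cube n) (y : ℝ) : State :=
  let s' := (s.loadPoint x).setReal 1 0 y
  { s' with used := s.used + 1 }

/-- The initial memory: `n` is in entry `0` of the array `0` of natural numbers, `γ` and `δ` are in
the entries `0` and `1` of the array `2` of real numbers, and everything else is `0`. -/
def start (n : ℕ) (γ δ : ℝ) : State where
  nat := fun a i => if a = 0 ∧ i = 0 then n else 0
  real := fun a i => if a = 2 ∧ i = 0 then γ else if a = 2 ∧ i = 1 then δ else 0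
  used := 0

end State

/-- Expressions for natural numbers (`sub` is truncated subtraction). -/
inductive NExp where
  | lit (k : ℕ)
  | get (a : ℕ) (i : NExp)
  | add (e f : NExp)
  | sub (e f : NExp)

/-- Expressions for real numbers (division by zero returns `0`). -/
inductive RExp where
  | ofNat (e : NExp)
  | get (a : ℕ) (i : NExp)
  | add (e f : RExp)
  | sub (e f : RExp)
  | mul (e f : RExp)
  | div (e f : RExp)

/-- Conditions. -/
inductive Test where
  | natLe (e f : NExp)
  | realLe (e f : RExp)
  | not (b : Test)
  | and (b d : Test)

/-- Programs; `draw` requests the next random example. -/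
inductive Cmd where
  | skip
  | setNat (a : ℕ) (i e : NExp)
  | setReal (a : ℕ) (i : NExp) (e : RExp)
  | draw
  | seq (p q : Cmd)
  | ite (b : Test) (p q : Cmd)
  | loop (b : Test) (p : Cmd)

namespace NExp

/-- The value of an expression. -/
def eval (s : State) : NExp → ℕ
  | lit k => k
  | get a i => s.nat a (i.eval s)
  | add e f => e.eval s + f.eval s
  | sub e f => e.eval s - f.eval s

/-- The time to evaluate an expression: one step for each operation in it. -/
def cost : NExp → ℕ
  | lit _ => 1
  | get _ i => i.cost + 1
  | add e f => e.cost + f.cost + 1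
  | sub e f => e.cost + f.cost + 1

end NExp

namespace RExp

/-- The value of an expression. -/
def eval (s : State) : RExp → ℝ
  | ofNat e => (e.eval s : ℝ)
  | get a i => s.real a (i.eval s)
  | add e f => e.eval s + f.eval s
  | sub e f => e.eval s - f.eval s
  | mul e f => e.eval s * f.eval s
  | div e f => e.eval s / f.eval s

/-- The time to evaluate an expression: one step for each operation in it. -/
def cost : RExp → ℕ
  | ofNat e => e.cost + 1
  | get _ i => i.cost + 1
  | add e f => e.cost + f.cost + 1
  | sub e f => e.cost + f.cost + 1
  | mul e f => e.cost + f.cost + 1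
  | div e f => e.cost + f.cost + 1

end RExp

namespace Test

/-- The truth value of a condition. -/
def Holds (s : State) : Test → Prop
  | natLe e f => e.eval s ≤ f.eval s
  | realLe e f => e.eval s ≤ f.eval s
  | not b => ¬ b.Holds s
  | and b d => b.Holds s ∧ d.Holds s

/-- The time to evaluate a condition: one step for each operation in it. -/
def cost : Test → ℕ
  | natLe e f => e.cost + f.cost + 1
  | realLe e f => e.cost + f.cost + 1
  | not b => b.cost + 1
  | and b d => b.cost + d.cost + 1

end Test

/-- The program never requests an example. -/
def Cmd.DrawFree : Cmd → Prop
  | skip => True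
  | setNat _ _ _ => True
  | setReal _ _ _ => True
  | draw => False
  | seq p q => p.DrawFree ∧ q.DrawFree
  | ite _ p q => p.DrawFree ∧ q.DrawFree
  | loop _ p => p.DrawFree

/-- `Exec c ω p s t s'`: started in the memory `s`, with examples `(ω j, c (ω j))`, `j = 0, 1, …`,
the program `p` halts after exactly `t` steps in the memory `s'`. Receiving an example takes `n + 1`
steps. -/
inductive Exec {n : ℕ} (c : Cube n → ℝ) (ω : ℕ → Cube n) : Cmd → State → ℕ → State → Prop where
  | skip (s : State) : Exec c ω .skip s 1 s
  | setNat (a : ℕ) (i e : NExp) (s : State) :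
      Exec c ω (.setNat a i e) s (i.cost + e.cost + 1) (s.setNat a (i.eval s) (e.eval s))
  | setReal (a : ℕ) (i : NExp) (e : RExp) (s : State) :
      Exec c ω (.setReal a i e) s (i.cost + e.cost + 1) (s.setReal a (i.eval s) (e.eval s))
  | draw (s : State) : Exec c ω .draw s (n + 1) (s.receive (ω s.used) (c (ω s.used)))
  | seq {p q : Cmd} {s s' s'' : State} {t t' : ℕ} :
      Exec c ω p s t s' → Exec c ω q s' t' s'' → Exec c ω (.seq p q) s (t + t') s''
  | ite_pos {b : Test} {p q : Cmd} {s s' : State} {t : ℕ} :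
      b.Holds s → Exec c ω p s t s' → Exec c ω (.ite b p q) s (b.cost + t + 1) s'
  | ite_neg {b : Test} {p q : Cmd} {s s' : State} {t : ℕ} :
      ¬ b.Holds s → Exec c ω q s t s' → Exec c ω (.ite b p q) s (b.cost + t + 1) s'
  | loop_done {b : Test} {p : Cmd} {s : State} :
      ¬ b.Holds s → Exec c ω (.loop b p) s (b.cost + 1) s
  | loop_step {b : Test} {p : Cmd} {s s' s'' : State} {t t' : ℕ} :
      b.Holds s → Exec c ω p s t s' → Exec c ω (.loop b p) s' t' s'' →
        Exec c ω (.loop b p) s (b.cost + t + t' + 1) s''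

/-- With parameters `γ`, `δ` and the examples `(ω j, c (ω j))`, the learning program `L` halts
within time `T` after requesting at most `m` examples, and the memory that it leaves represents the
hypothesis `h` through the evaluation program `E`: for each point `x`, started in that memory with
the coordinates of `x` loaded, `E` halts within time `T` with `h x` in entry `0` of the array `1` of
real numbers. -/
def Outputs {n : ℕ} (L E : Cmd) (γ δ : ℝ) (c : Cube n → ℝ) (ω : ℕ → Cube n) (T m : ℝ)
    (h : Cube n → ℝ) : Prop :=
  ∃ (t : ℕ) (s : State), Exec c ω L (State.start n γ δ) t s ∧ (t : ℝ) ≤ T ∧ (s.used : ℝ) ≤ m ∧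
    ∀ x : Cube n, ∃ (t' : ℕ) (s' : State),
      Exec c ω E (s.loadPoint x) t' s' ∧ (t' : ℝ) ≤ T ∧ s'.real 1 0 = h x

/-- The bound `C · F · (1 + log F)ᵏ`; a quantity is `Õ(F)`, for `F ≥ 1`, if it is at most this for
some constants `C` and `k`. -/
def softO (C : ℝ) (k : ℕ) (F : ℝ) : ℝ := C * F * (1 + Real.log F) ^ k

end

/-! Identify a point with the set R of its coordinates -1. A coverage function becomes a set
function f that is nonnegative, monotone and submodular. The learner splits the cube by a short
decision list and learns a sparse Fourier expansion on each leaf.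

Fourier side. On a subcube with maximal value M, the event that an element of the universe is missed
is an average of characters. Hence (`exists_expansion`) f = M - ∑ q_T χ_T with q ≥ 0, q decreasing
in T, and ∑ q_T ≤ M. Subsets of a set with large coefficient have large coefficients too, at most
1/θ coefficients exceed θM, and 2^|T| q_T ≤ M keeps their degree logarithmic. A search that extends
known sets by one coordinate, using empirical correlations, therefore finds all relevant sets. By
Parseval the mean square error is at most 7θM² (`sum_sq_search_sub_le`).

From additive to multiplicative error. The error is small relative to M, so f must be at least
M/(2α) on most of the leaf; then Chebyshev's inequality gives a relative error g/4, and division by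
1 + g/4 makes it one-sided. The decision list provides this lower bound. If some unused coordinate i
is such that every active sample containing i has a large label, then {i ∈ R} is made a leaf, and
small values are rare there because the samples are representative (`card_low_le`). If there is
none, monotonicity shows that every remaining singleton has value at most M/α, and a Chernoff bound
for submodular functions (`sum_exp_neg_le`, `card_low_le_exp`) shows that small values are rare on
everything that remains. The maximum M is known up to a factor 2 from the samples, since R or its
complement always has at least half of the maximal value. After D = L + 2 leaves at most a fraction
2^(-D) of the cube is left.

Sampling. All tests that can occur are averages of functions bounded by 1, indexed by the subcube
and the character, and chosen before the samples are drawn. Hoeffding's inequality and a union bound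
make all of them accurate to 1/Q at once (`le_exampleLaw_good`), so the adaptivity of the learner is
harmless.

Cost. With Q of order (γδ)^(-2) and m of order Q² log n, up to logarithms, a leaf costs m(n + Q²):
every coordinate is tried once as a singleton, and only coordinates that pass are combined with the
known sets. Capacity limits enforce the time bound on every sequence of examples; on good sequences
they are never reached. The execution half of the proof shows that the program terminates within the
bound in a memory meeting a deterministic specification (`exists_outputs`); the analytic half shows
that this specification yields a good hypothesis with probability 2/3 (`two_thirds_le_exampleLaw`).
-/

open MeasureTheory ProbabilityTheory

noncomputable section

set_option linter.unusedSimpArgs false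

/-! ### Total correctness with time bounds -/

namespace Cmd

/-- The arrays of natural numbers that the program may write to. -/
def natWrites : Cmd → List ℕ
  | skip => []
  | setNat a _ _ => [a]
  | setReal _ _ _ => []
  | draw => []
  | seq p q => p.natWrites ++ q.natWrites
  | ite _ p q => p.natWrites ++ q.natWrites
  | loop _ p => p.natWrites

/-- The arrays of real numbers that the program may write to. -/
def realWrites : Cmd → List ℕ
  | skip => []
  | setNat _ _ _ => []
  | setReal a _ _ => [a]
  | draw => [0, 1]
  | seq p q => p.realWrites ++ q.realWrites
  | ite _ p q => p.realWrites ++ q.realWrites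
  | loop _ p => p.realWrites

/-- The memories `s` and `s'` agree on everything that `p` cannot change. -/
structure Frame (p : Cmd) (s s' : State) : Prop where
  nat : ∀ a, a ∉ p.natWrites → s'.nat a = s.nat a
  real : ∀ a, a ∉ p.realWrites → s'.real a = s.real a
  used : p.DrawFree → s'.used = s.used

theorem Frame.refl (p : Cmd) (s : State) : p.Frame s s :=
  ⟨fun _ _ => rfl, fun _ _ => rfl, fun _ => rfl⟩

theorem Frame.trans {p : Cmd} {s s' s'' : State} (h : p.Frame s s') (h' : p.Frame s' s'') :
    p.Frame s s'' :=
  ⟨fun a ha => (h'.nat a ha).trans (h.nat a ha), fun a ha => (h'.real a ha).trans (h.real a ha),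
    fun hd => (h'.used hd).trans (h.used hd)⟩

end Cmd

/-- Only arrays named in the syntax are written, so facts about all others cross a whole subprogram
at once. For the concrete programs the side condition is settled by `decide`. -/
theorem Exec.frame {n : ℕ} {c : Cube n → ℝ} {ω : ℕ → Cube n} {p : Cmd} {s s' : State} {t : ℕ}
    (h : Exec c ω p s t s') : p.Frame s s' := by
  induction h with
  | skip s => exact .refl _ _
  | setNat a i e s =>
    refine ⟨fun b hb => ?_, fun _ _ => rfl, fun _ => rfl⟩
    simp only [Cmd.natWrites, List.mem_singleton] at hb
    simp [State.setNat, Function.update_of_ne hb]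
  | setReal a i e s =>
    refine ⟨fun _ _ => rfl, fun b hb => ?_, fun _ => rfl⟩
    simp only [Cmd.realWrites, List.mem_singleton] at hb
    simp [State.setReal, Function.update_of_ne hb]
  | draw s =>
    refine ⟨fun _ _ => rfl, fun b hb => ?_, fun h => h.elim⟩
    simp only [Cmd.realWrites, List.mem_cons, List.not_mem_nil, or_false, not_or] at hb
    simp [State.receive, State.loadPoint, State.setReal, hb]
  | seq _ _ ih ih' =>
    refine ⟨fun a ha => ?_, fun a ha => ?_, fun h => (ih'.used h.2).trans (ih.used h.1)⟩
    · simp only [Cmd.natWrites, List.mem_append, not_or] at ha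
      exact (ih'.nat a ha.2).trans (ih.nat a ha.1)
    · simp only [Cmd.realWrites, List.mem_append, not_or] at ha
      exact (ih'.real a ha.2).trans (ih.real a ha.1)
  | ite_pos _ _ ih =>
    refine ⟨fun a ha => ?_, fun a ha => ?_, fun h => ih.used h.1⟩
    · simp only [Cmd.natWrites, List.mem_append, not_or] at ha
      exact ih.nat a ha.1
    · simp only [Cmd.realWrites, List.mem_append, not_or] at ha
      exact ih.real a ha.1
  | ite_neg _ _ ih =>
    refine ⟨fun a ha => ?_, fun a ha => ?_, fun h => ih.used h.2⟩
    · simp only [Cmd.natWrites, List.mem_append, not_or] at ha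
      exact ih.nat a ha.2
    · simp only [Cmd.realWrites, List.mem_append, not_or] at ha
      exact ih.real a ha.2
  | loop_done _ => exact .refl _ _
  | loop_step _ _ _ ih ih' => exact ⟨fun a ha => (ih'.nat a ha).trans (ih.nat a ha),
      fun a ha => (ih'.real a ha).trans (ih.real a ha), fun h => (ih'.used h).trans (ih.used h)⟩

/-- Time budgets are handed on by truncated subtraction `T - T'`. A run within `T - T'` takes at
least one step, so the subtraction was not truncated. -/
theorem Exec.pos {n : ℕ} {c : Cube n → ℝ} {ω : ℕ → Cube n} {p : Cmd} {s s' : State} {t : ℕ}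
    (h : Exec c ω p s t s') : 0 < t := by
  induction h <;> omega

/-- Started in `s`, the program `p` halts within `T` steps in a memory satisfying `Q`. -/
def Run {n : ℕ} (c : Cube n → ℝ) (ω : ℕ → Cube n) (p : Cmd) (s : State) (T : ℕ)
    (Q : State → Prop) : Prop :=
  ∃ t s', Exec c ω p s t s' ∧ t ≤ T ∧ Q s'

namespace Run

variable {n : ℕ} {c : Cube n → ℝ} {ω : ℕ → Cube n} {p q : Cmd} {s : State} {T T' : ℕ}
  {P Q : State → Prop} {b : Test}

/-- The frame is supplied along with the old postcondition, so facts about untouched arrays can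
enter the new one. -/
theorem mono (h : Run c ω p s T P) (hT : T ≤ T') (hPQ : ∀ s', p.Frame s s' → P s' → Q s') :
    Run c ω p s T' Q := by
  obtain ⟨t, s', h, ht, hP⟩ := h
  exact ⟨t, s', h, ht.trans hT, hPQ s' h.frame hP⟩

theorem le (h : Run c ω p s T P) (hT : T ≤ T') : Run c ω p s T' P :=
  h.mono hT fun _ _ h => h

theorem skip (hT : 1 ≤ T) (h : Q s) : Run c ω .skip s T Q := ⟨1, s, .skip s, hT, h⟩

theorem setNat {a iv v : ℕ} {i e : NExp} (hi : i.eval s = iv) (hv : e.eval s = v)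
    (hT : i.cost + e.cost + 1 ≤ T) (h : Q (s.setNat a iv v)) : Run c ω (.setNat a i e) s T Q := by
  subst hi hv
  exact ⟨_, _, .setNat a i e s, hT, h⟩

theorem setReal {a iv : ℕ} {v : ℝ} {i : NExp} {e : RExp} (hi : i.eval s = iv)
    (hv : e.eval s = v) (hT : i.cost + e.cost + 1 ≤ T) (h : Q (s.setReal a iv v)) :
    Run c ω (.setReal a i e) s T Q := by
  subst hi hv
  exact ⟨_, _, .setReal a i e s, hT, h⟩

/-- Composition, with the intermediate condition and the time for the first part given. -/
theorem seq (h : Run c ω p s T' P)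
    (h' : ∀ s', p.Frame s s' → P s' → Run c ω q s' (T - T') Q) : Run c ω (.seq p q) s T Q := by
  obtain ⟨t, s', h, ht, hP⟩ := h
  obtain ⟨t', s'', h'', ht', hQ⟩ := h' s' h.frame hP
  have := h''.pos
  exact ⟨_, s'', .seq h h'', by omega, hQ⟩

theorem setNat_seq {a iv v : ℕ} {i e : NExp} (hi : i.eval s = iv) (hv : e.eval s = v)
    (h : Run c ω q (s.setNat a iv v) (T - (i.cost + e.cost + 1)) Q) :
    Run c ω (.seq (.setNat a i e) q) s T Q :=
  seq (P := (· = s.setNat a iv v)) (setNat hi hv le_rfl rfl) fun _ _ hs => hs ▸ h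

theorem setReal_seq {a iv : ℕ} {v : ℝ} {i : NExp} {e : RExp} (hi : i.eval s = iv)
    (hv : e.eval s = v)
    (h : Run c ω q (s.setReal a iv v) (T - (i.cost + e.cost + 1)) Q) :
    Run c ω (.seq (.setReal a i e) q) s T Q :=
  seq (P := (· = s.setReal a iv v)) (setReal hi hv le_rfl rfl) fun _ _ hs => hs ▸ h

theorem draw_seq
    (h : Run c ω q (s.receive (ω s.used) (c (ω s.used))) (T - (n + 1)) Q) :
    Run c ω (.seq .draw q) s T Q :=
  seq (P := (· = s.receive (ω s.used) (c (ω s.used)))) ⟨_, _, .draw s, le_rfl, rfl⟩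
    fun _ _ hs => hs ▸ h

theorem ite (h : b.Holds s → Run c ω p s (T - (b.cost + 1)) Q)
    (h' : ¬ b.Holds s → Run c ω q s (T - (b.cost + 1)) Q) : Run c ω (.ite b p q) s T Q := by
  by_cases hb : b.Holds s
  · obtain ⟨t, s', h, ht, hQ⟩ := h hb
    have := h.pos
    exact ⟨_, s', .ite_pos hb h, by omega, hQ⟩
  · obtain ⟨t, s', h, ht, hQ⟩ := h' hb
    have := h.pos
    exact ⟨_, s', .ite_neg hb h, by omega, hQ⟩

/-- The rule for loops: the potential `μ` pays for each iteration. -/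
theorem loop (I : State → Prop) (μ : State → ℕ) (h0 : I s)
    (hstep : ∀ s', p.Frame s s' → I s' → b.Holds s' →
      ∃ T, Run c ω p s' T fun s'' => I s'' ∧ b.cost + 1 + T + μ s'' ≤ μ s') :
    Run c ω (.loop b p) s (μ s + b.cost + 1) fun s' => I s' ∧ ¬ b.Holds s' := by
  suffices H : ∀ N s', μ s' ≤ N → p.Frame s s' → I s' →
      Run c ω (.loop b p) s' (μ s' + b.cost + 1) fun s'' => I s'' ∧ ¬ b.Holds s'' from
    H _ s le_rfl (.refl _ _) h0
  intro N
  induction N with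
  | zero =>
    intro s' hμ hf hI
    -- With no potential left the test must fail, since an iteration consumes at least `b.cost + 1`.
    have hb : ¬ b.Holds s' := fun hb => by
      obtain ⟨T, t, s'', h, ht, hI', hT⟩ := hstep s' hf hI hb
      omega
    exact ⟨_, s', .loop_done hb, by omega, hI, hb⟩
  | succ N ih =>
    intro s' hμ hf hI
    by_cases hb : b.Holds s'
    · obtain ⟨T, t, s'', h, ht, hI', hμ'⟩ := hstep s' hf hI hb
      obtain ⟨t', s''', h', ht', hQ⟩ := ih s'' (by omega) (hf.trans h.frame) hI'
      exact ⟨_, s''', .loop_step hb h h', by omega, hQ⟩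
    · exact ⟨_, s', .loop_done hb, by omega, hI, hb⟩

/-- The rule for loops with a counter `k` running from `0` to `N`. -/
theorem loop_count (N τ : ℕ) (I : ℕ → State → Prop) (h0 : I 0 s)
    (hb : ∀ k s', k ≤ N → p.Frame s s' → I k s' → (b.Holds s' ↔ k < N))
    (hstep : ∀ k s', k < N → p.Frame s s' → I k s' → Run c ω p s' τ (I (k + 1))) :
    Run c ω (.loop b p) s (N * (τ + b.cost + 1) + b.cost + 1) (I N) := by
  suffices H : ∀ M k s', k + M = N → p.Frame s s' → I k s' →
      Run c ω (.loop b p) s' (M * (τ + b.cost + 1) + b.cost + 1) (I N) from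
    H N 0 s (by omega) (.refl _ _) h0
  intro M
  induction M with
  | zero =>
    intro k s' hk hf hI
    obtain rfl : k = N := by omega
    have := (hb k s' le_rfl hf hI).not.2 (lt_irrefl _)
    exact ⟨_, s', .loop_done this, by omega, hI⟩
  | succ M ih =>
    intro k s' hk hf hI
    obtain ⟨t, s'', h, ht, hI'⟩ := hstep k s' (by omega) hf hI
    obtain ⟨t', s''', h', ht', hQ⟩ := ih (k + 1) s'' (by omega) (hf.trans h.frame) hI'
    refine ⟨_, s''', .loop_step ((hb k s' (by omega) hf hI).2 (by omega)) h h', ?_, hQ⟩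
    have : (M + 1) * (τ + b.cost + 1) = M * (τ + b.cost + 1) + (τ + b.cost + 1) := by ring
    omega

end Run

namespace State

variable (s : State) (a b i j : ℕ)

@[simp] theorem setNat_nat (v : ℕ) :
    (s.setNat a i v).nat b j = if b = a ∧ j = i then v else s.nat b j := by
  by_cases h : b = a
  · subst h
    by_cases h' : j = i
    · subst h'; simp [setNat]
    · simp [setNat, h']
  · simp [setNat, h]

@[simp] theorem setNat_nat_of_ne (v : ℕ) (h : b ≠ a) : (s.setNat a i v).nat b = s.nat b := by
  simp [setNat, h]

@[simp] theorem setReal_real_of_ne (v : ℝ) (h : b ≠ a) :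
    (s.setReal a i v).real b = s.real b := by
  simp [setReal, h]

@[simp] theorem setNat_real (v : ℕ) : (s.setNat a i v).real = s.real := rfl

@[simp] theorem setNat_used (v : ℕ) : (s.setNat a i v).used = s.used := rfl

@[simp] theorem setReal_nat (v : ℝ) : (s.setReal a i v).nat = s.nat := rfl

@[simp] theorem setReal_used (v : ℝ) : (s.setReal a i v).used = s.used := rfl

@[simp] theorem setReal_real (v : ℝ) :
    (s.setReal a i v).real b j = if b = a ∧ j = i then v else s.real b j := by
  by_cases h : b = a
  · subst h
    by_cases h' : j = i
    · subst h'; simp [setReal]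
    · simp [setReal, h']
  · simp [setReal, h]

end State

/-! ### Abbreviations for programs -/

/-- The variable stored in entry `0` of the array `a` of natural numbers. -/
abbrev nvar (a : ℕ) : NExp := .get a (.lit 0)

/-- The variable stored in entry `0` of the array `a` of real numbers. -/
abbrev rvar (a : ℕ) : RExp := .get a (.lit 0)

/-- A natural number as a real constant. -/
abbrev rlit (k : ℕ) : RExp := .ofNat (.lit k)

/-- Assignment to a variable. -/
abbrev nset (a : ℕ) (e : NExp) : Cmd := .setNat a (.lit 0) e

/-- Assignment to a variable. -/
abbrev rset (a : ℕ) (e : RExp) : Cmd := .setReal a (.lit 0) e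

/-- Increment a variable. -/
abbrev incr (a : ℕ) : Cmd := nset a (.add (nvar a) (.lit 1))

/-- The condition `e < f`. -/
abbrev Test.natLt (e f : NExp) : Test := .natLe (.add e (.lit 1)) f

@[simp] theorem Test.holds_natLt (s : State) (e f : NExp) :
    (Test.natLt e f).Holds s ↔ e.eval s < f.eval s := Iff.rfl

@[simp] theorem NExp.eval_nvar (s : State) (a : ℕ) : (nvar a).eval s = s.nat a 0 := rfl

@[simp] theorem NExp.eval_lit (s : State) (k : ℕ) : (NExp.lit k).eval s = k := rfl

@[simp] theorem RExp.eval_rvar (s : State) (a : ℕ) : (rvar a).eval s = s.real a 0 := rfl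

namespace Run

variable {n : ℕ} {c : Cube n → ℝ} {ω : ℕ → Cube n} {q : Cmd} {s : State} {T : ℕ}
  {Q : State → Prop}

theorem nset {a v : ℕ} {e : NExp} (hv : e.eval s = v) (hT : e.cost + 2 ≤ T)
    (h : Q (s.setNat a 0 v)) : Run c ω (nset a e) s T Q :=
  setNat rfl hv (by rw [NExp.cost]; omega) h

theorem rset {a : ℕ} {v : ℝ} {e : RExp} (hv : e.eval s = v) (hT : e.cost + 2 ≤ T)
    (h : Q (s.setReal a 0 v)) : Run c ω (rset a e) s T Q :=
  setReal rfl hv (by rw [NExp.cost]; omega) h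

theorem nset_seq {a v : ℕ} {e : NExp} (hv : e.eval s = v)
    (h : Run c ω q (s.setNat a 0 v) (T - (e.cost + 2)) Q) :
    Run c ω (.seq (_root_.nset a e) q) s T Q :=
  setNat_seq rfl hv (h.le (by rw [NExp.cost]; omega))

theorem rset_seq {a : ℕ} {v : ℝ} {e : RExp} (hv : e.eval s = v)
    (h : Run c ω q (s.setReal a 0 v) (T - (e.cost + 2)) Q) :
    Run c ω (.seq (_root_.rset a e) q) s T Q :=
  setReal_seq rfl hv (h.le (by rw [NExp.cost]; omega))

end Run

infixr:60 " ;; " => Cmd.seq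

namespace Learner

/-! ### The programs -/

/-- The value of the function of node `k` at sample `j`. -/
abbrev nodeVal (k j : NExp) : RExp := .get 10 (.add (.get 9 k) j)

/-- The coordinate `i` of the sample `j`. -/
abbrev coord (j i : NExp) : RExp := .get 8 (.add (.get 7 j) i)

/-- Fill in the next free node: its function is that of the node `p` times `a + b * x i`, where
`p`, `i`, `a`, `b` are in the variables `16`, `17` (naturals) and `19`, `20` (reals). The sum of
its values times the labels is left in the variable `17`. -/
def newNode : Cmd :=
  .setNat 11 (nvar 10) (nvar 16) ;;
  .setNat 12 (nvar 10) (nvar 17) ;;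
  .setReal 11 (nvar 10) (rvar 19) ;;
  .setReal 12 (nvar 10) (rvar 20) ;;
  -- Natural numbers cannot be multiplied, so the offset `k * m` of the values of node `k` is
  -- accumulated from the preceding node.
  .setNat 9 (nvar 10) (.add (.get 9 (.sub (nvar 10) (.lit 1))) (nvar 8)) ;;
  rset 17 (rlit 0) ;;
  nset 4 (.lit 0) ;;
  .loop (.natLt (nvar 4) (nvar 8))
    (.setReal 10 (.add (.get 9 (nvar 10)) (nvar 4))
        (.mul (nodeVal (nvar 16) (nvar 4))
          (.add (rvar 19) (.mul (rvar 20) (coord (nvar 4) (nvar 17))))) ;;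
     rset 17 (.add (rvar 17) (.mul (.get 9 (nvar 4)) (nodeVal (nvar 10) (nvar 4)))) ;;
     incr 4)

/-- Keep the node filled in last, with the given coefficient. -/
abbrev keep (e : RExp) : Cmd := .setReal 13 (nvar 10) e ;; incr 10

/-- Compute the largest label of an active sample. -/
def findMax : Cmd :=
  rset 14 (rlit 0) ;;
  nset 4 (.lit 0) ;;
  .loop (.natLt (nvar 4) (nvar 8))
    (.ite (.realLe (rvar 14) (.mul (nodeVal (nvar 13) (nvar 4)) (.get 9 (nvar 4))))
      (rset 14 (.mul (nodeVal (nvar 13) (nvar 4)) (.get 9 (nvar 4)))) .skip ;;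
     incr 4)

/-- Find the first unmarked coordinate `i` such that all active samples with `x i = -1` have a
large label. -/
def findVar : Cmd :=
  nset 22 (.lit 0) ;;
  nset 4 (.lit 0) ;;
  .loop (.and (.natLt (nvar 22) (nvar 0)) (.natLt (nvar 4) (nvar 8)))
    -- The left side vanishes for samples that are inactive or have `x i = 1`, so these never object
    -- when labels are nonnegative. On the others `1 - x i = 2`, whence the level `2 * α` in the
    -- variable `21`.
    (.ite (.and (.natLe (.get 15 (nvar 22)) (.lit 0))
        (.realLe (.mul (.mul (nodeVal (nvar 13) (nvar 4))
            (.sub (rlit 1) (coord (nvar 4) (nvar 22)))) (rvar 14))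
          (.mul (rvar 21) (.get 9 (nvar 4)))))
      (incr 4) (incr 22 ;; nset 4 (.lit 0)))

/-- Start a new leaf. -/
def newLeaf : Cmd :=
  .setNat 15 (nvar 22) (.lit 1) ;;
  -- The variable `15` holds `2 ^ d`. Leaf `d` fixes `d + 1` coordinates, or only `d` if the index
  -- found is `n`; the scale is the inverse of its measure.
  .ite (.natLt (nvar 22) (nvar 0)) (rset 16 (.mul (rlit 2) (rvar 15))) (rset 16 (rvar 15)) ;;
  -- The factor `1 / (1 + g / 4)` turns the two-sided relative error into a one-sided one.
  rset 16 (.div (rvar 16) (.mul (.ofNat (nvar 8)) (.add (rlit 1) (.div (rvar 3) (rlit 4))))) ;;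
  -- After normalization this threshold is 4θM with θ = 2^e / Q on a leaf of codimension e, against
  -- a sampling error of at most 2θM when the samples are good.
  rset 18 (.div (.mul (.mul (rlit 4) (rvar 14)) (.ofNat (nvar 8))) (rvar 6)) ;;
  nset 18 (nvar 10) ;;
  nset 16 (nvar 13) ;;
  nset 17 (nvar 22) ;;
  rset 19 (.div (rlit 1) (rlit 2)) ;;
  rset 20 (.sub (rlit 0) (.div (rlit 1) (rlit 2))) ;;
  newNode ;;
  keep (.mul (rvar 17) (rvar 16))

/-- The number of nodes of the current leaf is below its bound. -/
abbrev hasRoom : Test :=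
  .realLe (.ofNat (.sub (.add (nvar 10) (.lit 1)) (nvar 18))) (.add (rvar 6) (rlit 2))

/-- The correlation with the node filled in last is large. -/
abbrev isLarge : Test := .not (.realLe (rlit 0) (.add (rvar 17) (rvar 18)))

/-- Extend all nodes of the leaf by the coordinate in the variable `17`. -/
def expandVar : Cmd :=
  nset 20 (nvar 18) ;;
  -- The end of the scan is frozen here, since the list grows while it is being scanned.
  nset 21 (nvar 10) ;;
  .loop (.natLt (nvar 20) (nvar 21))
    (.ite hasRoom
      (nset 16 (nvar 20) ;; newNode ;;
        .ite isLarge (keep (.mul (rvar 17) (rvar 16))) .skip)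
      .skip ;;
    incr 20)

/-- Find the large Fourier coefficients of the current leaf. -/
def expandLeaf : Cmd :=
  rset 19 (rlit 0) ;;
  rset 20 (rlit 1) ;;
  nset 19 (.lit 0) ;;
  .loop (.natLt (nvar 19) (nvar 0))
    (.ite (.and (.natLe (.get 15 (nvar 19)) (.lit 0)) hasRoom)
      (nset 16 (nvar 18) ;; nset 17 (nvar 19) ;; newNode ;; .ite isLarge expandVar .skip)
      .skip ;;
    incr 19)

/-- Deactivate the samples of the current leaf. -/
def closeLeaf : Cmd :=
  nset 16 (nvar 13) ;;
  nset 17 (nvar 22) ;;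
  rset 19 (.div (rlit 1) (rlit 2)) ;;
  rset 20 (.div (rlit 1) (rlit 2)) ;;
  newNode ;;
  -- Coefficient zero: this node only carries the indicator of the points that stay active, to serve
  -- as a parent later.
  keep (rlit 0) ;;
  nset 13 (.sub (nvar 10) (.lit 1)) ;;
  rset 15 (.add (rvar 15) (rvar 15))

/-- One leaf of the decision list. -/
def round : Cmd := findMax ;; findVar ;; newLeaf ;; expandLeaf ;; closeLeaf ;; incr 14

/-- All leaves of the decision list. -/
def rounds : Cmd := .loop (.natLt (nvar 14) (.add (nvar 1) (.lit 2))) round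

/-- Compute the parameters. -/
def setParams : Cmd :=
  .ite (.realLe (.get 2 (.lit 0)) (rlit 1)) (rset 3 (.get 2 (.lit 0))) (rset 3 (rlit 1)) ;;
  .ite (.realLe (.get 2 (.lit 1)) (rlit 1)) (rset 4 (.get 2 (.lit 1))) (rset 4 (rlit 1)) ;;
  rset 4 (.mul (rvar 3) (rvar 4)) ;;
  rset 5 (rlit 1) ;;
  -- Finds the least `L` for which `2 ^ L` times the product of the truncated parameters is at least
  -- `1`, and leaves `2 ^ L` in the variable `5`. The next loop does the same for `K` and `n`.
  .loop (.not (.realLe (rlit 1) (.mul (rvar 5) (rvar 4))))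
    (rset 5 (.add (rvar 5) (rvar 5)) ;; incr 1) ;;
  nset 3 (.lit 1) ;;
  .loop (.not (.natLe (nvar 0) (nvar 3))) (nset 3 (.add (nvar 3) (nvar 3)) ;; incr 2) ;;
  rset 21 (.ofNat (.add (nvar 1) (.lit 2))) ;;
  rset 6 (.mul (.mul (rlit 131072) (.mul (rvar 21) (.mul (rvar 21) (rvar 21))))
    (.mul (rvar 5) (rvar 5))) ;;
  rset 7 (.mul (.mul (rlit 34) (.mul (rvar 6) (rvar 6)))
    (.mul (rvar 21) (.ofNat (.add (nvar 2) (.lit 1))))) ;;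
  rset 21 (.mul (rlit 16) (rvar 21)) ;;
  rset 15 (rlit 1) ;;
  nset 10 (.lit 1)

/-- Draw and store the samples. -/
def drawAll : Cmd :=
  .loop (.not (.realLe (rvar 7) (.ofNat (nvar 8))))
    (.draw ;;
    .setNat 7 (nvar 8) (nvar 6) ;;
    .setReal 9 (nvar 8) (rvar 1) ;;
    .setReal 10 (nvar 8) (rlit 1) ;;
    nset 5 (.lit 0) ;;
    .loop (.natLt (nvar 5) (nvar 0))
      (.setReal 8 (.add (nvar 6) (nvar 5)) (.get 0 (nvar 5)) ;; incr 5) ;;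
    -- A dummy coordinate of index `n` and value `-1`. Splitting on it puts every active point into
    -- the leaf, so the last leaf needs no special treatment.
    .setReal 8 (.add (nvar 6) (nvar 5)) (.sub (rlit 0) (rlit 1)) ;;
    nset 6 (.add (.add (nvar 6) (nvar 0)) (.lit 1)) ;;
    incr 8)

/-- The learning program. -/
def learn : Cmd := setParams ;; drawAll ;; rounds

/-- The evaluation program. -/
def evaluate : Cmd :=
  .setReal 0 (nvar 0) (.sub (rlit 0) (rlit 1)) ;;
  rset 22 (rlit 1) ;;
  -- Node `0` is the constant `1`, so its contribution is its coefficient.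
  rset 1 (rvar 13) ;;
  nset 23 (.lit 1) ;;
  .loop (.natLt (nvar 23) (nvar 10))
    (.setReal 22 (nvar 23) (.mul (.get 22 (.get 11 (nvar 23)))
      (.add (.get 11 (nvar 23)) (.mul (.get 12 (nvar 23)) (.get 0 (.get 12 (nvar 23)))))) ;;
    rset 1 (.add (rvar 1) (.mul (.get 13 (nvar 23)) (.get 22 (nvar 23)))) ;;
    incr 23)

theorem evaluate_drawFree : evaluate.DrawFree := by
  simp [evaluate, Cmd.DrawFree]

/-! ### Invariants of the memory -/

/-- The samples `xs j` with labels `y j`, `j < m`, are stored. -/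
structure Env (n m : ℕ) (xs : ℕ → ℕ → ℝ) (y : ℕ → ℝ) (s : State) : Prop where
  n_eq : s.nat 0 0 = n
  m_eq : s.nat 8 0 = m
  row : ∀ j < m, s.nat 7 j = j * (n + 1)
  coord : ∀ j < m, ∀ i ≤ n, s.real 8 (j * (n + 1) + i) = xs j i
  label : ∀ j < m, s.real 9 j = y j

/-- The first `N` nodes represent the functions `F 0, …, F (N - 1)`. -/
structure Nodes (n m : ℕ) (xs : ℕ → ℕ → ℝ) (F : ℕ → (ℕ → ℝ) → ℝ) (N : ℕ) (s : State) :
    Prop where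
  count : s.nat 10 0 = N
  pos : 0 < N
  zero : ∀ x, F 0 x = 1
  base : ∀ k < N, s.nat 9 k = k * m
  val : ∀ k < N, ∀ j < m, s.real 10 (k * m + j) = F k (xs j)
  parent : ∀ k < N, 0 < k → s.nat 11 k < k
  index : ∀ k < N, 0 < k → s.nat 12 k ≤ n
  step : ∀ k < N, 0 < k → ∀ x,
    F k x = F (s.nat 11 k) x * (s.real 11 k + s.real 12 k * x (s.nat 12 k))

/-- The combination of the nodes with the stored coefficients is `H`. -/
def Combines (F : ℕ → (ℕ → ℝ) → ℝ) (N : ℕ) (H : (ℕ → ℝ) → ℝ) (s : State) : Prop :=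
  ∀ x, ∑ k ∈ Finset.range N, s.real 13 k * F k x = H x

variable {n m N : ℕ} {xs : ℕ → ℕ → ℝ} {y : ℕ → ℝ} {F : ℕ → (ℕ → ℝ) → ℝ} {H : (ℕ → ℝ) → ℝ}
  {s s' : State}

theorem Env.congr (h : Env n m xs y s) (hn : ∀ a ∈ [0, 7, 8], s'.nat a = s.nat a)
    (hr : ∀ a ∈ [8, 9], s'.real a = s.real a) : Env n m xs y s' := by
  simp only [List.mem_cons, List.not_mem_nil, or_false, forall_eq_or_imp, forall_eq] at hn hr
  obtain ⟨h1, h2, h3⟩ := hn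
  obtain ⟨h4, h5⟩ := hr
  constructor
  · rw [h1]; exact h.n_eq
  · rw [h3]; exact h.m_eq
  · rw [h2]; exact h.row
  · rw [h4]; exact h.coord
  · rw [h5]; exact h.label

theorem Nodes.congr (h : Nodes n m xs F N s) (hn : ∀ a ∈ [9, 10, 11, 12], s'.nat a = s.nat a)
    (hr : ∀ a ∈ [10, 11, 12], s'.real a = s.real a) : Nodes n m xs F N s' := by
  simp only [List.mem_cons, List.not_mem_nil, or_false, forall_eq_or_imp, forall_eq] at hn hr
  obtain ⟨h1, h2, h3, h4⟩ := hn
  obtain ⟨h5, h6, h7⟩ := hr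
  constructor
  · rw [h2]; exact h.count
  · exact h.pos
  · exact h.zero
  · rw [h1]; exact h.base
  · rw [h5]; exact h.val
  · rw [h3]; exact h.parent
  · rw [h4]; exact h.index
  · rw [h3, h4, h6, h7]; exact h.step

theorem Env.frame {p : Cmd} (h : Env n m xs y s) (hf : p.Frame s s')
    (hn : ∀ a ∈ [0, 7, 8], a ∉ p.natWrites) (hr : ∀ a ∈ [8, 9], a ∉ p.realWrites) :
    Env n m xs y s' :=
  h.congr (fun a ha => hf.nat a (hn a ha)) fun a ha => hf.real a (hr a ha)

theorem Nodes.frame {p : Cmd} (h : Nodes n m xs F N s) (hf : p.Frame s s')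
    (hn : ∀ a ∈ [9, 10, 11, 12], a ∉ p.natWrites) (hr : ∀ a ∈ [10, 11, 12], a ∉ p.realWrites) :
    Nodes n m xs F N s' :=
  h.congr (fun a ha => hf.nat a (hn a ha)) fun a ha => hf.real a (hr a ha)

theorem Combines.frame {p : Cmd} (h : Combines F N H s) (hf : p.Frame s s')
    (hr : 13 ∉ p.realWrites) : Combines F N H s' := by
  intro x
  rw [hf.real 13 hr]
  exact h x

/-- The node that follows the first `N` nodes is filled in, with the function `G`, and `S` is its
correlation with the labels. -/
structure Staged (n m : ℕ) (xs : ℕ → ℕ → ℝ) (y : ℕ → ℝ) (F : ℕ → (ℕ → ℝ) → ℝ) (N : ℕ)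
    (G : (ℕ → ℝ) → ℝ) (s : State) : Prop where
  base : s.nat 9 N = N * m
  val : ∀ j < m, s.real 10 (N * m + j) = G (xs j)
  parent : s.nat 11 N < N
  index : s.nat 12 N ≤ n
  step : ∀ x, G x = F (s.nat 11 N) x * (s.real 11 N + s.real 12 N * x (s.nat 12 N))
  sum : s.real 17 0 = ∑ j ∈ Finset.range m, y j * G (xs j)

section

variable {k : ℕ} {c : Cube k → ℝ} {ω : ℕ → Cube k}

set_option maxHeartbeats 800000 in
-- The entries filled in have index `N`, outside the range that `Nodes` governs, so the invariant
-- survives. The trial node can then be kept or overwritten by the next one.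
theorem run_newNode (hE : Env n m xs y s) (hN : Nodes n m xs F N s) (hp : s.nat 16 0 < N)
    (hi : s.nat 17 0 ≤ n) {G : (ℕ → ℝ) → ℝ}
    (hG : ∀ x, G x = F (s.nat 16 0) x * (s.real 19 0 + s.real 20 0 * x (s.nat 17 0))) :
    Run c ω newNode s (80 * m + 80)
      fun s' => Env n m xs y s' ∧ Nodes n m xs F N s' ∧ Staged n m xs y F N G s' := by
  obtain ⟨N, rfl⟩ : ∃ M, N = M + 1 := ⟨N - 1, by have := hN.pos; omega⟩
  have hc := hN.count
  have hbN := hN.base N (by omega)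
  unfold newNode
  refine Run.setNat_seq hc rfl ?_
  refine Run.setNat_seq (iv := N + 1) (by simp [NExp.eval, hc]) rfl ?_
  refine Run.setReal_seq (iv := N + 1) (by simp [NExp.eval, hc]) rfl ?_
  refine Run.setReal_seq (iv := N + 1) (by simp [NExp.eval, hc]) rfl ?_
  refine Run.setNat_seq (iv := N + 1) (v := (N + 1) * m) (by simp [NExp.eval, hc])
    (by simp [NExp.eval, hc, hbN, hE.m_eq]; ring) ?_
  refine Run.rset_seq (v := 0) (by simp [RExp.eval, NExp.eval]) ?_
  refine Run.nset_seq (v := 0) rfl ?_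
  simp only [NExp.eval, RExp.eval]
  generalize hs1 : State.setNat _ 4 0 0 = s1
  have hE1 : Env n m xs y s1 := by
    subst hs1; exact hE.congr (by simp) (by simp)
  have hN1 : Nodes n m xs F (N + 1) s1 := by
    subst hs1
    constructor <;> simp [hc, hN.zero]
    · intro k hk
      rw [if_neg (by omega), hN.base k (by omega)]
    · exact fun k hk => hN.val k (by omega)
    · intro k hk h0
      rw [if_neg (by omega)]
      exact hN.parent k (by omega) h0
    · intro k hk h0
      rw [if_neg (by omega)]
      exact hN.index k (by omega) h0
    · intro k hk h0
      simp only [if_neg (show ¬ k = N + 1 by omega)]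
      exact hN.step k (by omega) h0
  have h9 : s1.nat 9 (N + 1) = (N + 1) * m := by
    subst hs1; simp
  have h11 : s1.nat 11 (N + 1) = s.nat 16 0 := by subst hs1; simp
  have h12 : s1.nat 12 (N + 1) = s.nat 17 0 := by subst hs1; simp
  have r11 : s1.real 11 (N + 1) = s.real 19 0 := by subst hs1; simp
  have r12 : s1.real 12 (N + 1) = s.real 20 0 := by subst hs1; simp
  have h16 : s1.nat 16 = s.nat 16 := by subst hs1; simp
  have h17 : s1.nat 17 = s.nat 17 := by subst hs1; simp
  have r19 : s1.real 19 = s.real 19 := by subst hs1; simp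
  have r20 : s1.real 20 = s.real 20 := by subst hs1; simp
  refine Run.mono (Run.loop_count m 60 (fun j s' => s'.nat 4 0 = j ∧
      (∀ k < N + 1, ∀ j < m, s'.real 10 (k * m + j) = F k (xs j)) ∧
      (∀ i < j, s'.real 10 ((N + 1) * m + i) = G (xs i)) ∧
      s'.real 17 0 = ∑ i ∈ Finset.range j, y i * G (xs i)) ?_ ?_ ?_) ?_ ?_
  · subst hs1; simpa using hN.val
  · rintro j s' - hf ⟨h, -⟩
    simp [h, hf.nat 8 (by decide), hE1.m_eq]
  · rintro j s' hj hf ⟨h4, hv, hv', hS⟩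
    have hE' : Env n m xs y s' := hE1.frame hf (by decide) (by decide)
    have g10 : s'.nat 10 0 = N + 1 := by rw [hf.nat 10 (by decide), hN1.count]
    have g9 : s'.nat 9 = s1.nat 9 := hf.nat 9 (by decide)
    have g16 : s'.nat 16 = s.nat 16 := by rw [hf.nat 16 (by decide), h16]
    have g17 : s'.nat 17 = s.nat 17 := by rw [hf.nat 17 (by decide), h17]
    have q19 : s'.real 19 = s.real 19 := by rw [hf.real 19 (by decide), r19]
    have q20 : s'.real 20 = s.real 20 := by rw [hf.real 20 (by decide), r20]
    have e1 : ((rvar 19).add ((rvar 20).mul (coord (nvar 4) (nvar 17)))).eval s' =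
        s.real 19 0 + s.real 20 0 * xs j (s.nat 17 0) := by
      simp [RExp.eval, NExp.eval, q19, q20, g17, h4, hE'.row j hj, hE'.coord j hj _ hi]
    have e2 : (nodeVal (nvar 16) (nvar 4)).eval s' = F (s.nat 16 0) (xs j) := by
      simp [RExp.eval, NExp.eval, g16, g9, h4, hN1.base _ hp, hv _ hp j hj]
    refine Run.setReal_seq (iv := (N + 1) * m + j) (v := G (xs j))
      (by simp [NExp.eval, g10, g9, h9, h4]) (by rw [RExp.eval, e1, e2, hG]) ?_
    refine Run.rset_seq (v := ∑ i ∈ Finset.range (j + 1), y i * G (xs i))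
      (by simp [NExp.eval, RExp.eval, g10, g9, h9, h4, hE'.label j hj, hS,
        Finset.sum_range_succ]) ?_
    refine Run.nset (v := j + 1) (by simp [NExp.eval, h4]) (by simp [NExp.cost, RExp.cost]) ?_
    · simp
      refine ⟨fun k hk i hi => ?_, fun i hi => ?_⟩
      · rw [if_neg, hv k (by omega) i hi]
        -- The block of values of an old node ends before the new block begins.
        have : k * m + m ≤ (N + 1) * m := by nlinarith
        omega
      · split_ifs with h
        · rw [h]
        · exact hv' i (by omega)
  · simp [NExp.cost, RExp.cost, Test.cost]
    omega
  · rintro s' hf ⟨h4, hv, hv', hS⟩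
    have hE' : Env n m xs y s' := hE1.frame hf (by decide) (by decide)
    have g9 : s'.nat 9 = s1.nat 9 := hf.nat 9 (by decide)
    have g10 : s'.nat 10 = s1.nat 10 := hf.nat 10 (by decide)
    have g11 : s'.nat 11 = s1.nat 11 := hf.nat 11 (by decide)
    have g12 : s'.nat 12 = s1.nat 12 := hf.nat 12 (by decide)
    have q11 : s'.real 11 = s1.real 11 := hf.real 11 (by decide)
    have q12 : s'.real 12 = s1.real 12 := hf.real 12 (by decide)
    refine ⟨hE', ⟨?_, hN1.pos, hN1.zero, ?_, hv, ?_, ?_, ?_⟩, ⟨?_, hv', ?_, ?_, ?_, hS⟩⟩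
    · rw [g10, hN1.count]
    · rw [g9]; exact hN1.base
    · rw [g11]; exact hN1.parent
    · rw [g12]; exact hN1.index
    · rw [g11, g12, q11, q12]; exact hN1.step
    · rw [g9, h9]
    · rw [g11, h11]; exact hp
    · rw [g12, h12]; exact hi
    · rw [g11, h11, g12, h12, q11, r11, q12, r12]; exact hG

/-- Keeping the staged node. -/
theorem Staged.keep {G : (ℕ → ℝ) → ℝ} {z : ℝ} (h : Staged n m xs y F N G s)
    (hN : Nodes n m xs F N s) (hH : Combines F N H s) :
    Nodes n m xs (Function.update F N G) (N + 1) ((s.setReal 13 N z).setNat 10 0 (N + 1)) ∧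
      Combines (Function.update F N G) (N + 1) (fun x => H x + z * G x)
        ((s.setReal 13 N z).setNat 10 0 (N + 1)) := by
  have hF : ∀ k < N, Function.update F N G k = F k := fun k hk =>
    Function.update_of_ne hk.ne _ _
  have hpos := hN.pos
  refine ⟨⟨by simp, by omega, ?_, ?_, ?_, ?_, ?_, ?_⟩, fun x => ?_⟩
  · rw [hF 0 hpos]; exact hN.zero
  all_goals simp only [Nat.lt_succ_iff_lt_or_eq, State.setNat_real]
  · rintro k (hk | rfl)
    · simpa using hN.base k hk
    · simpa using h.base
  · rintro k (hk | rfl) j hj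
    · rw [hF k hk]; simpa using hN.val k hk j hj
    · simpa using h.val j hj
  · rintro k (hk | rfl) hk0
    · simpa using hN.parent k hk hk0
    · simpa using h.parent
  · rintro k (hk | rfl) hk0
    · simpa using hN.index k hk hk0
    · simpa using h.index
  · rintro k (hk | rfl) hk0 x
    · have := hN.parent k hk hk0
      simp [hF k hk, hF _ (this.trans hk), hN.step k hk hk0 x]
    · simp [hF _ h.parent, h.step x]
  · rw [Finset.sum_range_succ, ← hH x]
    congr 1
    · refine Finset.sum_congr rfl fun k hk => ?_
      have := Finset.mem_range.1 hk
      simp [hF k this, this.ne]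
    · simp

end

/-! ### Scans over the samples: the largest label and the splitting coordinate. -/

section

variable {n m N : ℕ} {xs : ℕ → ℕ → ℝ} {y : ℕ → ℝ} {F : ℕ → (ℕ → ℝ) → ℝ} {H : (ℕ → ℝ) → ℝ}
  {s s' : State} {k : ℕ} {c : Cube k → ℝ} {ω : ℕ → Cube k}

theorem run_keep {e : RExp} {z : ℝ} {T : ℕ} (hN : Nodes n m xs F N s) (hz : e.eval s = z)
    (hT : e.cost + 10 ≤ T) :
    Run c ω (keep e) s T fun s' => s' = (s.setReal 13 N z).setNat 10 0 (N + 1) := by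
  refine Run.setReal_seq (iv := N) (by simp [hN.count]) hz ?_
  refine Run.nset (v := N + 1) (by simp [NExp.eval, hN.count]) ?_ rfl
  simp [NExp.cost]
  omega

theorem eval_nodeVal (hN : Nodes n m xs F N s) {K J : NExp} (hk : K.eval s < N)
    (hj : J.eval s < m) : (nodeVal K J).eval s = F (K.eval s) (xs (J.eval s)) := by
  simp [RExp.eval, NExp.eval, hN.base _ hk, hN.val _ hk _ hj]

theorem eval_coord (hE : Env n m xs y s) {J I : NExp} (hj : J.eval s < m) (hi : I.eval s ≤ n) :
    (coord J I).eval s = xs (J.eval s) (I.eval s) := by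
  simp [RExp.eval, NExp.eval, hE.row _ hj, hE.coord _ hj _ hi]

theorem run_findMax (hE : Env n m xs y s) (hN : Nodes n m xs F N s) (ha : s.nat 13 0 < N) :
    Run c ω findMax s (80 * m + 80) fun s' => 0 ≤ s'.real 14 0 ∧
      (∀ j < m, F (s.nat 13 0) (xs j) * y j ≤ s'.real 14 0) ∧
      (s'.real 14 0 = 0 ∨ ∃ j < m, s'.real 14 0 = F (s.nat 13 0) (xs j) * y j) := by
  unfold findMax
  refine Run.rset_seq (v := 0) (by simp [RExp.eval, NExp.eval]) ?_
  refine Run.nset_seq (v := 0) rfl ?_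
  generalize hs1 : State.setNat _ 4 0 0 = s1
  have hE1 : Env n m xs y s1 := by subst hs1; exact hE.congr (by simp) (by simp)
  have hN1 : Nodes n m xs F N s1 := by subst hs1; exact hN.congr (by simp) (by simp)
  have ha1 : s1.nat 13 = s.nat 13 := by subst hs1; simp
  refine Run.mono (Run.loop_count m 60 (fun j s' => s'.nat 4 0 = j ∧ 0 ≤ s'.real 14 0 ∧
      (∀ i < j, F (s.nat 13 0) (xs i) * y i ≤ s'.real 14 0) ∧
      (s'.real 14 0 = 0 ∨ ∃ i < m, s'.real 14 0 = F (s.nat 13 0) (xs i) * y i)) ?_ ?_ ?_) ?_ ?_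
  · subst hs1; simp
  · rintro j s' - hf ⟨h, -⟩
    simp [h, hf.nat 8 (by decide), hE1.m_eq]
  · rintro j s' hj hf ⟨h4, h0, hle, hex⟩
    have hE' : Env n m xs y s' := hE1.frame hf (by decide) (by decide)
    have hN' : Nodes n m xs F N s' := hN1.frame hf (by decide) (by decide)
    have g13 : s'.nat 13 = s.nat 13 := by rw [hf.nat 13 (by decide), ha1]
    have e1 : ((nodeVal (nvar 13) (nvar 4)).mul (.get 9 (nvar 4))).eval s' =
        F (s.nat 13 0) (xs j) * y j := by
      rw [RExp.eval, eval_nodeVal hN' (by simpa [g13]) (by simpa [h4])]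
      simp [RExp.eval, g13, h4, hE'.label j hj]
    refine Run.seq (T' := 40) (P := fun s'' => s''.nat 4 0 = j ∧ 0 ≤ s''.real 14 0 ∧
      (∀ i < j + 1, F (s.nat 13 0) (xs i) * y i ≤ s''.real 14 0) ∧
      (s''.real 14 0 = 0 ∨ ∃ i < m, s''.real 14 0 = F (s.nat 13 0) (xs i) * y i)) ?_ ?_
    · refine Run.ite (fun hb => ?_) fun hb => ?_
      · refine Run.rset e1 (by simp [Test.cost, RExp.cost, NExp.cost]) ?_
        simp only [Test.Holds, e1, RExp.eval_rvar] at hb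
        refine ⟨by simpa using h4, by simpa using h0.trans hb, fun i hi => ?_,
          .inr ⟨j, hj, by simp⟩⟩
        rcases Nat.lt_succ_iff_lt_or_eq.1 hi with hi | rfl
        · simpa using (hle i hi).trans hb
        · simp
      · refine Run.skip (by simp [Test.cost, RExp.cost, NExp.cost]) ?_
        simp only [Test.Holds, e1, RExp.eval_rvar, not_le] at hb
        refine ⟨h4, h0, fun i hi => ?_, hex⟩
        rcases Nat.lt_succ_iff_lt_or_eq.1 hi with hi | rfl
        · exact hle i hi
        · exact hb.le
    · rintro s'' - ⟨h4, h⟩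
      refine Run.nset (v := j + 1) (by simp [NExp.eval, h4]) (by simp [NExp.cost]) ?_
      simpa using h
  · simp [NExp.cost, RExp.cost, Test.cost]
    omega
  · rintro s' - ⟨-, h⟩
    exact h

/-- A coordinate is abandoned at its first counterexample, which is the witness in the last clause;
a coordinate that survives all samples is certified. -/
theorem run_findVar (hE : Env n m xs y s) (hN : Nodes n m xs F N s) (ha : s.nat 13 0 < N)
    (hm : 0 < m) :
    Run c ω findVar s (100 * (n * (m + 1)) + 100) fun s' => s'.nat 22 0 ≤ n ∧
      (s'.nat 22 0 < n → s.nat 15 (s'.nat 22 0) = 0 ∧ ∀ j < m,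
        F (s.nat 13 0) (xs j) * (1 - xs j (s'.nat 22 0)) * s.real 14 0 ≤ s.real 21 0 * y j) ∧
      ∀ i < s'.nat 22 0, s.nat 15 i = 0 → ∃ j < m,
        s.real 21 0 * y j < F (s.nat 13 0) (xs j) * (1 - xs j i) * s.real 14 0 := by
  unfold findVar
  refine Run.nset_seq (v := 0) rfl ?_
  refine Run.nset_seq (v := 0) rfl ?_
  generalize hs1 : State.setNat _ 4 0 0 = s1
  have hE1 : Env n m xs y s1 := by subst hs1; exact hE.congr (by simp) (by simp)
  have hN1 : Nodes n m xs F N s1 := by subst hs1; exact hN.congr (by simp) (by simp)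
  have h13 : s1.nat 13 = s.nat 13 := by subst hs1; simp
  have h15 : s1.nat 15 = s.nat 15 := by subst hs1; simp
  have r14 : s1.real 14 = s.real 14 := by subst hs1; simp
  have r21 : s1.real 21 = s.real 21 := by subst hs1; simp
  refine Run.mono (Run.loop (fun s' => s'.nat 22 0 ≤ n ∧ s'.nat 4 0 ≤ m ∧
      (0 < s'.nat 4 0 → s.nat 15 (s'.nat 22 0) = 0) ∧ (∀ j < s'.nat 4 0,
        F (s.nat 13 0) (xs j) * (1 - xs j (s'.nat 22 0)) * s.real 14 0 ≤ s.real 21 0 * y j) ∧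
      ∀ i < s'.nat 22 0, s.nat 15 i = 0 → ∃ j < m,
        s.real 21 0 * y j < F (s.nat 13 0) (xs j) * (1 - xs j i) * s.real 14 0)
      -- Ninety steps for each pair of a coordinate and a sample still ahead; abandoning a
      -- coordinate skips the rest of its row.
      (fun s' => 90 * ((n - s'.nat 22 0) * (m + 1) - s'.nat 4 0)) ?_ ?_) ?_ ?_
  · subst hs1; simp
  · rintro s' hf ⟨hi, hj, hmk, hall, hex⟩ hb
    have hE' : Env n m xs y s' := hE1.frame hf (by decide) (by decide)
    have hN' : Nodes n m xs F N s' := hN1.frame hf (by decide) (by decide)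
    simp only [Test.Holds, NExp.eval_nvar, NExp.eval, hE'.n_eq, hE'.m_eq] at hb
    obtain ⟨hi', hj'⟩ : s'.nat 22 0 < n ∧ s'.nat 4 0 < m := hb
    have g13 : s'.nat 13 = s.nat 13 := by rw [hf.nat 13 (by decide), h13]
    have g15 : s'.nat 15 = s.nat 15 := by rw [hf.nat 15 (by decide), h15]
    have q14 : s'.real 14 = s.real 14 := by rw [hf.real 14 (by decide), r14]
    have q21 : s'.real 21 = s.real 21 := by rw [hf.real 21 (by decide), r21]
    obtain ⟨d, hd⟩ : ∃ d, n - s'.nat 22 0 = d + 1 := ⟨n - s'.nat 22 0 - 1, by omega⟩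
    have hd' : (d + 1) * (m + 1) = d * (m + 1) + (m + 1) := by ring
    have e1 : (((nodeVal (nvar 13) (nvar 4)).mul
        (.sub (rlit 1) (coord (nvar 4) (nvar 22)))).mul (rvar 14)).eval s' =
        F (s.nat 13 0) (xs (s'.nat 4 0)) * (1 - xs (s'.nat 4 0) (s'.nat 22 0)) * s.real 14 0 := by
      change (nodeVal _ _).eval s' * (_ - (coord _ _).eval s') * _ = _
      rw [eval_nodeVal hN' (by simpa [g13]) (by simpa),
        eval_coord hE' (by simpa) (by simpa using hi)]
      simp [RExp.eval, NExp.eval, g13, q14]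
    have e2 : ((rvar 21).mul (.get 9 (nvar 4))).eval s' = s.real 21 0 * y (s'.nat 4 0) := by
      simp [RExp.eval, q21, hE'.label _ hj']
    refine ⟨70, Run.ite (fun hb => ?_) fun hb => ?_⟩
    all_goals
      simp only [Test.Holds, e1, e2] at hb
      simp only [NExp.eval, g15] at hb
    · refine Run.nset (v := s'.nat 4 0 + 1) (by simp [NExp.eval])
        (by simp [Test.cost, NExp.cost, RExp.cost]) ?_
      refine ⟨⟨by simpa, by simpa, fun _ => by simpa using hb.1, fun j hj => ?_, by simpa⟩, ?_⟩
      · simp only [State.setNat_nat] at hj ⊢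
        rcases Nat.lt_succ_iff_lt_or_eq.1 hj with hj | rfl
        · simpa using hall j hj
        · simpa using hb.2
      · simp [Test.cost, NExp.cost]
        rw [hd, hd']
        omega
    · refine Run.nset_seq (v := s'.nat 22 0 + 1) (by simp [NExp.eval]) ?_
      refine Run.nset (v := 0) rfl (by simp [Test.cost, NExp.cost, RExp.cost]) ?_
      refine ⟨⟨by simpa, by simp, by simp, by simp, fun i hi0 hi15 => ?_⟩, ?_⟩
      · simp only [State.setNat_nat] at hi0
        rcases Nat.lt_succ_iff_lt_or_eq.1 (by simpa using hi0) with hi0 | rfl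
        · exact hex i hi0 hi15
        · refine ⟨_, hj', ?_⟩
          by_contra! h
          exact hb ⟨hi15.le, h⟩
      · have : n - (s'.nat 22 0 + 1) = d := by omega
        simp [Test.cost, NExp.cost]
        rw [hd, hd', this]
        omega
  · simp [NExp.cost, RExp.cost, Test.cost]
    subst hs1
    simp
    omega
  · rintro s' hf ⟨⟨hi, hj, hmk, hall, hex⟩, hb⟩
    refine ⟨hi, fun hi' => ?_, hex⟩
    have hE' : Env n m xs y s' := hE1.frame hf (by decide) (by decide)
    have h4 : s'.nat 4 0 = m := by
      simp only [Test.Holds, NExp.eval_nvar, NExp.eval, hE'.n_eq, hE'.m_eq] at hb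
      have : ¬ (s'.nat 22 0 < n ∧ s'.nat 4 0 < m) := hb
      omega
    rw [h4] at hmk hall
    -- Since `0 < m`, at least one iteration has checked that this coordinate is unmarked.
    exact ⟨hmk hm, hall⟩

end

/-! ### The search for large Fourier coefficients -/

section

variable (K : ℕ) (ok : Finset ℕ → Prop) (v : ℕ)

open Classical in
/-- Add `T` with `v` inserted to the list if there is room and `ok` permits. -/
def tryInsert (l : List (Finset ℕ)) (T : Finset ℕ) : List (Finset ℕ) :=
  if l.length < K ∧ ok (insert v T) then l ++ [insert v T] else l

open Classical in
/-- Try to extend all members of the list by `v`, if `ok` permits `{v}`. -/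
def expandBy (l : List (Finset ℕ)) : List (Finset ℕ) :=
  if l.length < K ∧ ok {v} then l.foldl (tryInsert K ok v) l else l

open Classical in
/-- The sets of unmarked coordinates below `v` found by the search. -/
def search (marked : ℕ → Prop) : ℕ → List (Finset ℕ)
  | 0 => [∅]
  | v + 1 => if marked v then search marked v else expandBy K ok v (search marked v)

variable {K ok v}

theorem prefix_tryInsert (l : List (Finset ℕ)) (T : Finset ℕ) : l <+: tryInsert K ok v l T := by
  unfold tryInsert
  split_ifs
  · exact List.prefix_append _ _
  · exact List.prefix_rfl

theorem prefix_foldl_tryInsert (l l' : List (Finset ℕ)) :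
    l <+: l'.foldl (tryInsert K ok v) l := by
  induction l' generalizing l with
  | nil => exact List.prefix_rfl
  | cons T l' ih => exact (prefix_tryInsert l T).trans (ih _)

theorem length_tryInsert {l : List (Finset ℕ)} (T : Finset ℕ) (h : l.length ≤ K) :
    (tryInsert K ok v l T).length ≤ K := by
  unfold tryInsert
  split_ifs with h'
  · simpa using h'.1
  · exact h

theorem length_foldl_tryInsert {l : List (Finset ℕ)} (l' : List (Finset ℕ)) (h : l.length ≤ K) :
    (l'.foldl (tryInsert K ok v) l).length ≤ K := by
  induction l' generalizing l with
  | nil => exact h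
  | cons T l' ih => exact ih (length_tryInsert T h)

theorem length_expandBy {l : List (Finset ℕ)} (h : l.length ≤ K) :
    (expandBy K ok v l).length ≤ K := by
  unfold expandBy
  split_ifs
  · exact length_foldl_tryInsert l h
  · exact h

theorem length_search {marked : ℕ → Prop} (hK : 1 ≤ K) :
    (search K ok marked v).length ≤ K := by
  induction v with
  | zero => simpa [search]
  | succ v ih =>
    rw [search]
    split_ifs
    · exact ih
    · exact length_expandBy ih

theorem mem_tryInsert {l : List (Finset ℕ)} {T S : Finset ℕ} :
    S ∈ tryInsert K ok v l T ↔ S ∈ l ∨ (l.length < K ∧ ok (insert v T) ∧ S = insert v T) := by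
  unfold tryInsert
  split_ifs with h
  · simp [h]
  · simp only [iff_self_or]
    exact fun h' => (h ⟨h'.1, h'.2.1⟩).elim

theorem mem_foldl_tryInsert {l l' : List (Finset ℕ)} {S : Finset ℕ}
    (hS : S ∈ l'.foldl (tryInsert K ok v) l) : S ∈ l ∨ ok S ∧ ∃ T ∈ l', S = insert v T := by
  induction l' generalizing l with
  | nil => exact .inl hS
  | cons T l' ih =>
    rcases ih hS with h | ⟨h, T', hT', rfl⟩
    · rcases mem_tryInsert.1 h with h | ⟨-, hok, rfl⟩
      · exact .inl h
      · exact .inr ⟨hok, T, by simp, rfl⟩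
    · exact .inr ⟨h, T', by simp [hT'], rfl⟩

/-- The list only grows, so if it ends below the capacity there was room when `T` was tried. -/
theorem insert_mem_foldl_tryInsert {l l' : List (Finset ℕ)} {T : Finset ℕ} (hT : T ∈ l')
    (hok : ok (insert v T)) (hlen : (l'.foldl (tryInsert K ok v) l).length < K) :
    insert v T ∈ l'.foldl (tryInsert K ok v) l := by
  induction l' generalizing l with
  | nil => simp at hT
  | cons T' l' ih =>
    rcases List.mem_cons.1 hT with rfl | hT
    · refine (prefix_foldl_tryInsert _ l').subset (mem_tryInsert.2 (.inr ⟨?_, hok, rfl⟩))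
      exact ((prefix_foldl_tryInsert l (T :: l')).length_le).trans_lt hlen
    · exact ih hT hlen

theorem prefix_expandBy (l : List (Finset ℕ)) : l <+: expandBy K ok v l := by
  unfold expandBy
  split_ifs
  · exact prefix_foldl_tryInsert _ _
  · exact List.prefix_rfl

/-- The empty set stays at the head; its node is the root of the leaf, from which the singletons are
tested. -/
theorem search_ne_nil {marked : ℕ → Prop} :
    ∃ l', search K ok marked v = ∅ :: l' := by
  induction v with
  | zero => exact ⟨[], rfl⟩
  | succ v ih =>
    obtain ⟨l', h⟩ := ih
    rw [search]
    split_ifs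
    · exact ⟨l', h⟩
    · obtain ⟨t, ht⟩ := prefix_expandBy (K := K) (ok := ok) (v := v) (search K ok marked v)
      exact ⟨l' ++ t, by rw [← ht, h]; rfl⟩

/-- A nonempty set enters as the extension, by its largest coordinate, of a set found before. This
makes induction on the cardinality possible in the error analysis. -/
theorem mem_search {marked : ℕ → Prop} {T : Finset ℕ} (hT : T ∈ search K ok marked v) :
    (∀ i ∈ T, i < v ∧ ¬ marked i) ∧
      (T.Nonempty → ok T ∧ ∃ i ∈ T, T.erase i ∈ search K ok marked v) := by
  induction v generalizing T with
  | zero =>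
    obtain rfl : T = ∅ := by simpa [search] using hT
    simp
  | succ v ih =>
    rw [search] at hT ⊢
    have old : T ∈ search K ok marked v → (∀ i ∈ T, i < v + 1 ∧ ¬ marked i) ∧
        (T.Nonempty → ok T ∧ ∃ i ∈ T, T.erase i ∈ search K ok marked v) := fun h =>
      ⟨fun i hi => ⟨((ih h).1 i hi).1.trans v.lt_succ_self, ((ih h).1 i hi).2⟩, (ih h).2⟩
    split_ifs at hT ⊢ with hm
    · exact old hT
    · have sub := (prefix_expandBy (K := K) (ok := ok) (v := v) (search K ok marked v)).subset
      have key : T ∈ search K ok marked v ∨ ok T ∧ ∃ S ∈ search K ok marked v,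
          T = insert v S := by
        unfold expandBy at hT
        split_ifs at hT
        · exact mem_foldl_tryInsert hT
        · exact .inl hT
      rcases key with h | ⟨hok, S, hS, rfl⟩
      · refine ⟨(old h).1, fun hne => ⟨((old h).2 hne).1, ?_⟩⟩
        obtain ⟨i, hi, hi'⟩ := ((old h).2 hne).2
        exact ⟨i, hi, sub hi'⟩
      · have hv : v ∉ S := fun h => lt_irrefl _ ((ih hS).1 v h).1
        refine ⟨fun i hi => ?_, fun _ => ⟨hok, v, by simp, ?_⟩⟩
        · rcases Finset.mem_insert.1 hi with rfl | hi
          · exact ⟨i.lt_succ_self, hm⟩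
          · exact ⟨((ih hS).1 i hi).1.trans v.lt_succ_self, ((ih hS).1 i hi).2⟩
        · rw [Finset.erase_insert hv]
          exact sub hS

theorem nodup_search {marked : ℕ → Prop} : (search K ok marked v).Nodup := by
  induction v with
  | zero => simp [search]
  | succ v ih =>
    rw [search]
    split_ifs with hm
    · exact ih
    unfold expandBy
    split_ifs with h
    -- The scanned list and the accumulator are decoupled for the induction. Insertion of `v` is
    -- injective on sets without `v`.
    · suffices H : ∀ l l' : List (Finset ℕ), l.Nodup → l'.Nodup → (∀ T ∈ l', v ∉ T) →
          (∀ T ∈ l', insert v T ∉ l) → (l'.foldl (tryInsert K ok v) l).Nodup by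
        have hv : ∀ T ∈ search K ok marked v, v ∉ T := fun T hT hv =>
          lt_irrefl _ ((mem_search hT).1 v hv).1
        exact H _ _ ih ih hv fun T hT h => hv _ h (Finset.mem_insert_self _ _)
      intro l l' hl hl' hv hnot
      induction l' generalizing l with
      | nil => exact hl
      | cons T l' ih' =>
        simp only [List.nodup_cons, List.forall_mem_cons] at hl' hv hnot
        refine ih' _ ?_ hl'.2 hv.2 fun S hS hmem => ?_
        · unfold tryInsert
          split_ifs
          · simp [List.nodup_append, hl]
            rintro S hS rfl
            exact hnot.1 hS
          · exact hl
        · rcases mem_tryInsert.1 hmem with h | ⟨-, -, h⟩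
          · exact hnot.2 S hS h
          · have : S = T := by
              rw [← Finset.erase_insert (hv.2 S hS), h, Finset.erase_insert hv.1]
            exact hl'.1 (this ▸ hS)
    · exact ih

/-- If there was always room, then all sets with only permitted subsets were found. -/
theorem mem_search_of_ok {marked : ℕ → Prop} {T : Finset ℕ}
    (hlen : (search K ok marked v).length < K) (hT : ∀ i ∈ T, i < v ∧ ¬ marked i)
    (hok : ∀ S ⊆ T, S.Nonempty → ok S) : T ∈ search K ok marked v := by
  induction v generalizing T with
  | zero =>
    obtain rfl : T = ∅ := Finset.eq_empty_of_forall_notMem fun i hi => by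
      simpa using (hT i hi).1
    simp [search]
  | succ v ih =>
    rw [search] at hlen ⊢
    split_ifs at hlen ⊢ with hm
    · refine ih hlen (fun i hi => ⟨lt_of_le_of_ne (Nat.lt_succ_iff.1 (hT i hi).1) ?_,
        (hT i hi).2⟩) hok
      rintro rfl
      exact (hT i hi).2 hm
    · have hpre := prefix_expandBy (K := K) (ok := ok) (v := v) (search K ok marked v)
      have hlen' := hpre.length_le.trans_lt hlen
      by_cases hv : v ∈ T
      · have hmem : T.erase v ∈ search K ok marked v := by
          refine ih hlen' (fun i hi => ?_) fun S hS => hok S (hS.trans (Finset.erase_subset _ _))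
          have := hT i (Finset.mem_of_mem_erase hi)
          have := Finset.ne_of_mem_erase hi
          exact ⟨by omega, (hT i (Finset.mem_of_mem_erase hi)).2⟩
        -- The scan for `v` is made only if `{v}` is permitted, and `{v}` is one of the subsets
        -- covered by `hok`.
        have h1 : ok {v} := hok _ (by simpa) (by simp)
        unfold expandBy at hlen ⊢
        rw [if_pos ⟨hlen', h1⟩] at hlen ⊢
        rw [← Finset.insert_erase hv]
        exact insert_mem_foldl_tryInsert hmem
          (by rw [Finset.insert_erase hv]; exact hok T subset_rfl ⟨v, hv⟩) hlen
      · refine hpre.subset (ih hlen' (fun i hi => ?_) hok)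
        have := hT i hi
        exact ⟨by rcases Nat.lt_succ_iff_lt_or_eq.1 this.1 with h | rfl; exacts [h, (hv hi).elim],
          this.2⟩

end

/-! ### Execution of the search on one leaf. -/

section

variable {n m N : ℕ} {xs : ℕ → ℕ → ℝ} {y : ℕ → ℝ} {F : ℕ → (ℕ → ℝ) → ℝ} {H : (ℕ → ℝ) → ℝ}
  {s s' : State} {k : ℕ} {c : Cube k → ℝ} {ω : ℕ → Cube k}

/-- The correlation of the labels with `R` times the character of `T`. -/
def corr (m : ℕ) (xs : ℕ → ℕ → ℝ) (y : ℕ → ℝ) (R : (ℕ → ℝ) → ℝ) (T : Finset ℕ) : ℝ :=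
  ∑ j ∈ Finset.range m, y j * (R (xs j) * ∏ i ∈ T, xs j i)

/-- The hypothesis on a leaf with indicator `R`, given by the list of sets `l`. -/
def leafSum (m : ℕ) (xs : ℕ → ℕ → ℝ) (y : ℕ → ℝ) (R : (ℕ → ℝ) → ℝ) (sc : ℝ)
    (l : List (Finset ℕ)) (x : ℕ → ℝ) : ℝ :=
  (l.map fun T => corr m xs y R T * sc * (R x * ∏ i ∈ T, x i)).sum

/-- The nodes from `root` on represent the list of sets `l` of a leaf with indicator `R`. The
nodes below `root` represent the functions `F₀`. -/
structure Leaf (n m Q : ℕ) (xs : ℕ → ℕ → ℝ) (y : ℕ → ℝ) (F₀ : ℕ → (ℕ → ℝ) → ℝ)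
    (H : (ℕ → ℝ) → ℝ) (R : (ℕ → ℝ) → ℝ) (sc thr : ℝ) (root : ℕ) (l : List (Finset ℕ))
    (s : State) : Prop where
  env : Env n m xs y s
  root_eq : s.nat 18 0 = root
  bound : s.real 6 0 = Q
  scale : s.real 16 0 = sc
  threshold : s.real 18 0 = thr
  nodes : ∃ F, Nodes n m xs F (root + l.length) s ∧
    Combines F (root + l.length) (fun x => H x + leafSum m xs y R sc l x) s ∧
    (∀ k < root, F k = F₀ k) ∧
    ∀ t (ht : t < l.length), ∀ x, F (root + t) x = R x * ∏ i ∈ l[t], x i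

variable {Q root : ℕ} {F₀ : ℕ → (ℕ → ℝ) → ℝ} {R : (ℕ → ℝ) → ℝ} {sc thr : ℝ}
  {l : List (Finset ℕ)}

theorem Leaf.congr (h : Leaf n m Q xs y F₀ H R sc thr root l s)
    (hn : ∀ a ∈ [0, 7, 8, 9, 10, 11, 12, 18], s'.nat a = s.nat a)
    (hr : ∀ a ∈ [6, 8, 9, 10, 11, 12, 13, 16, 18], s'.real a = s.real a) :
    Leaf n m Q xs y F₀ H R sc thr root l s' := by
  obtain ⟨F, h1, h2, h3, h4⟩ := h.nodes
  refine ⟨h.env.congr (fun a ha => hn a ?_) fun a ha => hr a ?_, ?_, ?_, ?_, ?_, F,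
    h1.congr (fun a ha => hn a ?_) fun a ha => hr a ?_, ?_, h3, h4⟩
  · revert a; decide
  · revert a; decide
  · rw [hn 18 (by decide)]; exact h.root_eq
  · rw [hr 6 (by decide)]; exact h.bound
  · rw [hr 16 (by decide)]; exact h.scale
  · rw [hr 18 (by decide)]; exact h.threshold
  · revert a; decide
  · revert a; decide
  · intro x
    rw [hr 13 (by decide)]
    exact h2 x

theorem Leaf.count (h : Leaf n m Q xs y F₀ H R sc thr root l s) :
    s.nat 10 0 = root + l.length := by
  obtain ⟨F, h1, -⟩ := h.nodes
  exact h1.count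

theorem Leaf.hasRoom_iff (h : Leaf n m Q xs y F₀ H R sc thr root l s) :
    hasRoom.Holds s ↔ l.length < Q + 2 := by
  simp only [Test.Holds, RExp.eval, NExp.eval, NExp.eval_nvar, h.count, h.root_eq, h.bound,
    RExp.eval_rvar]
  rw [show root + l.length + 1 - root = l.length + 1 by omega]
  norm_cast

/-- A new node of a leaf, staged. -/
theorem Leaf.run_newNode (h : Leaf n m Q xs y F₀ H R sc thr root l s) {t v : ℕ}
    (ht : t < l.length) (h16 : s.nat 16 0 = root + t) (h17 : s.nat 17 0 = v) (hv : v ≤ n)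
    (hvt : v ∉ l[t]) (h19 : s.real 19 0 = 0) (h20 : s.real 20 0 = 1) :
    Run c ω newNode s (80 * m + 80) fun s' => Leaf n m Q xs y F₀ H R sc thr root l s' ∧
      s'.real 17 0 = corr m xs y R (insert v l[t]) ∧ ∀ z,
      z = corr m xs y R (insert v l[t]) * sc →
      Leaf n m Q xs y F₀ H R sc thr root (l ++ [insert v l[t]])
        ((s'.setReal 13 (root + l.length) z).setNat 10 0 (root + l.length + 1)) := by
  obtain ⟨F, h1, h2, h3, h4⟩ := h.nodes
  have hG : ∀ x : ℕ → ℝ, R x * ∏ i ∈ insert v l[t], x i =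
      F (s.nat 16 0) x * (s.real 19 0 + s.real 20 0 * x (s.nat 17 0)) := fun x => by
    rw [h16, h17, h19, h20, h4 t ht, Finset.prod_insert hvt]
    ring
  refine (Learner.run_newNode h.env h1 (by omega) (by omega) hG).mono le_rfl ?_
  rintro s' hf ⟨hE', hN', hS'⟩
  have hL : Leaf n m Q xs y F₀ H R sc thr root l s' := by
    refine ⟨hE', ?_, ?_, ?_, ?_, F, hN', h2.frame hf (by decide), h3, h4⟩
    · rw [hf.nat 18 (by decide), h.root_eq]
    · rw [hf.real 6 (by decide), h.bound]
    · rw [hf.real 16 (by decide), h.scale]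
    · rw [hf.real 18 (by decide), h.threshold]
  refine ⟨hL, hS'.sum, fun z hz => ?_⟩
  obtain ⟨k1, k2⟩ := hS'.keep (z := z) hN' (h2.frame hf (by decide))
  refine ⟨hE'.congr (by simp) (by simp), by simpa using hL.root_eq, by simpa using hL.bound,
    by simpa using hL.scale, by simpa using hL.threshold,
    Function.update F (root + l.length) fun x => R x * ∏ i ∈ insert v l[t], x i,
    ?_, ?_, fun k hk => ?_, ?_⟩
  · rw [List.length_append]; exact k1
  · rw [List.length_append]
    intro x
    refine (k2 x).trans ?_
    simp [leafSum, hz, add_assoc]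
  · rw [Function.update_of_ne (by omega), h3 k hk]
  · intro t' ht' x
    rw [List.length_append, List.length_singleton, Nat.lt_succ_iff_lt_or_eq] at ht'
    rcases ht' with ht' | rfl
    · rw [Function.update_of_ne (by omega), h4 t' ht', List.getElem_append_left ht']
    · simp

open Classical in
/-- Extending the node `t` of a leaf by the coordinate `v`. -/
theorem Leaf.run_insert (h : Leaf n m Q xs y F₀ H R sc thr root l s) {t v : ℕ}
    (ht : t < l.length) (h16 : s.nat 16 0 = root + t) (h17 : s.nat 17 0 = v) (hv : v ≤ n)
    (hvt : v ∉ l[t]) (h19 : s.real 19 0 = 0) (h20 : s.real 20 0 = 1) :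
    Run c ω (newNode ;; .ite isLarge (keep (.mul (rvar 17) (rvar 16))) .skip) s (80 * m + 130)
      fun s' => Leaf n m Q xs y F₀ H R sc thr root
        (if corr m xs y R (insert v l[t]) + thr < 0 then l ++ [insert v l[t]] else l) s' := by
  refine Run.seq (h.run_newNode ht h16 h17 hv hvt h19 h20) ?_
  rintro s' hf ⟨hL, hS, hk⟩
  refine Run.ite (fun hb => ?_) fun hb => ?_
  · obtain ⟨F, h1, -⟩ := hL.nodes
    refine (run_keep h1 (z := corr m xs y R (insert v l[t]) * sc) ?_ ?_).mono le_rfl ?_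
    · simp [RExp.eval, hS, hL.scale]
    · simp [Test.cost, RExp.cost, NExp.cost]
    · rintro s'' - rfl
      rw [if_pos]
      · exact hk _ rfl
      · simpa [Test.Holds, RExp.eval, hS, hL.threshold] using hb
  · refine Run.skip (by simp [Test.cost, RExp.cost, NExp.cost]) ?_
    rw [if_neg]
    · exact hL
    · simpa [Test.Holds, RExp.eval, hS, hL.threshold] using hb

theorem Leaf.run_expandVar (h : Leaf n m Q xs y F₀ H R sc thr root l s) {v : ℕ}
    (h17 : s.nat 17 0 = v) (hv : v ≤ n) (hvl : ∀ T ∈ l, v ∉ T) (hl : l.length ≤ Q + 2)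
    (h19 : s.real 19 0 = 0) (h20 : s.real 20 0 = 1) :
    Run c ω expandVar s ((Q + 2) * (80 * m + 200) + 50)
      fun s' => Leaf n m Q xs y F₀ H R sc thr root
        (l.foldl (tryInsert (Q + 2) (fun T => corr m xs y R T + thr < 0) v) l) s' := by
  unfold expandVar
  refine Run.nset_seq (v := root) (by simp [h.root_eq]) ?_
  refine Run.nset_seq (v := root + l.length) (by simp [h.count]) ?_
  generalize hs1 : State.setNat _ 21 0 _ = s1
  have hL1 : Leaf n m Q xs y F₀ H R sc thr root l s1 := by
    subst hs1; exact h.congr (by simp) (by simp)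
  have h21 : s1.nat 21 0 = root + l.length := by subst hs1; simp
  have k17 : s1.nat 17 0 = v := by subst hs1; simpa
  have k19 : s1.real 19 0 = 0 := by subst hs1; simpa
  have k20 : s1.real 20 0 = 1 := by subst hs1; simpa
  refine Run.mono (Run.loop_count l.length (80 * m + 180) (fun p s' => s'.nat 20 0 = root + p ∧
    Leaf n m Q xs y F₀ H R sc thr root
      ((l.take p).foldl (tryInsert (Q + 2) (fun T => corr m xs y R T + thr < 0) v) l) s')
    ?_ ?_ ?_) ?_ ?_
  · refine ⟨by subst hs1; simp, by simpa using hL1⟩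
  · rintro p s' - hf ⟨hp, -⟩
    simp [hp, hf.nat 21 (by decide), h21]
  · rintro p s' hp hf ⟨k1, k2⟩
    set l' := (l.take p).foldl (tryInsert (Q + 2) (fun T => corr m xs y R T + thr < 0) v) l
    have hpre : l <+: l' := prefix_foldl_tryInsert _ _
    have hp' : p < l'.length := hp.trans_le hpre.length_le
    -- Appending does not move earlier entries, so node `p` is still the one of the original list.
    have hget : l'[p] = l[p] := (hpre.getElem hp).symm
    have hnext : (l.take (p + 1)).foldl
        (tryInsert (Q + 2) (fun T => corr m xs y R T + thr < 0) v) l =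
        tryInsert (Q + 2) (fun T => corr m xs y R T + thr < 0) v l' l[p] := by
      rw [List.take_succ_eq_append_getElem hp, List.foldl_append]
      rfl
    refine Run.seq (T' := 80 * m + 170) (P := fun s'' => s''.nat 20 0 = root + p ∧
      Leaf n m Q xs y F₀ H R sc thr root
        (tryInsert (Q + 2) (fun T => corr m xs y R T + thr < 0) v l' l[p]) s'') ?_ ?_
    · refine Run.ite (fun hb => ?_) fun hb => ?_
      · refine Run.nset_seq (v := root + p) k1 ?_
        generalize hs2 : State.setNat _ 16 0 _ = s2
        have hL2 : Leaf n m Q xs y F₀ H R sc thr root l' s2 := by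
          subst hs2; exact k2.congr (by simp) (by simp)
        refine (hL2.run_insert hp' ?_ (v := v) ?_ hv ?_ ?_ ?_).mono ?_ ?_
        · subst hs2; simp
        · subst hs2; simp [hf.nat 17 (by decide), k17]
        · rw [hget]; exact hvl _ (List.getElem_mem _)
        · subst hs2; simp [hf.real 19 (by decide), k19]
        · subst hs2; simp [hf.real 20 (by decide), k20]
        · simp [Test.cost, RExp.cost, NExp.cost]
        · intro s'' hf' hL
          refine ⟨?_, ?_⟩
          · rw [hf'.nat 20 (by decide)]; subst hs2; simpa
          · rw [k2.hasRoom_iff] at hb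
            rw [hget] at hL
            unfold tryInsert
            convert hL using 2
            simp [hb]
      · refine Run.skip (by simp [Test.cost, RExp.cost, NExp.cost]) ⟨k1, ?_⟩
        rw [k2.hasRoom_iff] at hb
        rw [tryInsert, if_neg fun h => hb h.1]
        exact k2
    · rintro s'' - ⟨k1, k2⟩
      refine Run.nset (v := root + (p + 1)) (by simp [NExp.eval, k1, add_assoc])
        (by simp [NExp.cost]) ⟨by simp, ?_⟩
      rw [hnext]
      exact k2.congr (by simp) (by simp)
  · simp [Test.cost, RExp.cost, NExp.cost]
    have := Nat.mul_le_mul_right (80 * m + 180 + 6) hl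
    ring_nf at this ⊢
    omega
  · rintro s' - ⟨-, hL⟩
    simpa using hL

end

section

variable {n m N : ℕ} {xs : ℕ → ℕ → ℝ} {y : ℕ → ℝ} {F : ℕ → (ℕ → ℝ) → ℝ} {H : (ℕ → ℝ) → ℝ}
  {s s' : State} {k : ℕ} {c : Cube k → ℝ} {ω : ℕ → Cube k} {Q root : ℕ}
  {F₀ : ℕ → (ℕ → ℝ) → ℝ} {R : (ℕ → ℝ) → ℝ} {sc thr : ℝ} {l : List (Finset ℕ)}

/-- The scan meets `∅` first, while there is room, and appends `{v}`. So every scan uses up a free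
place, which bounds the number of scans by the capacity. -/
theorem length_lt_foldl_tryInsert {K v : ℕ} {ok : Finset ℕ → Prop} {l l' : List (Finset ℕ)}
    (hl : l = ∅ :: l') (hK : l.length < K) (hv : ok {v}) :
    l.length < (l.foldl (tryInsert K ok v) l).length := by
  have h : tryInsert K ok v l ∅ = l ++ [{v}] := by
    rw [tryInsert, if_pos ⟨hK, by simpa using hv⟩]
    simp
  have hpre : l ++ [{v}] <+: l.foldl (tryInsert K ok v) l := by
    have h' : ∀ l₁, (∅ :: l').foldl (tryInsert K ok v) l₁ =
        l'.foldl (tryInsert K ok v) (tryInsert K ok v l₁ ∅) := fun _ => rfl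
    rw [← h]
    nth_rw 3 [hl]
    rw [h']
    exact prefix_foldl_tryInsert (K := K) (ok := ok) (v := v) _ l'
  have := hpre.length_le
  rw [List.length_append, List.length_singleton] at this
  omega

/-- A bound for the time to search a leaf. -/
abbrev leafTime (n m Q : ℕ) : ℕ :=
  n * (80 * m + 300) + (Q + 2) * ((Q + 2) * (80 * m + 200) + 50) + 50

theorem Leaf.run_expandLeaf (h : Leaf n m Q xs y F₀ H R sc thr root [∅] s) :
    Run c ω expandLeaf s (leafTime n m Q) fun s' => Leaf n m Q xs y F₀ H R sc thr root
      (search (Q + 2) (fun T => corr m xs y R T + thr < 0) (fun i => 0 < s.nat 15 i) n) s' := by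
  set S := search (Q + 2) (fun T => corr m xs y R T + thr < 0) (fun i => 0 < s.nat 15 i)
  unfold expandLeaf
  refine Run.rset_seq (v := 0) (by simp [RExp.eval]) ?_
  refine Run.rset_seq (v := 1) (by simp [RExp.eval]) ?_
  refine Run.nset_seq (v := 0) rfl ?_
  generalize hs1 : State.setNat _ 19 0 _ = s1
  have hL1 : Leaf n m Q xs y F₀ H R sc thr root [∅] s1 := by
    subst hs1; exact h.congr (by simp) (by simp)
  have k15 : s1.nat 15 = s.nat 15 := by subst hs1; simp
  set B := (Q + 2) * (80 * m + 200) + 50 with hB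
  refine Run.mono (Run.loop (fun s' => s'.nat 19 0 ≤ n ∧ s'.real 19 0 = 0 ∧ s'.real 20 0 = 1 ∧
      Leaf n m Q xs y F₀ H R sc thr root (S (s'.nat 19 0)) s')
      -- Each coordinate pays for one trial of a singleton, each free place of the list for one scan
      -- of cost at most `B`. This gives order `n * m + Q ^ 2 * m` instead of `n * Q * m`.
      (fun s' => (n - s'.nat 19 0) * (80 * m + 300) + (Q + 2 + root - s'.nat 10 0) * B)
      ?_ ?_) ?_ ?_
  · subst hs1; simpa [S, search] using hL1
  · rintro s' hf ⟨hv, h19, h20, hL⟩ hb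
    generalize hv' : s'.nat 19 0 = v at hv hL
    simp only [Test.holds_natLt, NExp.eval_nvar, hL.env.n_eq, hv'] at hb
    obtain ⟨d, hd⟩ : ∃ d, n - v = d + 1 := ⟨n - v - 1, by omega⟩
    have hd' : n - (v + 1) = d := by omega
    have h15 : s'.nat 15 = s.nat 15 := by rw [hf.nat 15 (by decide), k15]
    have hlen : (S v).length ≤ Q + 2 := length_search (by omega)
    obtain ⟨l', hl'⟩ : ∃ l', S v = ∅ :: l' := search_ne_nil
    have hpos : 0 < (S v).length := by simp [hl']
    have hget : (S v)[0] = ∅ := by simp [hl']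
    have hvl : ∀ T ∈ S v, v ∉ T := fun T hT hv => lt_irrefl _ ((mem_search hT).1 v hv).1
    have hcount := hL.count
    -- `g = 1` if the list is scanned, and then the list becomes longer by at least one; otherwise
    -- `g = 0`.
    suffices H : ∃ g T, g ≤ 1 ∧ (S v).length + g ≤ (S (v + 1)).length ∧
        T ≤ 80 * m + 280 + g * B ∧ Run c ω (.ite (.and (.natLe (.get 15 (nvar 19)) (.lit 0)) hasRoom)
          (nset 16 (nvar 18) ;; nset 17 (nvar 19) ;; newNode ;; .ite isLarge expandVar .skip)
          .skip) s' T fun s'' => Leaf n m Q xs y F₀ H R sc thr root (S (v + 1)) s'' by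
      obtain ⟨g, T, hg, hg', hT, hrun⟩ := H
      have hlen1 : (S (v + 1)).length ≤ Q + 2 := length_search (by omega)
      refine ⟨T + 6, Run.seq hrun fun s'' hf' hL' => ?_⟩
      refine Run.nset (v := v + 1) (by simp [NExp.eval, hf'.nat 19 (by decide), hv'])
        (by simp [NExp.cost]) ⟨⟨by simp; omega, ?_, ?_, ?_⟩, ?_⟩
      · simpa [hf'.real 19 (by decide)] using h19
      · simpa [hf'.real 20 (by decide)] using h20
      · simpa using hL'.congr (by simp) (by simp)
      · simp only [Test.cost, NExp.cost, hcount, State.setNat_nat, hv', hd]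
        rw [if_pos ⟨trivial, trivial⟩, if_neg (by simp), hd', hL'.count]
        have e1 : Q + 2 + root - (root + (S v).length) = Q + 2 - (S v).length := by omega
        have e2 : Q + 2 + root - (root + (S (v + 1)).length) = Q + 2 - (S (v + 1)).length := by
          omega
        rw [e1, e2]
        have e3 : (Q + 2 - (S (v + 1)).length + g) * B ≤ (Q + 2 - (S v).length) * B :=
          Nat.mul_le_mul_right _ (by omega)
        have e4 : (d + 1) * (80 * m + 300) = d * (80 * m + 300) + (80 * m + 300) := by ring
        rw [add_mul] at e3
        omega
    have hS : S (v + 1) = if 0 < s.nat 15 v then S v else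
        expandBy (Q + 2) (fun T => corr m xs y R T + thr < 0) v (S v) := by
      simp only [S, search]
      split_ifs <;> rfl
    have hex : expandBy (Q + 2) (fun T => corr m xs y R T + thr < 0) v (S v) =
      if (S v).length < Q + 2 ∧ corr m xs y R {v} + thr < 0 then
        (S v).foldl (tryInsert (Q + 2) (fun T => corr m xs y R T + thr < 0) v) (S v)
      else S v := by simp only [expandBy]
    have hcond : (Test.and (.natLe (.get 15 (nvar 19)) (.lit 0)) hasRoom).Holds s' ↔
        ¬ 0 < s.nat 15 v ∧ (S v).length < Q + 2 := by
      rw [← hL.hasRoom_iff]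
      simp only [Test.Holds, NExp.eval, h15, NExp.eval_nvar, hv', not_lt]
    have hmain : ¬ 0 < s.nat 15 v → (S v).length < Q + 2 → ∀ T,
        (∀ s'', (nset 16 (nvar 18) ;; nset 17 (nvar 19) ;; newNode).Frame s' s'' →
          Leaf n m Q xs y F₀ H R sc thr root (S v) s'' → s''.nat 17 0 = v →
          s''.real 17 0 = corr m xs y R {v} → Run c ω (.ite isLarge expandVar .skip) s'' T
            fun s'' => Leaf n m Q xs y F₀ H R sc thr root (S (v + 1)) s'') →
        Run c ω (nset 16 (nvar 18) ;; nset 17 (nvar 19) ;; newNode ;; .ite isLarge expandVar .skip)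
          s' (80 * m + 100 + T) fun s'' => Leaf n m Q xs y F₀ H R sc thr root (S (v + 1)) s'' := by
      intro hm hr T hT
      refine Run.nset_seq (v := root) (by simp [hL.root_eq]) ?_
      refine Run.nset_seq (v := v) (by simp [hv']) ?_
      generalize hs2 : State.setNat _ 17 0 _ = s2
      have hL2 : Leaf n m Q xs y F₀ H R sc thr root (S v) s2 := by
        subst hs2; exact hL.congr (by simp) (by simp)
      refine Run.seq (hL2.run_newNode hpos (v := v) ?_ ?_ hv ?_ ?_ ?_) ?_
      · subst hs2; simp
      · subst hs2; simp
      · rw [hget]; simp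
      · subst hs2; simpa
      · subst hs2; simpa
      · rintro s3 hf3 ⟨hL3, hS3, -⟩
        refine (hT s3 ⟨fun a ha => ?_, fun a ha => ?_, fun ha => ?_⟩ hL3 ?_ ?_).le ?_
        · simp only [Cmd.natWrites, List.mem_append, List.mem_singleton, not_or] at ha
          rw [hf3.nat a ha.2.2]
          subst hs2
          simp [ha.1, ha.2.1]
        · simp only [Cmd.realWrites, List.mem_append, List.mem_singleton, not_or] at ha
          rw [hf3.real a ha.2.2]
          subst hs2
          rfl
        · rw [hf3.used ha.2.2]
          subst hs2
          rfl
        · rw [hf3.nat 17 (by decide)]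
          subst hs2
          simp
        · rw [hS3, hget]
          simp
        · simp [NExp.cost]
          omega
    have hlarge : ∀ s'', Leaf n m Q xs y F₀ H R sc thr root (S v) s'' →
        s''.real 17 0 = corr m xs y R {v} →
        (isLarge.Holds s'' ↔ corr m xs y R {v} + thr < 0) := by
      intro s'' hL'' h17
      simp [Test.Holds, RExp.eval, h17, hL''.threshold]
    by_cases hm : 0 < s.nat 15 v
    · rw [if_pos hm] at hS
      refine ⟨0, 60, by simp, by rw [hS]; simp, by omega, Run.ite (fun hb => ?_) fun hb => ?_⟩
      · exact ((hcond.1 hb).1 hm).elim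
      · refine Run.skip (by simp [Test.cost, NExp.cost, RExp.cost]) (hS ▸ hL)
    rw [if_neg hm, hex] at hS
    by_cases hr : (S v).length < Q + 2
    · by_cases hok : corr m xs y R {v} + thr < 0
      · rw [if_pos ⟨hr, hok⟩] at hS
        refine ⟨1, 80 * m + 200 + B, le_rfl, ?_, by omega, Run.ite (fun hb => ?_) fun hb => ?_⟩
        · rw [hS]
          exact length_lt_foldl_tryInsert hl' hr hok
        · refine (hmain hm hr (B + 20) fun s3 hf3 hL3 h17 hS3 => ?_).le ?_
          · refine Run.ite (fun hb => ?_) fun hb => ?_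
            · refine (hL3.run_expandVar h17 hv hvl hlen ?_ ?_).mono ?_ ?_
              · rw [hf3.real 19 (by decide), h19]
              · rw [hf3.real 20 (by decide), h20]
              · simp [Test.cost, NExp.cost, RExp.cost]
                omega
              · intro s4 _ h4
                rw [hS]
                exact h4
            · exact (hb ((hlarge s3 hL3 hS3).2 hok)).elim
          · simp [Test.cost, NExp.cost, RExp.cost]
            omega
        · exact (hb (hcond.2 ⟨hm, hr⟩)).elim
      · rw [if_neg fun h => hok h.2] at hS
        refine ⟨0, 80 * m + 200, by simp, by rw [hS]; simp, by omega,
          Run.ite (fun hb => ?_) fun hb => ?_⟩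
        · refine (hmain hm hr 20 fun s3 hf3 hL3 h17 hS3 => ?_).le ?_
          · refine Run.ite (fun hb => ?_) fun hb => ?_
            · exact (hok ((hlarge s3 hL3 hS3).1 hb)).elim
            · exact Run.skip (by simp [Test.cost, NExp.cost, RExp.cost]) (hS ▸ hL3)
          · simp [Test.cost, NExp.cost, RExp.cost]
        · exact (hb (hcond.2 ⟨hm, hr⟩)).elim
    · rw [if_neg fun h => hr h.1] at hS
      refine ⟨0, 60, by simp, by rw [hS]; simp, by omega, Run.ite (fun hb => ?_) fun hb => ?_⟩
      · exact (hr (hcond.1 hb).2).elim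
      · refine Run.skip (by simp [Test.cost, NExp.cost, RExp.cost]) (hS ▸ hL)
  · have h10 : s1.nat 10 0 = root + 1 := hL1.count
    have h19 : s1.nat 19 0 = 0 := by subst hs1; simp
    simp only [h10, h19]
    have : (Q + 2 + root - (root + 1)) * B ≤ (Q + 2) * B := Nat.mul_le_mul_right _ (by omega)
    simp [Test.cost, NExp.cost, RExp.cost, leafTime]
    rw [← hB]
    omega
  · rintro s' hf ⟨⟨hv, h19, h20, hL⟩, hb⟩
    simp only [Test.holds_natLt, NExp.eval_nvar, hL.env.n_eq] at hb
    rwa [show s'.nat 19 0 = n by omega] at hL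

end

/-! ### Opening and closing a leaf. -/

section

variable {n m N : ℕ} {xs : ℕ → ℕ → ℝ} {y : ℕ → ℝ} {F : ℕ → (ℕ → ℝ) → ℝ} {H : (ℕ → ℝ) → ℝ}
  {s s' : State} {k : ℕ} {c : Cube k → ℝ} {ω : ℕ → Cube k} {Q root : ℕ}
  {F₀ : ℕ → (ℕ → ℝ) → ℝ} {R : (ℕ → ℝ) → ℝ} {sc thr : ℝ} {l : List (Finset ℕ)}

/-- The coefficient of `∅` is kept without a test: it is the mean over the leaf, and only the other
coefficients of a coverage function are necessarily nonpositive. -/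
theorem run_newLeaf (hE : Env n m xs y s) (hN : Nodes n m xs F N s) (hH : Combines F N H s)
    (ha : s.nat 13 0 < N) (hi : s.nat 22 0 ≤ n) (hQ : s.real 6 0 = Q)
    (hR : ∀ x, R x = F (s.nat 13 0) x * ((1 - x (s.nat 22 0)) / 2))
    (hsc : sc = (if s.nat 22 0 < n then 2 * s.real 15 0 else s.real 15 0) /
      (m * (1 + s.real 3 0 / 4)))
    (hthr : thr = 4 * s.real 14 0 * m / Q) :
    Run c ω newLeaf s (80 * m + 250) fun s' => Leaf n m Q xs y F H R sc thr N [∅] s' ∧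
      s'.nat 15 = Function.update (s.nat 15) (s.nat 22 0) 1 := by
  unfold newLeaf
  refine Run.setNat_seq (iv := s.nat 22 0) (v := 1) rfl rfl ?_
  generalize hs1 : State.setNat _ 15 _ _ = s1
  have k15 : s1.nat 15 = Function.update (s.nat 15) (s.nat 22 0) 1 := by
    subst hs1; simp [State.setNat]
  have f1 : ∀ a, a ≠ 15 → s1.nat a = s.nat a := fun a ha => by subst hs1; simp [ha]
  have f1' : s1.real = s.real := by subst hs1; simp
  refine Run.seq (T' := 30) (P := fun s2 =>
    s2.real 16 0 = if s.nat 22 0 < n then 2 * s.real 15 0 else s.real 15 0) ?_ ?_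
  · refine Run.ite (fun hb => ?_) fun hb => ?_
    all_goals
      simp only [Test.holds_natLt, NExp.eval_nvar, f1 22 (by decide), f1 0 (by decide),
        hE.n_eq] at hb
    · refine Run.rset (v := 2 * s.real 15 0) (by simp [RExp.eval, f1'])
        (by simp [Test.cost, NExp.cost, RExp.cost]) ?_
      simp [hb]
    · refine Run.rset (v := s.real 15 0) (by simp [RExp.eval, f1'])
        (by simp [Test.cost, NExp.cost, RExp.cost]) ?_
      simp [hb]
  intro s2 hf2 h16
  have f2 : ∀ a, s2.nat a = s1.nat a := fun a => hf2.nat a (by simp [Cmd.natWrites])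
  have f2' : ∀ a, a ≠ 16 → s2.real a = s.real a := fun a ha => by
    rw [hf2.real a (by simp [Cmd.realWrites, ha]), f1']
  refine Run.rset_seq (v := sc) ?_ ?_
  · simp [RExp.eval, h16, hsc, f2, f2', f1, hE.m_eq]
  refine Run.rset_seq (v := thr) ?_ ?_
  · simp [RExp.eval, hthr, f2, f2', f1, hE.m_eq, hQ]
  refine Run.nset_seq (v := N) (by simp [f2, f1, hN.count]) ?_
  refine Run.nset_seq (v := s.nat 13 0) (by simp [f2, f1]) ?_
  refine Run.nset_seq (v := s.nat 22 0) (by simp [f2, f1]) ?_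
  refine Run.rset_seq (v := 1 / 2) (by simp [RExp.eval]) ?_
  refine Run.rset_seq (v := 0 - 1 / 2) (by simp [RExp.eval]) ?_
  generalize hs3 : State.setReal _ 20 0 _ = s3
  have hE3 : Env n m xs y s3 := by subst hs3; exact hE.congr (by simp [f2, f1]) (by simp [f2'])
  have hN3 : Nodes n m xs F N s3 := by
    subst hs3; exact hN.congr (by simp [f2, f1]) (by simp [f2'])
  have hH3 : Combines F N H s3 := by
    subst hs3; intro x; simpa [f2'] using hH x
  have e16 : s3.nat 16 0 = s.nat 13 0 := by subst hs3; simp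
  have e17 : s3.nat 17 0 = s.nat 22 0 := by subst hs3; simp
  have e19 : s3.real 19 0 = 1 / 2 := by subst hs3; simp
  have e20 : s3.real 20 0 = 0 - 1 / 2 := by subst hs3; simp
  have e15 : s3.nat 15 = Function.update (s.nat 15) (s.nat 22 0) 1 := by
    subst hs3; simp [f2, k15]
  have e18 : s3.nat 18 0 = N := by subst hs3; simp
  have g6 : s3.real 6 0 = Q := by subst hs3; simp [f2', hQ]
  have g16 : s3.real 16 0 = sc := by subst hs3; simp
  have g18 : s3.real 18 0 = thr := by subst hs3; simp
  refine Run.seq (run_newNode hE3 hN3 (G := R) (by omega) (by omega) fun x => ?_) ?_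
  · rw [e16, e17, e19, e20, hR]
    ring
  rintro s4 hf4 ⟨hE4, hN4, hS4⟩
  have hsum : s4.real 17 0 = corr m xs y R ∅ := by simp [hS4.sum, corr]
  obtain ⟨k1, k2⟩ := hS4.keep (z := corr m xs y R ∅ * sc) hN4 (hH3.frame hf4 (by decide))
  refine (run_keep hN4 (z := corr m xs y R ∅ * sc) ?_ le_rfl).mono ?_ ?_
  · simp [RExp.eval, hsum, hf4.real 16 (by decide), g16]
  · simp [NExp.cost, RExp.cost]
  · rintro s5 - rfl
    refine ⟨⟨hE4.congr (by simp) (by simp), ?_, ?_, ?_, ?_, Function.update F N R, k1, ?_, ?_, ?_⟩,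
      ?_⟩
    · simp [hf4.nat 18 (by decide), e18]
    · simp [hf4.real 6 (by decide), g6]
    · simp [hf4.real 16 (by decide), g16]
    · simp [hf4.real 18 (by decide), g18]
    · intro x
      refine (k2 x).trans ?_
      simp [leafSum]
    · intro k hk
      rw [Function.update_of_ne hk.ne]
    · intro t ht x
      obtain rfl : t = 0 := by simpa using ht
      simp
    · simp [hf4.nat 15 (by decide), e15]

theorem Leaf.run_closeLeaf (h : Leaf n m Q xs y F₀ H R sc thr root l s)
    (ha : s.nat 13 0 < root) (hi : s.nat 22 0 ≤ n) {A : (ℕ → ℝ) → ℝ}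
    (hA : ∀ x, A x = F₀ (s.nat 13 0) x * ((1 + x (s.nat 22 0)) / 2)) :
    Run c ω closeLeaf s (80 * m + 200) fun s' => Env n m xs y s' ∧
      s'.real 15 0 = 2 * s.real 15 0 ∧ s'.nat 13 0 = root + l.length ∧
      ∃ F, Nodes n m xs F (root + l.length + 1) s' ∧
        Combines F (root + l.length + 1) (fun x => H x + leafSum m xs y R sc l x) s' ∧
        F (root + l.length) = A := by
  obtain ⟨F, h1, h2, h3, h4⟩ := h.nodes
  set N := root + l.length
  unfold closeLeaf
  refine Run.nset_seq (v := s.nat 13 0) rfl ?_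
  refine Run.nset_seq (v := s.nat 22 0) (by simp) ?_
  refine Run.rset_seq (v := 1 / 2) (by simp [RExp.eval]) ?_
  refine Run.rset_seq (v := 1 / 2) (by simp [RExp.eval]) ?_
  generalize hs3 : State.setReal _ 20 0 _ = s3
  have hE3 : Env n m xs y s3 := by subst hs3; exact h.env.congr (by simp) (by simp)
  have hN3 : Nodes n m xs F N s3 := by
    subst hs3; exact h1.congr (by simp) (by simp)
  have hH3 : Combines F N (fun x => H x + leafSum m xs y R sc l x) s3 := by
    subst hs3; intro x; simpa using h2 x
  have e16 : s3.nat 16 0 = s.nat 13 0 := by subst hs3; simp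
  have e17 : s3.nat 17 0 = s.nat 22 0 := by subst hs3; simp
  have e19 : s3.real 19 0 = 1 / 2 := by subst hs3; simp
  have e20 : s3.real 20 0 = 1 / 2 := by subst hs3; simp
  have g15 : s3.real 15 0 = s.real 15 0 := by subst hs3; simp
  refine Run.seq (Learner.run_newNode hE3 hN3 (G := A) (by omega) (by omega) fun x => ?_) ?_
  · rw [e16, e17, e19, e20, hA, h3 _ ha]
    ring
  rintro s4 hf4 ⟨hE4, hN4, hS4⟩
  obtain ⟨k1, k2⟩ := hS4.keep (z := 0) hN4 (hH3.frame hf4 (by decide))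
  refine Run.seq (run_keep hN4 (z := 0) (by simp [RExp.eval]) le_rfl) ?_
  rintro s5 - rfl
  refine Run.nset_seq (v := N) (by simp [NExp.eval]) ?_
  refine Run.rset (v := 2 * s.real 15 0) ?_ ?_ ?_
  · simp [RExp.eval, hf4.real 15 (by decide), g15]
    ring
  · simp [NExp.cost, RExp.cost]
  · refine ⟨hE4.congr (by simp) (by simp), by simp, by simp, Function.update F N A,
      k1.congr (by simp) (by simp), fun x => ?_, by simp⟩
    simpa using k2 x

/-! ### The rounds -/

/-- The indicator of the points that are not in the first `d` leaves of the decision list `ℓ`. -/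
def active (ℓ : ℕ → ℕ) (d : ℕ) (x : ℕ → ℝ) : ℝ := ∏ e ∈ Finset.range d, (1 + x (ℓ e)) / 2

/-- The indicator of the leaf `d` of the decision list `ℓ`. -/
def leafInd (ℓ : ℕ → ℕ) (d : ℕ) (x : ℕ → ℝ) : ℝ := active ℓ d x * ((1 - x (ℓ d)) / 2)

/-- The specification of the choice of `ℓ d`, where `M` is the largest active label. -/
structure Round (n m : ℕ) (xs : ℕ → ℕ → ℝ) (y : ℕ → ℝ) (al : ℝ) (ℓ : ℕ → ℕ) (d : ℕ) (M : ℝ) :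
    Prop where
  nonneg : 0 ≤ M
  le_max : ∀ j < m, active ℓ d (xs j) * y j ≤ M
  max_eq : M = 0 ∨ ∃ j < m, M = active ℓ d (xs j) * y j
  le : ℓ d ≤ n
  new : ℓ d < n → ∀ e < d, ℓ e ≠ ℓ d
  large : ℓ d < n → ∀ j < m, active ℓ d (xs j) * (1 - xs j (ℓ d)) * M ≤ al * y j
  small : ∀ i < ℓ d, (∀ e < d, ℓ e ≠ i) →
    ∃ j < m, al * y j < active ℓ d (xs j) * (1 - xs j i) * M

/-- The sets found by the search in leaf `d`. -/
def leafSets (n m Q : ℕ) (xs : ℕ → ℕ → ℝ) (y : ℕ → ℝ) (ℓ : ℕ → ℕ) (d : ℕ) (M : ℝ) :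
    List (Finset ℕ) :=
  search (Q + 2) (fun T => corr m xs y (leafInd ℓ d) T + 4 * M * m / Q < 0)
    (fun i => ∃ e ≤ d, ℓ e = i) n

/-- The hypothesis on leaf `d`. -/
def leafHyp (n m Q : ℕ) (xs : ℕ → ℕ → ℝ) (y : ℕ → ℝ) (g : ℝ) (ℓ : ℕ → ℕ) (d : ℕ) (M : ℝ) :
    (ℕ → ℝ) → ℝ :=
  leafSum m xs y (leafInd ℓ d) ((if ℓ d < n then 2 * 2 ^ d else 2 ^ d) / (m * (1 + g / 4)))
    (leafSets n m Q xs y ℓ d M)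

/-- The invariant of the main loop, after `d` rounds. -/
structure Main (n m Q L : ℕ) (xs : ℕ → ℕ → ℝ) (y : ℕ → ℝ) (al g : ℝ) (d : ℕ) (s : State) :
    Prop where
  env : Env n m xs y s
  depth : s.nat 1 0 = L
  round_eq : s.nat 14 0 = d
  bound : s.real 6 0 = Q
  weight : s.real 15 0 = 2 ^ d
  slack : s.real 3 0 = g
  level : s.real 21 0 = al
  inv : ∃ (ℓ : ℕ → ℕ) (M : ℕ → ℝ) (F : ℕ → (ℕ → ℝ) → ℝ) (N : ℕ),
    (∀ e < d, Round n m xs y al ℓ e (M e)) ∧ (∀ i, 0 < s.nat 15 i ↔ ∃ e < d, ℓ e = i) ∧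
    Nodes n m xs F N s ∧
    Combines F N (fun x => ∑ e ∈ Finset.range d, leafHyp n m Q xs y g ℓ e (M e) x) s ∧
    s.nat 13 0 < N ∧ F (s.nat 13 0) = active ℓ d ∧ N ≤ 1 + d * (Q + 3)

/-- A round extends the decision list by changing `ℓ` at `d` alone; this and the next congruences
carry over what is known about earlier leaves. -/
theorem active_congr {ℓ ℓ' : ℕ → ℕ} {d : ℕ} (h : ∀ e < d, ℓ e = ℓ' e) :
    active ℓ d = active ℓ' d := by
  ext x
  exact Finset.prod_congr rfl fun e he => by rw [h e (Finset.mem_range.1 he)]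

theorem leafInd_congr {ℓ ℓ' : ℕ → ℕ} {d : ℕ} (h : ∀ e ≤ d, ℓ e = ℓ' e) :
    leafInd ℓ d = leafInd ℓ' d := by
  ext x
  rw [leafInd, leafInd, active_congr fun e he => h e he.le, h d le_rfl]

theorem leafHyp_congr {ℓ ℓ' : ℕ → ℕ} {d : ℕ} (h : ∀ e ≤ d, ℓ e = ℓ' e) {g M : ℝ} :
    leafHyp n m Q xs y g ℓ d M = leafHyp n m Q xs y g ℓ' d M := by
  have : (fun i => ∃ e ≤ d, ℓ e = i) = fun i => ∃ e ≤ d, ℓ' e = i := by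
    ext i
    exact exists_congr fun e => and_congr_right fun he => by rw [h e he]
  rw [leafHyp, leafHyp, leafSets, leafSets, leafInd_congr h, h d le_rfl, this]

theorem Round.congr {ℓ ℓ' : ℕ → ℕ} {d : ℕ} {al M : ℝ} (hR : Round n m xs y al ℓ d M)
    (h : ∀ e ≤ d, ℓ e = ℓ' e) : Round n m xs y al ℓ' d M := by
  have hd := h d le_rfl
  have ha : active ℓ d = active ℓ' d := active_congr fun e he => h e he.le
  have hall : ∀ i, (∀ e < d, ℓ e ≠ i) ↔ ∀ e < d, ℓ' e ≠ i := fun i =>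
    forall₂_congr fun e he => by rw [h e he.le]
  obtain ⟨h1, h2, h3, h4, h5, h6, h7⟩ := hR
  simp only [ha, hd, hall] at h2 h3 h4 h5 h6 h7
  exact ⟨h1, h2, h3, h4, h5, h6, h7⟩

/-- A bound for the time of a round. -/
abbrev roundTime (n m Q : ℕ) : ℕ := 100 * (n * (m + 1)) + leafTime n m Q + 240 * m + 700

set_option maxHeartbeats 1000000 in
theorem Main.run_round {L d : ℕ} {al g : ℝ} (h : Main n m Q L xs y al g d s) (hm : 0 < m) :
    Run c ω round s (roundTime n m Q) fun s' => Main n m Q L xs y al g (d + 1) s' := by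
  obtain ⟨ℓ, M, F, N, hR, hmk, hN, hH, ha, hFa, hNle⟩ := h.inv
  have hpos := hN.pos
  unfold round
  refine Run.seq (run_findMax h.env hN ha) ?_
  rintro s1 hf1 ⟨h0, hle, hmax⟩
  have hN1 : Nodes n m xs F N s1 := hN.frame hf1 (by decide) (by decide)
  have hE1 : Env n m xs y s1 := h.env.frame hf1 (by decide) (by decide)
  have a1 : s1.nat 13 = s.nat 13 := hf1.nat 13 (by decide)
  refine Run.seq (run_findVar hE1 hN1 (by rwa [a1]) hm) ?_
  rintro s2 hf2 ⟨hi, hlarge, hsmall⟩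
  have hN2 : Nodes n m xs F N s2 := hN1.frame hf2 (by decide) (by decide)
  have hE2 : Env n m xs y s2 := hE1.frame hf2 (by decide) (by decide)
  have a2 : s2.nat 13 = s.nat 13 := (hf2.nat 13 (by decide)).trans a1
  have hH2 := (hH.frame hf1 (by decide)).frame hf2 (by decide)
  have b15 : s1.nat 15 = s.nat 15 := hf1.nat 15 (by decide)
  have c15 : s2.nat 15 = s.nat 15 := (hf2.nat 15 (by decide)).trans b15
  have b21 : s1.real 21 0 = al := by rw [hf1.real 21 (by decide), h.level]
  have c14 : s2.real 14 = s1.real 14 := hf2.real 14 (by decide)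
  set i := s2.nat 22 0
  set ℓ' := Function.update ℓ d i with hℓ'
  set M' := Function.update M d (s1.real 14 0) with hM'
  have hℓ : ∀ e < d, ℓ e = ℓ' e := fun e he => (Function.update_of_ne he.ne _ _).symm
  have hact : active ℓ d = active ℓ' d := active_congr hℓ
  have hℓd : ℓ' d = i := Function.update_self _ _ _
  have hMd : M' d = s1.real 14 0 := Function.update_self _ _ _
  have unmarked : ∀ v, s.nat 15 v = 0 ↔ ∀ e < d, ℓ' e ≠ v := fun v => by
    rw [← Nat.le_zero, ← not_lt, hmk]
    push Not
    exact forall₂_congr fun e he => by rw [hℓ e he]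
  have hRd : Round n m xs y al ℓ' d (M' d) := by
    rw [a1, hFa, hact, b15, b21] at hlarge hsmall
    rw [hFa, hact] at hle hmax
    refine ⟨?_, ?_, ?_, ?_, ?_, ?_, ?_⟩ <;> (try rw [hMd]) <;> (try rw [hℓd])
    · exact h0
    · exact hle
    · exact hmax
    · exact hi
    · exact fun hin => (unmarked i).1 (hlarge hin).1
    · exact fun hin => (hlarge hin).2
    · exact fun v hv hv' => hsmall v hv ((unmarked v).2 hv')
  refine Run.seq (run_newLeaf hE2 hN2 hH2 (Q := Q) (R := leafInd ℓ' d) (by rwa [a2]) hi ?_ ?_ rfl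
    rfl) ?_
  · rw [hf2.real 6 (by decide), hf1.real 6 (by decide), h.bound]
  · intro x
    rw [a2, hFa, leafInd, hact, hℓd]
  rintro s3 hf3 ⟨hL3, h15⟩
  refine Run.seq hL3.run_expandLeaf ?_
  intro s4 hf4 hL4
  have a4 : s4.nat 13 = s.nat 13 :=
    (hf4.nat 13 (by decide)).trans ((hf3.nat 13 (by decide)).trans a2)
  have i4 : s4.nat 22 0 = i := by
    rw [hf4.nat 22 (by decide), hf3.nat 22 (by decide)]
  refine Run.seq (hL4.run_closeLeaf (A := active ℓ' (d + 1)) (by rwa [a4]) (by rwa [i4]) ?_) ?_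
  · intro x
    rw [a4, hFa, i4, active, Finset.prod_range_succ, hℓd, hact]
    rfl
  rintro s5 hf5 ⟨hE5, h15', h13, F', hN5, hH5, hF5⟩
  -- The coordinate of the current leaf is already marked, hence `e ≤ d`: the search uses only the
  -- coordinates that are free on the leaf.
  have hmk' : ∀ v, 0 < s3.nat 15 v ↔ ∃ e ≤ d, ℓ' e = v := by
    intro v
    rw [h15, c15]
    by_cases hv : v = i
    · have : Function.update (s.nat 15) (s2.nat 22 0) 1 v = 1 := by
        rw [hv]
        exact Function.update_self _ _ _
      rw [this]
      exact iff_of_true one_pos ⟨d, le_rfl, hℓd.trans hv.symm⟩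
    · rw [Function.update_of_ne hv, hmk]
      constructor
      · rintro ⟨e, he, rfl⟩
        exact ⟨e, he.le, (hℓ e he).symm⟩
      · rintro ⟨e, he, rfl⟩
        rcases he.lt_or_eq with he | rfl
        · exact ⟨e, he, hℓ e he⟩
        · exact (hv hℓd).elim
  have w2 : s2.real 15 0 = 2 ^ d := by
    rw [hf2.real 15 (by decide), hf1.real 15 (by decide), h.weight]
  have g2 : s2.real 3 0 = g := by
    rw [hf2.real 3 (by decide), hf1.real 3 (by decide), h.slack]
  have hsets : search (Q + 2) (fun T => corr m xs y (leafInd ℓ' d) T +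
      4 * s2.real 14 0 * m / Q < 0) (fun v => 0 < s3.nat 15 v) n =
      leafSets n m Q xs y ℓ' d (M' d) := by
    rw [leafSets, hMd, c14]
    congr 1
    ext v
    exact hmk' v
  rw [hsets] at hN5 hH5 hF5 h13
  rw [w2, g2] at hH5
  have hlen : (leafSets n m Q xs y ℓ' d (M' d)).length ≤ Q + 2 := length_search (by omega)
  have hcomb : ∀ x, ∑ e ∈ Finset.range d, leafHyp n m Q xs y g ℓ e (M e) x +
      leafSum m xs y (leafInd ℓ' d) ((if i < n then 2 * 2 ^ d else 2 ^ d) / (m * (1 + g / 4)))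
        (leafSets n m Q xs y ℓ' d (M' d)) x =
      ∑ e ∈ Finset.range (d + 1), leafHyp n m Q xs y g ℓ' e (M' e) x := by
    intro x
    rw [Finset.sum_range_succ]
    congr 1
    · refine Finset.sum_congr rfl fun e he => ?_
      have he := Finset.mem_range.1 he
      rw [hM', Function.update_of_ne he.ne, leafHyp_congr fun e' he' => hℓ e' (by omega)]
    · rw [leafHyp, hℓd]
  refine Run.nset (v := d + 1) ?_ ?_ ⟨hE5.congr (by simp) (by simp), ?_, by simp, ?_, ?_, ?_, ?_,
    ℓ', M', F', _, ?_, ?_, hN5.congr (by simp) (by simp), fun x => ?_, ?_, ?_, ?_⟩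
  · simp [NExp.eval, hf5.nat 14 (by decide), hf4.nat 14 (by decide), hf3.nat 14 (by decide),
      hf2.nat 14 (by decide), hf1.nat 14 (by decide), h.round_eq]
  · simp only [NExp.cost, roundTime]
    omega
  · simp [hf5.nat 1 (by decide), hf4.nat 1 (by decide), hf3.nat 1 (by decide),
      hf2.nat 1 (by decide), hf1.nat 1 (by decide), h.depth]
  · simp [hf5.real 6 (by decide), hL4.bound]
  · simp [h15', hf4.real 15 (by decide), hf3.real 15 (by decide), w2, pow_succ, mul_comm]
  · simp [hf5.real 3 (by decide), hf4.real 3 (by decide), hf3.real 3 (by decide), g2]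
  · simp [hf5.real 21 (by decide), hf4.real 21 (by decide), hf3.real 21 (by decide),
      hf2.real 21 (by decide), b21]
  · intro e he
    rcases Nat.lt_succ_iff_lt_or_eq.1 he with he | rfl
    · rw [hM', Function.update_of_ne he.ne]
      exact (hR e he).congr fun e' he' => hℓ e' (by omega)
    · exact hRd
  · intro v
    simp only [Nat.lt_succ_iff]
    rw [← hmk' v]
    simp [hf5.nat 15 (by decide), hf4.nat 15 (by decide)]
  · exact (hH5 x).trans (hcomb x)
  · simp [h13]
  · simp [h13, hF5]
  · have : (d + 1) * (Q + 3) = d * (Q + 3) + (Q + 3) := by ring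
    omega

theorem Main.run_rounds {L : ℕ} {al g : ℝ} (h : Main n m Q L xs y al g 0 s) (hm : 0 < m) :
    Run c ω rounds s ((L + 2) * (roundTime n m Q + 20) + 20)
      fun s' => Main n m Q L xs y al g (L + 2) s' := by
  refine Run.mono (Run.loop_count (L + 2) (roundTime n m Q) (Main n m Q L xs y al g) h ?_ ?_) ?_ ?_
  · intro d s' _ _ hM
    simp [NExp.eval, hM.round_eq, hM.depth]
  · intro d s' _ _ hM
    exact hM.run_round hm
  · simp only [Test.cost, NExp.cost]
    generalize roundTime n m Q = r
    have := Nat.mul_le_mul_left (L + 2) 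
      (show r + (1 + 1 + 1 + 1 + (1 + 1 + 1 + 1) + 1) + 1 ≤ r + 20 by omega)
    omega
  · exact fun s' _ h => h

end

/-! ### Evaluation of the hypothesis and computation of the parameters. -/

section

/-- The coordinates of a point of the cube, followed by the constant `-1`. -/
def ext {n : ℕ} (x : Cube n) (i : ℕ) : ℝ := if h : i < n then ((x ⟨i, h⟩ : ℤ) : ℝ) else -1

variable {n m N : ℕ} {xs : ℕ → ℕ → ℝ} {y : ℕ → ℝ} {F : ℕ → (ℕ → ℝ) → ℝ} {H : (ℕ → ℝ) → ℝ}
  {s s' : State} {k : ℕ} {c : Cube n → ℝ} {ω : ℕ → Cube n}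

theorem run_evaluate (hn : s.nat 0 0 = n) (hN : Nodes n m xs F N s) (hH : Combines F N H s)
    (x : Cube n) :
    Run c ω evaluate (s.loadPoint x) (60 * N + 60) fun s' => s'.real 1 0 = H (ext x) := by
  have hc := hN.count
  have hpos := hN.pos
  unfold evaluate
  refine Run.setReal_seq (iv := n) (v := -1) (by simpa [State.loadPoint] using hn)
    (by simp [RExp.eval]) ?_
  refine Run.rset_seq (v := 1) (by simp [RExp.eval]) ?_
  refine Run.rset_seq (v := s.real 13 0) (by simp [State.loadPoint]) ?_
  refine Run.nset_seq (v := 1) rfl ?_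
  generalize hs1 : State.setNat _ 23 0 1 = s1
  have a1 : ∀ a, a ≠ 23 → s1.nat a = s.nat a := fun a ha => by
    subst hs1; simp [ha, State.loadPoint]
  have b1 : ∀ a, a ≠ 0 → a ≠ 1 → a ≠ 22 → s1.real a = s.real a := fun a h0 h1 h2 => by
    subst hs1; simp [h0, h1, h2, State.loadPoint]
  have b0 : ∀ i ≤ n, s1.real 0 i = ext x i := fun i hi => by
    subst hs1
    rcases hi.lt_or_eq with hi | rfl
    · simp [State.loadPoint, ext, hi, hi.ne]
    · simp [ext]
  -- The loop starts at node `1`. Parents have smaller indices, so their values are available when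
  -- needed.
  refine Run.mono (Run.loop_count (N - 1) 45 (fun j s' => s'.nat 23 0 = j + 1 ∧
    (∀ i ≤ j, s'.real 22 i = F i (ext x)) ∧
    s'.real 1 0 = ∑ i ∈ Finset.range (j + 1), s.real 13 i * F i (ext x)) ?_ ?_ ?_) ?_ ?_
  · refine ⟨by subst hs1; simp, fun i hi => ?_, ?_⟩
    · obtain rfl : i = 0 := by omega
      subst hs1; simp [hN.zero]
    · subst hs1; simp [hN.zero]
  · rintro j s' hj hf ⟨h, -⟩
    simp [h, hf.nat 10 (by decide), a1, hc]
    omega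
  · rintro j s' hj hf ⟨h1, h2, h3⟩
    have e11 : s'.nat 11 = s.nat 11 := by rw [hf.nat 11 (by decide), a1 11 (by decide)]
    have e12 : s'.nat 12 = s.nat 12 := by rw [hf.nat 12 (by decide), a1 12 (by decide)]
    have r11 : s'.real 11 = s.real 11 := by
      rw [hf.real 11 (by decide), b1 11 (by decide) (by decide) (by decide)]
    have r12 : s'.real 12 = s.real 12 := by
      rw [hf.real 12 (by decide), b1 12 (by decide) (by decide) (by decide)]
    have r13 : s'.real 13 = s.real 13 := by
      rw [hf.real 13 (by decide), b1 13 (by decide) (by decide) (by decide)]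
    have r0 : s'.real 0 = s1.real 0 := hf.real 0 (by decide)
    have hj' : j + 1 < N := by omega
    have hp := hN.parent (j + 1) hj' (by omega)
    have hi := hN.index (j + 1) hj' (by omega)
    refine Run.setReal_seq (iv := j + 1) (v := F (j + 1) (ext x)) (by simpa using h1) ?_ ?_
    · rw [hN.step (j + 1) hj' (by omega)]
      simp [RExp.eval, NExp.eval, h1, e11, e12, r11, r12, r0, h2 _ (Nat.lt_succ_iff.1 hp), b0 _ hi]
    refine Run.rset_seq
      (v := ∑ i ∈ Finset.range (j + 1 + 1), s.real 13 i * F i (ext x)) ?_ ?_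
    · rw [Finset.sum_range_succ _ (j + 1)]
      simp [RExp.eval, h1, h3, r13]
    refine Run.nset (v := j + 1 + 1) (by simp [NExp.eval, h1]) (by simp [NExp.cost, RExp.cost])
      ⟨by simp, fun i hi => ?_, by simp⟩
    rcases hi.lt_or_eq with hi | rfl
    · simpa [hi.ne] using h2 i (by omega)
    · simp
  · simp [Test.cost, NExp.cost, RExp.cost]
    omega
  · rintro s' - ⟨-, -, h⟩
    rw [h, Nat.sub_add_cancel hpos, hH]

/-- The bound on the correlations, inverted. -/
def invTol (L : ℕ) : ℕ := 131072 * (L + 2) ^ 3 * 4 ^ L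

/-- The number of samples. -/
def sampleSize (L K : ℕ) : ℕ := 34 * invTol L ^ 2 * (L + 2) * (K + 1)

theorem run_setParams {γ δ : ℝ} {L K : ℕ} (hL : 1 ≤ 2 ^ L * (min γ 1 * min δ 1))
    (hL' : ∀ j < L, 2 ^ j * (min γ 1 * min δ 1) < 1) (hK : n ≤ 2 ^ K)
    (hK' : ∀ j < K, 2 ^ j < n) :
    Run c ω setParams (State.start n γ δ) (40 * L + 40 * K + 300) fun s =>
      s.real 3 0 = min γ 1 ∧ s.nat 1 0 = L ∧ s.real 6 0 = invTol L ∧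
      s.real 7 0 = sampleSize L K ∧ s.real 21 0 = 16 * (L + 2) ∧ s.real 15 0 = 1 ∧
      s.nat 10 0 = 1 := by
  unfold setParams
  refine Run.seq (T' := 30) (P := fun s => s.real 3 0 = min γ 1) ?_ ?_
  · refine Run.ite (fun hb => ?_) fun hb => ?_
    all_goals simp only [Test.Holds, RExp.eval, NExp.eval, State.start] at hb
    · refine Run.rset (v := min γ 1) ?_ (by simp [Test.cost, NExp.cost, RExp.cost]) (by simp)
      simpa [RExp.eval, State.start] using hb
    · refine Run.rset (v := min γ 1) ?_ (by simp [Test.cost, NExp.cost, RExp.cost]) (by simp)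
      simpa [RExp.eval, State.start] using (not_le.1 hb).le
  intro s1 hf1 h1
  have c2 : s1.real 2 = (State.start n γ δ).real 2 := hf1.real 2 (by decide)
  refine Run.seq (T' := 30) (P := fun s => s.real 4 0 = min δ 1) ?_ ?_
  · refine Run.ite (fun hb => ?_) fun hb => ?_
    all_goals simp only [Test.Holds, RExp.eval, NExp.eval, c2, State.start] at hb
    · refine Run.rset (v := min δ 1) ?_ (by simp [Test.cost, NExp.cost, RExp.cost]) (by simp)
      simpa [RExp.eval, c2, State.start] using hb
    · refine Run.rset (v := min δ 1) ?_ (by simp [Test.cost, NExp.cost, RExp.cost]) (by simp)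
      simpa [RExp.eval, State.start] using (not_le.1 hb).le
  intro s2 hf2 h2
  have d3 : s2.real 3 0 = min γ 1 := by rw [hf2.real 3 (by decide), h1]
  refine Run.rset_seq (v := min γ 1 * min δ 1) (by simp [RExp.eval, h2, d3]) ?_
  refine Run.rset_seq (v := 1) (by simp [RExp.eval]) ?_
  set e := min γ 1 * min δ 1
  generalize hs3 : State.setReal _ 5 0 _ = s3
  have e4 : s3.real 4 0 = e := by subst hs3; simp
  have e3 : s3.real 3 0 = min γ 1 := by subst hs3; simpa
  have n3 : ∀ a, s3.nat a = (State.start n γ δ).nat a := fun a => by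
    subst hs3
    simp [hf2.nat a (by simp [Cmd.natWrites]), hf1.nat a (by simp [Cmd.natWrites])]
  refine Run.seq (Run.loop_count L 25 (fun j s => s.real 5 0 = 2 ^ j ∧ s.nat 1 0 = j)
    ?_ ?_ ?_) ?_
  · subst hs3
    have := n3 1
    simpa [State.start] using congr_fun (n3 1) 0
  · rintro j s hj hf ⟨h5, -⟩
    have : s.real 4 0 = e := by rw [hf.real 4 (by decide), e4]
    simp only [Test.Holds, RExp.eval, NExp.eval, h5, this, Nat.cast_one, not_le]
    refine ⟨fun h => lt_of_le_of_ne hj ?_, hL' j⟩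
    rintro rfl
    exact absurd hL (not_le.2 h)
  · rintro j s hj hf ⟨h5, h6⟩
    refine Run.rset_seq (v := 2 ^ (j + 1)) (by simp [RExp.eval, h5]; ring) ?_
    exact Run.nset (v := j + 1) (by simp [NExp.eval, h6]) (by simp [NExp.cost, RExp.cost]) (by simp)
  rintro s4 hf4 ⟨h5, h6⟩
  refine Run.nset_seq (v := 1) rfl ?_
  generalize hs5 : State.setNat _ 3 0 _ = s5
  have n5 : ∀ a, a ≠ 1 → a ≠ 3 → s5.nat a = (State.start n γ δ).nat a := fun a ha ha' => by
    subst hs5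
    simp [ha', hf4.nat a (by simp [Cmd.natWrites, ha]), n3]
  refine Run.seq (Run.loop_count K 25 (fun j s => s.nat 3 0 = 2 ^ j ∧ s.nat 2 0 = j)
    ?_ ?_ ?_) ?_
  · refine ⟨by subst hs5; simp, by simp [n5, State.start]⟩
  · rintro j s hj hf ⟨h3, -⟩
    have : s.nat 0 0 = n := by
      rw [hf.nat 0 (by decide), n5 0 (by decide) (by decide)]; simp [State.start]
    simp only [Test.Holds, NExp.eval_nvar, h3, this, not_le]
    refine ⟨fun h => lt_of_le_of_ne hj ?_, hK' j⟩
    rintro rfl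
    exact absurd hK (not_le.2 h)
  · rintro j s hj hf ⟨h5, h6⟩
    refine Run.nset_seq (v := 2 ^ (j + 1)) (by simp [NExp.eval, h5]; ring) ?_
    exact Run.nset (v := j + 1) (by simp [NExp.eval, h6]) (by simp [NExp.cost, RExp.cost]) (by simp)
  rintro s6 hf6 ⟨-, h62⟩
  have h61 : s6.nat 1 0 = L := by
    rw [hf6.nat 1 (by decide)]
    subst hs5
    simpa using h6
  have r63 : s6.real 3 0 = min γ 1 := by
    rw [hf6.real 3 (by decide)]
    subst hs5
    simp [hf4.real 3 (by decide), e3]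
  have r65 : s6.real 5 0 = 2 ^ L := by
    rw [hf6.real 5 (by decide)]
    subst hs5
    simpa using h5
  refine Run.rset_seq (v := L + 2) (by simp [RExp.eval, NExp.eval, h61]) ?_
  refine Run.rset_seq (v := invTol L) ?_ ?_
  · have : (4 : ℝ) ^ L = 2 ^ L * 2 ^ L := by rw [← mul_pow]; norm_num
    simp [RExp.eval, r65, invTol, this]
    ring
  refine Run.rset_seq (v := sampleSize L K) ?_ ?_
  · simp [RExp.eval, NExp.eval, h62, sampleSize]
    ring
  refine Run.rset_seq (v := 16 * (L + 2)) (by simp [RExp.eval]) ?_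
  refine Run.rset_seq (v := 1) (by simp [RExp.eval]) ?_
  refine Run.nset (v := 1) rfl ?_ ?_
  · simp [Test.cost, NExp.cost, RExp.cost]
    omega
  · simp [r63, h61]

end

/-! ### Drawing the samples and running the learner. -/

section

variable {n m : ℕ} {s s' : State} {c : Cube n → ℝ} {ω : ℕ → Cube n}

/-- The samples received so far are stored. -/
structure Drawn (c : Cube n → ℝ) (ω : ℕ → Cube n) (j : ℕ) (s : State) : Prop where
  count : s.nat 8 0 = j
  used : s.used = j
  offset : s.nat 6 0 = j * (n + 1)
  row : ∀ i < j, s.nat 7 i = i * (n + 1)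
  coord : ∀ i < j, ∀ a ≤ n, s.real 8 (i * (n + 1) + a) = ext (ω i) a
  label : ∀ i < j, s.real 9 i = c (ω i)
  one : ∀ i < j, s.real 10 i = 1

theorem Drawn.run_step {j : ℕ} (h : Drawn c ω j s) (hn : s.nat 0 0 = n) :
    Run c ω (.draw ;;
      .setNat 7 (nvar 8) (nvar 6) ;;
      .setReal 9 (nvar 8) (rvar 1) ;;
      .setReal 10 (nvar 8) (rlit 1) ;;
      nset 5 (.lit 0) ;;
      .loop (.natLt (nvar 5) (nvar 0))
        (.setReal 8 (.add (nvar 6) (nvar 5)) (.get 0 (nvar 5)) ;; incr 5) ;;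
      .setReal 8 (.add (nvar 6) (nvar 5)) (.sub (rlit 0) (rlit 1)) ;;
      nset 6 (.add (.add (nvar 6) (nvar 0)) (.lit 1)) ;;
      incr 8) s (40 * n + 100) fun s' => Drawn c ω (j + 1) s' := by
  refine Run.draw_seq ?_
  rw [h.used]
  refine Run.setNat_seq (iv := j) (v := j * (n + 1)) (by simpa [State.receive, State.loadPoint]
    using h.count) (by simpa [State.receive, State.loadPoint] using h.offset) ?_
  refine Run.setReal_seq (iv := j) (v := c (ω j)) (by simpa [State.receive, State.loadPoint]
    using h.count) (by simp [State.receive, State.loadPoint, State.setReal]) ?_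
  refine Run.setReal_seq (iv := j) (v := 1) (by simpa [State.receive, State.loadPoint]
    using h.count) (by simp [RExp.eval]) ?_
  refine Run.nset_seq (v := 0) rfl ?_
  generalize hs1 : State.setNat _ 5 0 _ = s1
  have e0 : s1.nat 0 0 = n := by
    subst hs1; simpa [State.receive, State.loadPoint] using hn
  have e8 : s1.nat 8 0 = j := by
    subst hs1; simpa [State.receive, State.loadPoint] using h.count
  have e6 : s1.nat 6 0 = j * (n + 1) := by
    subst hs1; simpa [State.receive, State.loadPoint] using h.offset
  have e7 : ∀ i, s1.nat 7 i = if i = j then j * (n + 1) else s.nat 7 i := fun i => by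
    subst hs1; simp [State.receive, State.loadPoint]
  have r0 : ∀ i < n, s1.real 0 i = ext (ω j) i := fun i hi => by
    subst hs1; simp [State.receive, State.loadPoint, State.setReal, hi, ext]
  have r8 : s1.real 8 = s.real 8 := by
    subst hs1; simp [State.receive, State.loadPoint, State.setReal]
  have r9 : ∀ i, s1.real 9 i = if i = j then c (ω j) else s.real 9 i := fun i => by
    subst hs1; simp [State.receive, State.loadPoint]
  have r10 : ∀ i, s1.real 10 i = if i = j then 1 else s.real 10 i := fun i => by
    subst hs1; simp [State.receive, State.loadPoint]
  have hu : s1.used = j + 1 := by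
    subst hs1; simp [State.receive, State.loadPoint, h.used]
  refine Run.seq (Run.loop_count n 25 (fun a s' => s'.nat 5 0 = a ∧
    (∀ i < j, ∀ a ≤ n, s'.real 8 (i * (n + 1) + a) = ext (ω i) a) ∧
    ∀ b < a, s'.real 8 (j * (n + 1) + b) = ext (ω j) b) ?_ ?_ ?_) ?_
  · exact ⟨by subst hs1; simp, by rw [r8]; exact h.coord, by simp⟩
  · rintro a s' - hf ⟨h, -⟩
    simp [h, hf.nat 0 (by decide), e0]
  · rintro a s' ha hf ⟨h1, h2, h3⟩
    refine Run.setReal_seq (iv := j * (n + 1) + a) (v := ext (ω j) a)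
      (by simp [NExp.eval, h1, hf.nat 6 (by decide), e6]) ?_ ?_
    · simp [RExp.eval, h1, hf.real 0 (by decide), r0 a ha]
    refine Run.nset (v := a + 1) (by simp [NExp.eval, h1]) (by simp [NExp.cost, RExp.cost])
      ⟨by simp, fun i hi b hb => ?_, fun b hb => ?_⟩
    · have : i * (n + 1) + (n + 1) ≤ j * (n + 1) := by
        have := Nat.mul_le_mul_right (n + 1) (Nat.succ_le_of_lt hi)
        rwa [Nat.succ_mul] at this
      rw [← h2 i hi b hb]
      simp
      omega
    · rcases Nat.lt_succ_iff_lt_or_eq.1 hb with hb | rfl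
      · simpa [hb.ne] using h3 b hb
      · simp
  rintro s2 hf2 ⟨h1, h2, h3⟩
  refine Run.setReal_seq (iv := j * (n + 1) + n) (v := -1)
    (by simp [NExp.eval, h1, hf2.nat 6 (by decide), e6]) (by simp [RExp.eval]) ?_
  refine Run.nset_seq (v := (j + 1) * (n + 1)) ?_ ?_
  · simp [NExp.eval, hf2.nat 6 (by decide), e6, hf2.nat 0 (by decide), e0]
    ring
  have less : ∀ i, i < j + 1 ↔ i < j ∨ i = j := fun i => Nat.lt_succ_iff_lt_or_eq
  refine Run.nset (v := j + 1) ?_ ?_ ⟨by simp, ?_, by simp, ?_, ?_, ?_, ?_⟩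
  · simp [NExp.eval, hf2.nat 8 (by decide), e8]
  · simp [Test.cost, NExp.cost, RExp.cost]
    omega
  · simp [hf2.used (by simp [Cmd.DrawFree]), hu]
  · intro i hi
    rcases (less i).1 hi with hi | rfl
    · simp [hf2.nat 7 (by decide), e7, hi.ne, h.row i hi]
    · simp [hf2.nat 7 (by decide), e7]
  · intro i hi b hb
    rcases (less i).1 hi with hi | rfl
    · have : i * (n + 1) + (n + 1) ≤ j * (n + 1) := by
        have := Nat.mul_le_mul_right (n + 1) (Nat.succ_le_of_lt hi)
        rwa [Nat.succ_mul] at this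
      rw [← h2 i hi b hb]
      simp
      omega
    · rcases hb.lt_or_eq with hb | rfl
      · simpa [hb.ne] using h3 b hb
      · simp [ext]
  · intro i hi
    rcases (less i).1 hi with hi | rfl
    · simp [hf2.real 9 (by decide), r9, hi.ne, h.label i hi]
    · simp [hf2.real 9 (by decide), r9]
  · intro i hi
    rcases (less i).1 hi with hi | rfl
    · simp [hf2.real 10 (by decide), r10, hi.ne, h.one i hi]
    · simp [hf2.real 10 (by decide), r10]

theorem run_drawAll (h : Drawn c ω 0 s) (hn : s.nat 0 0 = n) (hm : s.real 7 0 = m) :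
    Run c ω drawAll s (m * (40 * n + 120) + 20) fun s' => Drawn c ω m s' := by
  refine Run.mono (Run.loop_count m (40 * n + 100) (Drawn c ω) h ?_ ?_) ?_ fun s' _ h => h
  · intro j s' hj hf hD
    have e7 : s'.real 7 0 = m := by simp [hf.real 7 (by decide), hm]
    simp only [Test.Holds, RExp.eval, NExp.eval_nvar, NExp.eval, e7, hD.count, not_le, Nat.cast_lt]
  · intro j s' hj hf hD
    exact hD.run_step (by rw [hf.nat 0 (by decide), hn])
  · simp only [Test.cost, NExp.cost, RExp.cost]
    have := Nat.mul_le_mul_left m (show 40 * n + 100 + (1 + 1 + (1 + 1 + 1) + 1 + 1) + 1 ≤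
      40 * n + 120 by omega)
    omega

/-- A bound for the running time of the learner. -/
def learnTime (n m Q L K : ℕ) : ℕ :=
  40 * L + 40 * K + 300 + (m * (40 * n + 120) + 20) + ((L + 2) * (roundTime n m Q + 20) + 20)

/-- The final memory of the learner. -/
theorem run_learn {γ δ : ℝ} {L K : ℕ} (hL : 1 ≤ 2 ^ L * (min γ 1 * min δ 1))
    (hL' : ∀ j < L, 2 ^ j * (min γ 1 * min δ 1) < 1) (hK : n ≤ 2 ^ K)
    (hK' : ∀ j < K, 2 ^ j < n) :
    Run c ω learn (State.start n γ δ) (learnTime n (sampleSize L K) (invTol L) L K) fun s =>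
      s.used = sampleSize L K ∧ Main n (sampleSize L K) (invTol L) L (fun j => ext (ω j))
        (fun j => c (ω j)) (16 * (L + 2)) (min γ 1) (L + 2) s := by
  have hpos : 0 < sampleSize L K := by
    unfold sampleSize invTol
    positivity
  unfold learn
  refine Run.seq (run_setParams hL hL' hK hK') ?_
  rintro s1 hf1 ⟨h3, h1, h6, h7, h21, h15, h10⟩
  have hn : s1.nat 0 0 = n := by rw [hf1.nat 0 (by decide)]; simp [State.start]
  refine Run.seq (run_drawAll (m := sampleSize L K) ⟨?_, ?_, ?_, ?_, ?_, ?_, ?_⟩ hn h7) ?_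
  · rw [hf1.nat 8 (by decide)]; simp [State.start]
  · rw [hf1.used (by simp [setParams, Cmd.DrawFree])]; simp [State.start]
  · rw [hf1.nat 6 (by decide)]; simp [State.start]
  iterate 4 simp
  intro s2 hf2 hD
  set m := sampleSize L K
  have hM : Main n m (invTol L) L (fun j => ext (ω j)) (fun j => c (ω j)) (16 * (L + 2))
      (min γ 1) 0 s2 := by
    -- Before the first round the decision list is empty, so `ℓ` and `M` are arbitrary; the only
    -- node is the constant `1`, with coefficient `0`.
    refine ⟨⟨?_, hD.count, hD.row, hD.coord, hD.label⟩, ?_, ?_, ?_, ?_, ?_, ?_, fun _ => 0,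
      fun _ => 0, fun _ _ => 1, 1, by simp, ?_,
      ⟨?_, one_pos, fun _ => rfl, ?_, ?_, ?_, ?_, ?_⟩, ?_, ?_, ?_, by simp⟩
    · rw [hf2.nat 0 (by decide), hn]
    · rw [hf2.nat 1 (by decide), h1]
    · rw [hf2.nat 14 (by decide), hf1.nat 14 (by decide)]; simp [State.start]
    · rw [hf2.real 6 (by decide), h6]
    · rw [hf2.real 15 (by decide), h15, pow_zero]
    · rw [hf2.real 3 (by decide), h3]
    · rw [hf2.real 21 (by decide), h21]
    · intro i
      rw [hf2.nat 15 (by decide), hf1.nat 15 (by decide)]; simp [State.start]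
    · rw [hf2.nat 10 (by decide), h10]
    · intro k hk
      obtain rfl : k = 0 := by omega
      rw [hf2.nat 9 (by decide), hf1.nat 9 (by decide)]; simp [State.start]
    · intro k hk j hj
      obtain rfl : k = 0 := by omega
      simpa using hD.one j hj
    · omega
    · omega
    · omega
    · intro x
      rw [hf2.real 13 (by decide), hf1.real 13 (by decide)]; simp [State.start]
    · rw [hf2.nat 13 (by decide), hf1.nat 13 (by decide)]; simp [State.start]
    · ext x
      simp [active]
  refine (hM.run_rounds hpos).mono ?_ ?_
  · unfold learnTime
    omega
  · rintro s3 hf3 hM3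
    refine ⟨?_, hM3⟩
    rw [hf3.used (by simp [rounds, round, findMax, findVar, newLeaf, newNode, expandLeaf,
      expandVar, closeLeaf, Cmd.DrawFree]), hD.used]

/-- The hypothesis computed by the learner. -/
theorem exists_outputs {γ δ : ℝ} {L K : ℕ} (hL : 1 ≤ 2 ^ L * (min γ 1 * min δ 1))
    (hL' : ∀ j < L, 2 ^ j * (min γ 1 * min δ 1) < 1) (hK : n ≤ 2 ^ K)
    (hK' : ∀ j < K, 2 ^ j < n) {T B : ℝ}
    (hT : (learnTime n (sampleSize L K) (invTol L) L K : ℝ) ≤ T) (hB : (sampleSize L K : ℝ) ≤ B) :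
    ∃ h, Outputs learn evaluate γ δ c ω T B h ∧ ∃ (ℓ : ℕ → ℕ) (M : ℕ → ℝ),
      (∀ d < L + 2, Round n (sampleSize L K) (fun j => ext (ω j)) (fun j => c (ω j))
        (16 * (L + 2)) ℓ d (M d)) ∧
      ∀ x, h x = ∑ d ∈ Finset.range (L + 2), leafHyp n (sampleSize L K) (invTol L)
        (fun j => ext (ω j)) (fun j => c (ω j)) (min γ 1) ℓ d (M d) (ext x) := by
  obtain ⟨t, s, hexec, ht, hu, hM⟩ := run_learn (c := c) (ω := ω) hL hL' hK hK'
  obtain ⟨ℓ, M, F, N, hR, -, hN, hH, -, -, hle⟩ := hM.inv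
  refine ⟨_, ⟨t, s, hexec, (Nat.cast_le.2 ht).trans hT, by rwa [hu], fun x => ?_⟩, ℓ, M, hR,
    fun x => rfl⟩
  obtain ⟨t', s', h', ht', hx⟩ := run_evaluate (c := c) (ω := ω) hM.env.n_eq hN hH x
  refine ⟨t', s', h', le_trans ?_ hT, hx⟩
  rw [Nat.cast_le]
  refine ht'.trans ?_
  have hm : 1 ≤ sampleSize L K := by
    unfold sampleSize invTol
    exact Nat.succ_le_of_lt (by positivity)
  generalize sampleSize L K = m at hm
  generalize invTol L = Q at hle
  -- Evaluation is linear in the number of nodes, at most `1 + (L + 2) * (Q + 3)`, and the time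
  -- bound of the search already exceeds this.
  have h1 : 450 ≤ (Q + 2) * (80 * m + 200) + 50 := by
    have := Nat.mul_le_mul (show 2 ≤ Q + 2 by omega) (show 200 ≤ 80 * m + 200 by omega)
    omega
  have h2 : 60 * (Q + 3) ≤ roundTime n m Q + 20 := by
    have := Nat.mul_le_mul_left (Q + 2) h1
    unfold roundTime leafTime
    generalize (Q + 2) * ((Q + 2) * (80 * m + 200) + 50) = a at this ⊢
    generalize n * (80 * m + 300) = b
    generalize n * (m + 1) = d
    omega
  have h3 := Nat.mul_le_mul_left (L + 2) h2
  have h4 : 60 * N ≤ 60 + (L + 2) * (60 * (Q + 3)) := by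
    calc 60 * N ≤ 60 * (1 + (L + 2) * (Q + 3)) := Nat.mul_le_mul_left _ hle
      _ = _ := by ring
  unfold learnTime
  generalize (L + 2) * (60 * (Q + 3)) = a at h3 h4
  generalize (L + 2) * (roundTime n m Q + 20) = b at h3 ⊢
  omega

end

end Learner

/-! ### Hoeffding's inequality and simultaneous estimation. -/

section Hoeffding

variable {Ω : Type*} [MeasurableSpace Ω] {μ : Measure Ω} [IsProbabilityMeasure μ]

theorem measure_infinitePi_sum_ge_le {f : Ω → ℝ} (hf : Measurable f) (hb : ∀ x, |f x| ≤ 1)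
    (m : ℕ) {ε : ℝ} (hε : 0 ≤ ε) :
    (Measure.infinitePi fun _ : ℕ => μ).real
      {ω | ε ≤ ∑ j ∈ Finset.range m, (f (ω j) - ∫ x, f x ∂μ)} ≤ Real.exp (-ε ^ 2 / (2 * m)) := by
  have hi : iIndepFun (fun (j : ℕ) (ω : ℕ → Ω) => f (ω j) - ∫ x, f x ∂μ)
      (Measure.infinitePi fun _ : ℕ => μ) :=
    iIndepFun_infinitePi (X := fun (_ : ℕ) x => f x - ∫ x, f x ∂μ)
      fun _ => hf.sub measurable_const
  have hE : ∀ j : ℕ, ∫ ω, f (ω j) ∂(Measure.infinitePi fun _ : ℕ => μ) = ∫ x, f x ∂μ := by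
    intro j
    have := integral_map (μ := Measure.infinitePi fun _ : ℕ => μ) (φ := fun ω => ω j)
      (measurable_pi_apply j).aemeasurable (f := f) hf.aestronglyMeasurable
    rw [← this, Measure.infinitePi_map_eval]
  have hs : ∀ j < m, HasSubgaussianMGF (fun ω : ℕ → Ω => f (ω j) - ∫ x, f x ∂μ) 1
      (Measure.infinitePi fun _ : ℕ => μ) := by
    intro j _
    have h := hasSubgaussianMGF_of_mem_Icc (μ := Measure.infinitePi fun _ : ℕ => μ)
      (X := fun ω => f (ω j)) (a := -1) (b := 1)
      (hf.comp (measurable_pi_apply j)).aemeasurable (ae_of_all _ fun ω => abs_le.1 (hb _))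
    rw [hE] at h
    -- The subgaussian parameter for the interval `[-1, 1]` is the square of half its length, which
    -- is `1`.
    convert h using 1
    ext
    norm_num
  simpa using HasSubgaussianMGF.measure_sum_range_ge_le_of_iIndepFun hi hs hε

theorem measure_infinitePi_abs_sum_gt_le {f : Ω → ℝ} (hf : Measurable f) (hb : ∀ x, |f x| ≤ 1)
    (m : ℕ) {ε : ℝ} (hε : 0 ≤ ε) :
    (Measure.infinitePi fun _ : ℕ => μ).real
      {ω | ε < |∑ j ∈ Finset.range m, f (ω j) - m * ∫ x, f x ∂μ|}
        ≤ 2 * Real.exp (-ε ^ 2 / (2 * m)) := by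
  have h1 := measure_infinitePi_sum_ge_le (μ := μ) hf hb m hε
  have h2 := measure_infinitePi_sum_ge_le (μ := μ) hf.neg (by simpa using hb) m hε
  refine (measureReal_mono ?_).trans ((measureReal_union_le _ _).trans
    ((add_le_add h1 h2).trans_eq (two_mul _).symm))
  intro ω hω
  simp only [Set.mem_ofPred_eq, Finset.sum_sub_distrib, Finset.sum_const, Finset.card_range,
    nsmul_eq_mul, Set.mem_union, Pi.neg_apply, integral_neg, Finset.sum_neg_distrib] at hω ⊢
  rcases lt_abs.1 hω with h | h
  · exact Or.inl h.le
  · exact Or.inr (by linarith)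

/-- Simultaneous estimation of finitely many expectations. -/
theorem le_measure_infinitePi_forall_abs_sum_le {ι : Type*} [Fintype ι] {F : ι → Ω → ℝ}
    (hF : ∀ i, Measurable (F i)) (hb : ∀ i x, |F i x| ≤ 1) (m : ℕ) {ε : ℝ} (hε : 0 ≤ ε) :
    1 - Fintype.card ι * (2 * Real.exp (-ε ^ 2 / (2 * m))) ≤
      (Measure.infinitePi fun _ : ℕ => μ).real
        {ω | ∀ i, |∑ j ∈ Finset.range m, F i (ω j) - m * ∫ x, F i x ∂μ| ≤ ε} := by
  have hm : ∀ i, Measurable fun ω : ℕ → Ω =>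
      |∑ j ∈ Finset.range m, F i (ω j) - m * ∫ x, F i x ∂μ| := fun i => by
    have := hF i
    have h2 : ∀ j : ℕ, Measurable fun ω : ℕ → Ω => F i (ω j) := fun j =>
      (hF i).comp (measurable_pi_apply j)
    exact ((Finset.measurable_sum _ fun j _ => h2 j).sub measurable_const).norm
  have hS : MeasurableSet {ω : ℕ → Ω |
      ∀ i, |∑ j ∈ Finset.range m, F i (ω j) - m * ∫ x, F i x ∂μ| ≤ ε} := by
    simp only [Set.ofPred_forall]
    exact MeasurableSet.iInter fun i => measurableSet_le (hm i) measurable_const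
  have hc := probReal_compl_eq_one_sub (μ := Measure.infinitePi fun _ : ℕ => μ) hS
  have hU : {ω : ℕ → Ω | ∀ i, |∑ j ∈ Finset.range m, F i (ω j) - m * ∫ x, F i x ∂μ| ≤ ε}ᶜ =
      ⋃ i, {ω | ε < |∑ j ∈ Finset.range m, F i (ω j) - m * ∫ x, F i x ∂μ|} := by
    ext ω
    simp
  have hle := measureReal_iUnion_fintype_le (μ := Measure.infinitePi fun _ : ℕ => μ)
    fun i => {ω : ℕ → Ω | ε < |∑ j ∈ Finset.range m, F i (ω j) - m * ∫ x, F i x ∂μ|}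
  rw [← hU, hc] at hle
  have := Finset.sum_le_sum fun i (_ : i ∈ Finset.univ) =>
    measure_infinitePi_abs_sum_gt_le (μ := μ) (hF i) (hb i) m hε
  rw [Finset.sum_const, nsmul_eq_mul, Finset.card_univ] at this
  linarith

end Hoeffding

/-! ### Characters: orthogonality and Parseval's identity. -/

/-- The character of `T`, as a function of the set `R` of the coordinates `-1`. -/
def chi (T R : Finset ℕ) : ℝ := ∏ i ∈ T, if i ∈ R then -1 else 1

section Fourier

variable {S T W R : Finset ℕ}

@[simp] theorem chi_empty : chi ∅ R = 1 := by simp [chi]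

theorem abs_chi (T R : Finset ℕ) : |chi T R| = 1 := by
  rw [chi, Finset.abs_prod]
  exact Finset.prod_eq_one fun i _ => by split_ifs <;> simp

theorem chi_congr {R' : Finset ℕ} (h : ∀ i ∈ T, i ∈ R ↔ i ∈ R') : chi T R = chi T R' :=
  Finset.prod_congr rfl fun i hi => by simp [h i hi]

theorem sum_powerset_prod_ite (W : Finset ℕ) (a b : ℕ → ℝ) :
    ∑ R ∈ W.powerset, ∏ i ∈ W, (if i ∈ R then a i else b i) = ∏ i ∈ W, (a i + b i) := by
  rw [Finset.prod_add]
  refine Finset.sum_congr rfl fun R hR => ?_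
  rw [Finset.prod_ite, Finset.filter_mem_eq_inter, Finset.inter_eq_right.2
    (Finset.mem_powerset.1 hR), ← Finset.sdiff_eq_filter]

theorem chi_eq_prod (hT : T ⊆ W) (R : Finset ℕ) :
    chi T R = ∏ i ∈ W, if i ∈ R then (if i ∈ T then (-1 : ℝ) else 1) else 1 := by
  rw [chi, ← Finset.prod_subset hT]
  · exact Finset.prod_congr rfl fun i hi => by simp [hi]
  · intro i _ hi
    simp [hi]

/-- The sum factors over the coordinates: a coordinate contributes 2 if `S` and `T` agree there and
0 otherwise. -/
theorem sum_chi_mul_chi (hS : S ⊆ W) (hT : T ⊆ W) :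
    ∑ R ∈ W.powerset, chi S R * chi T R = if S = T then 2 ^ W.card else 0 := by
  have : ∀ R, chi S R * chi T R = ∏ i ∈ W, if i ∈ R then
      (if i ∈ S then (-1 : ℝ) else 1) * (if i ∈ T then (-1 : ℝ) else 1) else 1 := by
    intro R
    rw [chi_eq_prod hS, chi_eq_prod hT, ← Finset.prod_mul_distrib]
    exact Finset.prod_congr rfl fun i _ => by split_ifs <;> simp
  simp only [this]
  rw [sum_powerset_prod_ite]
  split_ifs with h
  · subst h
    rw [Finset.prod_congr rfl (g := fun _ => 2), Finset.prod_const]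
    intro i _
    split_ifs <;> norm_num
  · obtain ⟨i, hi⟩ : ∃ i, ¬(i ∈ S ↔ i ∈ T) := by
      by_contra! h'
      exact h (Finset.ext h')
    have hW : i ∈ W := by
      by_cases hS' : i ∈ S
      · exact hS hS'
      · exact hT (by tauto)
    refine Finset.prod_eq_zero hW ?_
    by_cases hS' : i ∈ S <;> by_cases hT' : i ∈ T <;> simp [hS', hT'] <;> tauto

theorem sum_sum_mul_chi_mul_chi (b : Finset ℕ → ℝ) (hT : T ⊆ W) :
    ∑ R ∈ W.powerset, (∑ S ∈ W.powerset, b S * chi S R) * chi T R = 2 ^ W.card * b T := by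
  simp only [Finset.sum_mul, mul_assoc]
  rw [Finset.sum_comm]
  simp only [← Finset.mul_sum]
  rw [Finset.sum_congr rfl fun S hS => by
    rw [sum_chi_mul_chi (Finset.mem_powerset.1 hS) hT]]
  simp [hT, mul_comm]

theorem sum_sq_sum_mul_chi (b : Finset ℕ → ℝ) (W : Finset ℕ) :
    ∑ R ∈ W.powerset, (∑ T ∈ W.powerset, b T * chi T R) ^ 2 =
      2 ^ W.card * ∑ T ∈ W.powerset, b T ^ 2 := by
  have : ∀ R, (∑ T ∈ W.powerset, b T * chi T R) ^ 2 =
      ∑ T ∈ W.powerset, b T * ((∑ S ∈ W.powerset, b S * chi S R) * chi T R) := by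
    intro R
    rw [sq, Finset.mul_sum]
    exact Finset.sum_congr rfl fun T _ => by ring
  simp only [this]
  rw [Finset.sum_comm, Finset.mul_sum]
  refine Finset.sum_congr rfl fun T hT => ?_
  rw [← Finset.mul_sum, sum_sum_mul_chi_mul_chi b (Finset.mem_powerset.1 hT)]
  ring

/-- The sum is a product of factors `1 ± 1`, killed by any common element of `S` and `R`. Read
backwards, the indicator of disjointness is an average of characters. -/
theorem sum_powerset_chi (S R : Finset ℕ) :
    ∑ T ∈ S.powerset, chi T R = if Disjoint S R then 2 ^ S.card else 0 := by
  simp only [chi]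
  rw [← Finset.prod_one_add]
  split_ifs with h
  · rw [Finset.prod_congr rfl (g := fun _ => 2), Finset.prod_const]
    intro i hi
    rw [if_neg (Finset.disjoint_left.1 h hi)]
    norm_num
  · obtain ⟨i, hi, hR⟩ := Finset.not_disjoint_iff.1 h
    exact Finset.prod_eq_zero hi (by simp [hR])

end Fourier

/-! ### Coverage functions on sets: submodularity and Fourier expansion. -/

/-- Coverage functions, as functions of sets. -/
def IsSetCoverage (f : Finset ℕ → ℝ) : Prop :=
  ∃ (N : ℕ) (w : Fin N → ℝ) (S : Fin N → Finset ℕ) (a : ℝ), (∀ u, 0 ≤ w u) ∧ 0 ≤ a ∧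
    ∀ R, f R = a + ∑ u, if Disjoint (S u) R then 0 else w u

namespace IsSetCoverage

variable {f : Finset ℕ → ℝ}

theorem nonneg (hf : IsSetCoverage f) (R : Finset ℕ) : 0 ≤ f R := by
  obtain ⟨N, w, S, a, hw, ha, h⟩ := hf
  rw [h]
  exact add_nonneg ha (Finset.sum_nonneg fun u _ => by split_ifs <;> simp [hw])

theorem mono (hf : IsSetCoverage f) {R R' : Finset ℕ} (hR : R ⊆ R') : f R ≤ f R' := by
  obtain ⟨N, w, S, a, hw, ha, h⟩ := hf
  rw [h, h]
  refine add_le_add le_rfl (Finset.sum_le_sum fun u _ => ?_)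
  by_cases h' : Disjoint (S u) R'
  · simp [h', h'.mono_right hR]
  · by_cases h'' : Disjoint (S u) R <;> simp [h', h'', hw]

/-- Submodularity holds element by element: whatever `A` newly covers over `R'` it also newly covers
over the smaller `R`. -/
theorem sub_le_sub (hf : IsSetCoverage f) {R R' : Finset ℕ} (A : Finset ℕ) (hR : R ⊆ R') :
    f (R' ∪ A) - f R' ≤ f (R ∪ A) - f R := by
  obtain ⟨N, w, S, a, hw, ha, h⟩ := hf
  simp only [h, add_sub_add_left_eq_sub, ← Finset.sum_sub_distrib]
  refine Finset.sum_le_sum fun u _ => ?_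
  have := hw u
  by_cases h1 : Disjoint (S u) R' <;> by_cases h2 : Disjoint (S u) A
  · simp [h1, h2, h1.mono_right hR]
  · simp [h1, h2, h1.mono_right hR]
  all_goals by_cases h3 : Disjoint (S u) R <;> simp [h1, h2, h3, this]

theorem union_le (hf : IsSetCoverage f) (R A : Finset ℕ) : f (R ∪ A) ≤ f R + f A := by
  have h1 := hf.sub_le_sub A (Finset.empty_subset R)
  have h2 := hf.nonneg ∅
  rw [Finset.empty_union] at h1
  linarith

theorem insert_sub_le (hf : IsSetCoverage f) (i : ℕ) (R : Finset ℕ) :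
    f (insert i R) - f R ≤ f {i} := by
  have := hf.union_le R {i}
  rw [Finset.union_comm, ← Finset.insert_eq] at this
  linarith

/-- The Fourier expansion on a subcube. -/
theorem exists_expansion (hf : IsSetCoverage f) (N W : Finset ℕ) :
    ∃ q : Finset ℕ → ℝ, (∀ T, 0 ≤ q T) ∧ (∀ S T, S ⊆ T → q T ≤ q S) ∧
      ∑ T ∈ W.powerset, q T ≤ f (N ∪ W) ∧
      ∀ R ⊆ W, f (N ∪ R) = f (N ∪ W) - ∑ T ∈ W.powerset, q T * chi T R := by
  obtain ⟨n, w, S, a, hw, ha, h⟩ := hf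
  -- The elements whose fate is open on the subcube: if `S u` meets `N`, then `u` is always covered,
  -- and if it meets neither `N` nor `W`, never. An open element is missed when `S u ∩ W` is
  -- disjoint from `R`, an event that is the average of the characters of the subsets of `S u ∩ W`.
  let A : Fin n → Prop := fun u => Disjoint (S u) N ∧ ¬Disjoint (S u) W
  classical
  let v : Fin n → ℝ := fun u => if A u then w u * (2 ^ (S u ∩ W).card)⁻¹ else 0
  have hv : ∀ u, 0 ≤ v u := by
    intro u
    simp only [v]
    split_ifs
    · have := hw u
      positivity
    · rfl
  -- Exchange of summation, used with `x = 1` for the total mass and with characters for the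
  -- expansion.
  have hq : ∀ x : Finset ℕ → ℝ,
      ∑ T ∈ W.powerset, (∑ u, if T ⊆ S u ∩ W then v u else 0) * x T =
        ∑ u, v u * ∑ T ∈ (S u ∩ W).powerset, x T := by
    intro x
    simp only [Finset.sum_mul, Finset.mul_sum]
    rw [Finset.sum_comm]
    refine Finset.sum_congr rfl fun u _ => ?_
    rw [← Finset.sum_subset (Finset.powerset_mono.2 (Finset.inter_subset_right (s₁ := S u)))]
    · refine Finset.sum_congr rfl fun T hT => ?_
      rw [if_pos (Finset.mem_powerset.1 hT)]
    · intro T _ hT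
      rw [if_neg fun h => hT (Finset.mem_powerset.2 h), zero_mul]
  refine ⟨fun T => ∑ u, if T ⊆ S u ∩ W then v u else 0, fun T => ?_, fun S' T hST => ?_, ?_, ?_⟩
  · exact Finset.sum_nonneg fun u _ => by split_ifs <;> simp [hv]
  · refine Finset.sum_le_sum fun u _ => ?_
    by_cases h1 : T ⊆ S u ∩ W
    · simp only [if_pos h1, if_pos (hST.trans h1), le_refl]
    · rw [if_neg h1]
      split_ifs <;> simp [hv]
  · have := hq fun _ => 1
    simp only [mul_one] at this
    rw [this, h]
    refine (Finset.sum_le_sum fun u _ => ?_).trans (le_add_of_nonneg_left ha)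
    simp only [v, A, Finset.disjoint_union_right, Finset.sum_const, Finset.card_powerset,
      nsmul_eq_mul, mul_one]
    have hu := hw u
    by_cases h1 : Disjoint (S u) N <;> by_cases h2 : Disjoint (S u) W <;> simp [h1, h2, hu]
  · intro R hR
    simp only [hq, sum_powerset_chi, h, add_sub_assoc, add_right_inj, ← Finset.sum_sub_distrib]
    refine Finset.sum_congr rfl fun u _ => ?_
    have h3 : Disjoint (S u ∩ W) R ↔ Disjoint (S u) R := by
      rw [Finset.disjoint_iff_inter_eq_empty, Finset.disjoint_iff_inter_eq_empty,
        Finset.inter_assoc, Finset.inter_eq_right.2 hR]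
    simp only [v, A, Finset.disjoint_union_right, h3]
    by_cases h1 : Disjoint (S u) N <;> by_cases h2 : Disjoint (S u) W
    · simp [h1, h2, h2.mono_right hR]
    · by_cases h4 : Disjoint (S u) R <;> simp [h1, h2, h4]
    all_goals simp [h1, h2]

end IsSetCoverage

/-! ### Lower tails of coverage functions. -/

theorem exp_add_exp_le_two {d : ℝ} (h0 : 0 ≤ d) (h1 : d ≤ 1) :
    Real.exp (3 / 8 * d) + Real.exp (3 / 8 * d - d) ≤ 2 := by
  -- The midpoint of the two exponents is `-d / 8`. What remains is `cosh (d / 2) ≤ exp (d ^ 2 /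
  -- 8)`, and `d ^ 2 ≤ d`.
  have e1 : Real.exp (3 / 8 * d) + Real.exp (3 / 8 * d - d) =
      2 * (Real.exp (-(d / 8)) * Real.cosh (d / 2)) := by
    rw [Real.cosh_eq, mul_div_assoc', mul_add, ← Real.exp_add, ← Real.exp_add]
    ring_nf
  have e2 : Real.exp (-(d / 8)) * Real.exp ((d / 2) ^ 2 / 2) ≤ 1 := by
    rw [← Real.exp_add, Real.exp_le_one_iff]
    nlinarith
  have e3 := mul_le_mul_of_nonneg_left (Real.cosh_le_exp_half_sq (d / 2))
    (Real.exp_nonneg (-(d / 8)))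
  rw [e1]
  linarith

namespace IsSetCoverage

variable {f : Finset ℕ → ℝ}

/-- A Chernoff bound for the lower tail of a coverage function whose singletons have small
values. -/
theorem sum_exp_neg_le (hf : IsSetCoverage f) {β : ℝ} (hβ : 0 < β) (W : Finset ℕ)
    (hW : ∀ i ∈ W, f {i} ≤ β) (N : Finset ℕ) :
    ∑ R ∈ W.powerset, Real.exp (-(f (N ∪ R) / β)) ≤
      2 ^ W.card * Real.exp (-(3 / 8 * ((f (N ∪ W) - f N) / β)) - f N / β) := by
  induction W using Finset.induction_on generalizing N with
  | empty => simp
  | insert i W hi ih =>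
    have hW' : ∀ j ∈ W, f {j} ≤ β := fun j hj => hW j (Finset.mem_insert_of_mem hj)
    -- Condition on whether `i ∈ R`; in the second case `i` joins the fixed set, so the induction
    -- must be uniform in `N`.
    rw [Finset.sum_powerset_insert hi, Finset.card_insert_of_notMem hi, pow_succ]
    have h1 := ih hW' N
    have h2 := ih hW' (insert i N)
    simp only [Finset.union_insert, ← Finset.insert_union] at h2 ⊢
    have hd0 : f N ≤ f (insert i N) := hf.mono (Finset.subset_insert i N)
    have hd1 := (hf.insert_sub_le i N).trans (hW i (Finset.mem_insert_self i W))
    have hs := hf.sub_le_sub {i} (Finset.subset_union_left (s₁ := N) (s₂ := W))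
    simp only [Finset.union_comm _ {i}, ← Finset.insert_eq, ← Finset.insert_union] at hs
    set d := (f (insert i N) - f N) / β with hd
    have hd0' : 0 ≤ d := div_nonneg (by linarith) hβ.le
    have hd1' : d ≤ 1 := (div_le_one hβ).2 hd1
    -- `E` is the target exponential. The branch without `i` loses at most `exp (3 / 8 * d)`, by
    -- submodularity; the branch with `i` has exactly the factor `exp (3 / 8 * d - d)`. Their sum is
    -- at most 2.
    set E := Real.exp (-(3 / 8 * ((f (insert i N ∪ W) - f N) / β)) - f N / β)
    have h3 : Real.exp (-(3 / 8 * ((f (N ∪ W) - f N) / β)) - f N / β) ≤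
        E * Real.exp (3 / 8 * d) := by
      rw [← Real.exp_add, Real.exp_le_exp, hd]
      have : f (insert i N ∪ W) / β ≤ f (N ∪ W) / β + f (insert i N) / β - f N / β := by
        rw [← add_div, ← sub_div]
        gcongr
        linarith
      simp only [sub_div]
      linarith
    have h4 : Real.exp (-(3 / 8 * ((f (insert i N ∪ W) - f (insert i N)) / β)) -
        f (insert i N) / β) = E * Real.exp (3 / 8 * d - d) := by
      rw [← Real.exp_add, hd]
      ring_nf
    rw [h4] at h2
    have h5 := mul_le_mul_of_nonneg_left (exp_add_exp_le_two hd0' hd1')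
      (mul_nonneg (pow_nonneg zero_le_two W.card) (Real.exp_nonneg _) : (0 : ℝ) ≤ 2 ^ W.card * E)
    have h6 := mul_le_mul_of_nonneg_left h3 (pow_nonneg (zero_le_two (α := ℝ)) W.card)
    linarith

theorem card_lt_le (hf : IsSetCoverage f) {α : ℝ} (hα : 0 < α) {W : Finset ℕ}
    (hW : ∀ i ∈ W, α * f {i} ≤ f W) :
    ((W.powerset.filter fun R => 2 * α * f R < f W).card : ℝ) ≤
      2 ^ W.card * Real.exp (1 / 2 - 3 / 8 * α) := by
  rcases (hf.nonneg W).eq_or_lt with h0 | h0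
  · rw [Finset.filter_false_of_mem]
    · simp only [Finset.card_empty, Nat.cast_zero]
      positivity
    · intro R _
      have := hf.nonneg R
      rw [← h0, not_lt]
      positivity
  have hβ : 0 < f W / α := div_pos h0 hα
  have h1 := hf.sum_exp_neg_le hβ W (fun i hi => by rw [le_div_iff₀ hα, mul_comm]; exact hW i hi) ∅
  simp only [Finset.empty_union] at h1
  -- Markov's inequality for the exponential moment with `β = f W / α`: the condition on `R` reads
  -- `f R / β < 1 / 2`.
  have h2 : (W.powerset.filter fun R => 2 * α * f R < f W).card * Real.exp (-(1 / 2)) ≤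
      ∑ R ∈ W.powerset, Real.exp (-(f R / (f W / α))) := by
    rw [← nsmul_eq_mul, ← Finset.sum_const]
    refine (Finset.sum_le_sum fun R hR => ?_).trans
      (Finset.sum_le_sum_of_subset_of_nonneg (Finset.filter_subset _ _)
        fun _ _ _ => Real.exp_nonneg _)
    rw [Real.exp_le_exp, neg_le_neg_iff, div_le_iff₀ hβ]
    have := (Finset.mem_filter.1 hR).2
    rw [mul_div_assoc', le_div_iff₀ hα]
    linarith
  have h3 : Real.exp (-(3 / 8 * ((f W - f ∅) / (f W / α))) - f ∅ / (f W / α)) ≤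
      Real.exp (-(3 / 8 * α)) := by
    rw [Real.exp_le_exp, sub_div, div_div_cancel₀ h0.ne']
    have : 0 ≤ f ∅ / (f W / α) := div_nonneg (hf.nonneg _) hβ.le
    linarith
  rw [sub_eq_add_neg, Real.exp_add, ← mul_le_mul_iff_of_pos_right (Real.exp_pos (-(1 / 2)))]
  calc _ ≤ _ := h2.trans h1
    _ ≤ 2 ^ W.card * Real.exp (-(3 / 8 * α)) := by gcongr
    _ = 2 ^ W.card * (Real.exp (1 / 2) * Real.exp (-(3 / 8 * α))) * Real.exp (-(1 / 2)) := by
      have : Real.exp (1 / 2) * Real.exp (-(1 / 2)) = 1 := by rw [← Real.exp_add]; simp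
      linear_combination -(2 ^ W.card * Real.exp (-(3 / 8 * α))) * this

/-- On at least half of the points a coverage function is at least half of its maximum. -/
theorem le_two_mul_card_le (hf : IsSetCoverage f) (W : Finset ℕ) :
    2 ^ W.card ≤ 2 * (W.powerset.filter fun R => f W ≤ 2 * f R).card := by
  -- By subadditivity `R` or `W \ R` has at least half of the value of `W`.
  have h : W.powerset ⊆ (W.powerset.filter fun R => f W ≤ 2 * f R) ∪
      (W.powerset.filter fun R => f W ≤ 2 * f R).image fun R => W \ R := by
    intro R hR
    have hR' := Finset.mem_powerset.1 hR
    by_cases h1 : f W ≤ 2 * f R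
    · exact Finset.mem_union_left _ (Finset.mem_filter.2 ⟨hR, h1⟩)
    · refine Finset.mem_union_right _ (Finset.mem_image.2 ⟨W \ R, Finset.mem_filter.2
        ⟨Finset.mem_powerset.2 Finset.sdiff_subset, ?_⟩, Finset.sdiff_sdiff_eq_self hR'⟩)
      have := hf.union_le R (W \ R)
      rw [Finset.union_sdiff_of_subset hR'] at this
      linarith
  have h1 := (Finset.card_le_card h).trans (Finset.card_union_le _ _)
  have h2 := Finset.card_image_le (s := W.powerset.filter fun R => f W ≤ 2 * f R)
    (f := fun R => W \ R)
  rw [Finset.card_powerset] at h1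
  omega

end IsSetCoverage

/-! ### Sparse approximation in mean square. -/

theorem sum_sq_truncated_sub_le {W : Finset ℕ} {A : Finset (Finset ℕ)} {a b : Finset ℕ → ℝ} {ε : ℝ}
    (hA : A ⊆ W.powerset) (hb : ∀ T ∈ A, |b T - a T| ≤ ε) :
    ∑ R ∈ W.powerset, (∑ T ∈ A, b T * chi T R - ∑ T ∈ W.powerset, a T * chi T R) ^ 2 ≤
      2 ^ W.card * (A.card * ε ^ 2 + ∑ T ∈ W.powerset \ A, a T ^ 2) := by
  have h1 : ∀ R, ∑ T ∈ A, b T * chi T R - ∑ T ∈ W.powerset, a T * chi T R =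
      ∑ T ∈ W.powerset, ((if T ∈ A then b T else 0) - a T) * chi T R := by
    intro R
    simp only [sub_mul, Finset.sum_sub_distrib, ite_mul, zero_mul]
    rw [Finset.sum_ite_mem, Finset.inter_eq_right.2 hA]
  simp only [h1]
  -- Parseval: the kept coefficients contribute their estimation errors, the omitted ones their
  -- squares.
  rw [sum_sq_sum_mul_chi, ← Finset.sum_sdiff hA, add_comm, ← nsmul_eq_mul A.card,
    ← Finset.sum_const]
  refine mul_le_mul_of_nonneg_left (add_le_add (Finset.sum_le_sum fun T hT => ?_)
    (Finset.sum_le_sum fun T hT => ?_)) (by positivity)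
  · rw [if_pos hT]
    exact sq_le_sq' (abs_le.1 (hb T hT)).1 (abs_le.1 (hb T hT)).2
  · rw [if_neg (Finset.mem_sdiff.1 hT).2]
    simp

namespace IsSetCoverage

open Learner

variable {f : Finset ℕ → ℝ}

/-- The quadratic error of the sparse approximation that the search finds. -/
theorem sum_sq_search_sub_le (hf : IsSetCoverage f) {N W : Finset ℕ} {b : Finset ℕ → ℝ}
    {θ Mh : ℝ} {K k n : ℕ} {marked : ℕ → Prop} {ok : Finset ℕ → Prop} (hθ : 0 < θ) (hθ1 : θ ≤ 1)
    (hk : 1 < 2 ^ (k + 1) * θ) (hK : 1 / θ + 1 < K) (hW : ∀ i, i ∈ W ↔ i < n ∧ ¬ marked i)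
    (hM : f (N ∪ W) ≤ 2 * Mh) (hM' : Mh ≤ f (N ∪ W))
    (hb : ∀ T ⊆ W, T.card ≤ k + 1 →
      |2 ^ W.card * b T - ∑ R ∈ W.powerset, f (N ∪ R) * chi T R| ≤ 2 ^ W.card * (θ * f (N ∪ W)))
    (hok : ∀ T ⊆ W, ok T ↔ b T < -(4 * θ * Mh)) :
    ∑ R ∈ W.powerset, (∑ T ∈ (search K ok marked n).toFinset, b T * chi T R - f (N ∪ R)) ^ 2 ≤
      2 ^ W.card * (7 * θ * f (N ∪ W) ^ 2) := by
  obtain ⟨q, hq0, hqa, hqs, hq⟩ := hf.exists_expansion N W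
  set M := f (N ∪ W) with hMdef
  have hM0 : 0 ≤ M := hf.nonneg _
  set a : Finset ℕ → ℝ := fun T => (if T = ∅ then M else 0) - q T with ha
  have hfa : ∀ R ∈ W.powerset, f (N ∪ R) = ∑ T ∈ W.powerset, a T * chi T R := by
    intro R hR
    rw [hq R (Finset.mem_powerset.1 hR)]
    simp only [ha, sub_mul, Finset.sum_sub_distrib, ite_mul, zero_mul]
    simp
  have hba : ∀ T ⊆ W, T.card ≤ k + 1 → |b T - a T| ≤ θ * M := by
    intro T hT hc
    have h1 := hb T hT hc
    rw [Finset.sum_congr rfl fun R hR => by rw [hfa R hR], sum_sum_mul_chi_mul_chi a hT,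
      ← mul_sub, abs_mul, abs_of_pos (by positivity)] at h1
    exact le_of_mul_le_mul_left h1 (by positivity)
  -- All `2 ^ T.card` subsets of `T` have at least the mass of `T`, and the total mass is at most
  -- `M`.
  have hqT : ∀ T ⊆ W, 2 ^ T.card * q T ≤ M := by
    intro T hT
    rw [← Nat.cast_ofNat, ← Nat.cast_pow, ← Finset.card_powerset, ← nsmul_eq_mul,
      ← Finset.sum_const]
    refine (Finset.sum_le_sum fun S hS => hqa S T (Finset.mem_powerset.1 hS)).trans
      ((Finset.sum_le_sum_of_subset_of_nonneg (Finset.powerset_mono.2 hT)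
        fun _ _ _ => hq0 _).trans hqs)
  have haq : ∀ T : Finset ℕ, T.Nonempty → a T = -q T := fun T hT => by
    simp [ha, hT.ne_empty]
  have hsub : ∀ T ∈ search K ok marked n, T ⊆ W := fun T hT i hi =>
    (hW i).2 ((mem_search hT).1 i hi)
  -- Since `M ≤ 2 * Mh`, acceptance means an estimate below `-2θM`, and the estimation error is at
  -- most `θM`.
  have hacc : ∀ T ⊆ W, T.Nonempty → T.card ≤ k + 1 → ok T → θ * M < q T := by
    intro T hT hne hc hokT
    have h1 := (abs_le.1 (hba T hT hc)).1
    rw [haq T hne] at h1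
    have h2 := (hok T hT).1 hokT
    nlinarith
  -- Estimates are reliable only up to `k + 1` elements. An accepted set has an accepted subset with
  -- one element less, so by induction it has at most `k + 1` elements and its estimate is reliable;
  -- exactly `k + 1` is then excluded by `hqT` and `hk`.
  have hcard : ∀ c, ∀ T ∈ search K ok marked n, T.card = c → c ≤ k := by
    intro c
    induction c with
    | zero => intros; omega
    | succ c ih =>
      intro T hT hc
      have hne : T.Nonempty := Finset.card_pos.1 (by omega)
      obtain ⟨hokT, i, hi, he⟩ := (mem_search hT).2 hne
      have hck := ih _ he (by rw [Finset.card_erase_of_mem hi, hc]; rfl)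
      have h1 := hacc T (hsub T hT) hne (by omega) hokT
      have h2 := hqT T (hsub T hT)
      by_contra! h3
      have h4 : c = k := by omega
      rw [hc, h4] at h2
      have h5 : (0 : ℝ) < 2 ^ (k + 1) := by positivity
      nlinarith [mul_lt_mul_of_pos_left h1 h5]
  set A := (search K ok marked n).toFinset with hAdef
  have hAW : A ⊆ W.powerset := fun T hT =>
    Finset.mem_powerset.2 (hsub T (List.mem_toFinset.1 hT))
  have hA0 : ∅ ∈ A := by
    obtain ⟨l', hl⟩ := search_ne_nil (K := K) (ok := ok) (v := n) (marked := marked)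
    simp [hAdef, hl]
  have hAq : ∀ T ∈ A.erase ∅, θ * M < q T := by
    intro T hT
    obtain ⟨hne, hT⟩ := Finset.mem_erase.1 hT
    have hT' := List.mem_toFinset.1 hT
    have hne := Finset.nonempty_iff_ne_empty.2 hne
    exact hacc T (hsub T hT') hne ((hcard _ T hT' rfl).trans (by omega)) ((mem_search hT').2 hne).1
  have hAc : (A.card : ℝ) - 1 = (A.erase ∅).card := by
    rw [Finset.card_erase_of_mem hA0, Nat.cast_sub (Finset.card_pos.2 ⟨_, hA0⟩), Nat.cast_one]
  have hAM : ((A.card : ℝ) - 1) * (θ * M) ≤ M := by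
    rw [hAc, ← nsmul_eq_mul, ← Finset.sum_const]
    exact (Finset.sum_le_sum fun T hT => (hAq T hT).le).trans ((Finset.sum_le_sum_of_subset_of_nonneg
      ((Finset.erase_subset _ _).trans hAW) fun _ _ _ => hq0 _).trans hqs)
  have hAcard : (A.card : ℝ) ≤ 1 / θ + 1 := by
    rcases hM0.eq_or_lt with h0 | h0
    · have : A.erase ∅ = ∅ := by
        refine Finset.eq_empty_of_forall_notMem fun T hT => ?_
        have h1 := hAq T hT
        have h2 := hqT T (Finset.mem_powerset.1 (hAW (Finset.mem_of_mem_erase hT)))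
        rw [← h0, mul_zero] at h1
        rw [← h0] at h2
        have : 0 < 2 ^ T.card * q T := by positivity
        linarith
      rw [this, Finset.card_empty, Nat.cast_zero] at hAc
      have : 0 < 1 / θ := by positivity
      linarith
    · rw [← sub_le_iff_le_add, le_div_iff₀ hθ]
      rw [← mul_assoc] at hAM
      exact le_of_mul_le_mul_right (by linarith) h0
  -- The capacity was not reached, so no set was lost for lack of room.
  have hlen : (search K ok marked n).length < K := by
    rw [← List.toFinset_card_of_nodup nodup_search, ← Nat.cast_lt (α := ℝ)]
    exact hAcard.trans_lt hK
  -- A missing set has a rejected nonempty subset `S`, and its coefficient is at most that of `S`.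
  -- If `S` is too large for a reliable estimate, its coefficient is small by `hqT`.
  have hrej : ∀ T ∈ W.powerset \ A, q T ≤ 5 * θ * M := by
    intro T hT
    obtain ⟨hT, hTA⟩ := Finset.mem_sdiff.1 hT
    have hT := Finset.mem_powerset.1 hT
    have h1 : ¬ ∀ S ⊆ T, S.Nonempty → ok S := fun h =>
      hTA (List.mem_toFinset.2 (mem_search_of_ok hlen (fun i hi => (hW i).1 (hT hi)) h))
    push Not at h1
    obtain ⟨S, hS, hne, hokS⟩ := h1
    by_cases hc : S.card ≤ k + 1
    · refine (hqa S T hS).trans ?_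
      have h2 := (abs_le.1 (hba S (hS.trans hT) hc)).2
      rw [haq S hne] at h2
      rw [hok S (hS.trans hT), not_lt] at hokS
      nlinarith
    · have h2 := hqT S (hS.trans hT)
      have h3 : (2 : ℝ) ^ (k + 1) ≤ 2 ^ S.card :=
        pow_le_pow_right₀ one_le_two (by omega)
      have h4 : 2 ^ (k + 1) * q S ≤ M := (mul_le_mul_of_nonneg_right h3 (hq0 S)).trans h2
      have h5 : q S ≤ θ * M := by
        have := mul_le_mul_of_nonneg_left h4 hθ.le
        nlinarith [hq0 S]
      have := hqa S T hS
      nlinarith [mul_nonneg hθ.le hM0]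
  rw [Finset.sum_congr rfl fun R hR => by rw [hfa R hR]]
  refine (sum_sq_truncated_sub_le hAW (ε := θ * M) fun T hT => hba T
    (Finset.mem_powerset.1 (hAW hT)) ((hcard _ T (List.mem_toFinset.1 hT) rfl).trans
      (by omega))).trans ?_
  gcongr
  -- The omitted squares are at most their maximum `5θM` times the total mass `M`. The kept terms
  -- add `(1 / θ + 1) * (θM) ^ 2 ≤ 2θM ^ 2`, which makes `7θM ^ 2`.
  have h1 : ∑ T ∈ W.powerset \ A, a T ^ 2 ≤ 5 * θ * M * M := by
    calc ∑ T ∈ W.powerset \ A, a T ^ 2 ≤ ∑ T ∈ W.powerset \ A, 5 * θ * M * q T := by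
          refine Finset.sum_le_sum fun T hT => ?_
          have hne : T.Nonempty := Finset.nonempty_iff_ne_empty.2 fun h =>
            (Finset.mem_sdiff.1 hT).2 (h ▸ hA0)
          rw [haq T hne, neg_sq, sq]
          exact mul_le_mul_of_nonneg_right (hrej T hT) (hq0 T)
      _ ≤ 5 * θ * M * M := by
          rw [← Finset.mul_sum]
          refine mul_le_mul_of_nonneg_left ((Finset.sum_le_sum_of_subset_of_nonneg
            Finset.sdiff_subset fun _ _ _ => hq0 _).trans hqs) (by positivity)
  have h2 : A.card * (θ * M) ^ 2 ≤ (θ + θ ^ 2) * M ^ 2 := by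
    have := mul_le_mul_of_nonneg_right hAcard (sq_nonneg (θ * M))
    refine this.trans_eq ?_
    field_simp
  have h3 : θ ^ 2 * M ^ 2 ≤ θ * M ^ 2 := by
    refine mul_le_mul_of_nonneg_right ?_ (sq_nonneg M)
    nlinarith
  linarith

end IsSetCoverage

/-! ### Empirical estimates on subcubes. -/

namespace IsSetCoverage

open Learner

variable {f : Finset ℕ → ℝ} {P N W R T : Finset ℕ} {n m k : ℕ} {Q α g κ Mh : ℝ}
  {Rs : ℕ → Finset ℕ}

/-- The average of `φ` over the samples is close to its expectation. -/
def Accurate (n m : ℕ) (Q : ℝ) (Rs : ℕ → Finset ℕ) (φ : Finset ℕ → ℝ) : Prop :=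
  |∑ j ∈ Finset.range m, φ (Rs j) - m * ((∑ R ∈ (Finset.range n).powerset, φ R) / 2 ^ n)| ≤ m / Q

/-- The subcube of the sets `R` that contain `N` and do not meet `P`. -/
def Box (P N R : Finset ℕ) : Prop := Disjoint P R ∧ N ⊆ R

instance : DecidablePred (Box P N) := fun _ => instDecidableAnd

/-- The normalized correlation with the character of `T` on a subcube. -/
def corrTest (f : Finset ℕ → ℝ) (n : ℕ) (P N T R : Finset ℕ) : ℝ :=
  if Box P N R then f R / f (Finset.range n \ P) * chi T R else 0

open Classical in
/-- The indicator of small values on a subcube. -/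
def lowTest (f : Finset ℕ → ℝ) (n : ℕ) (α : ℝ) (P N R : Finset ℕ) : ℝ :=
  if Box P N R ∧ 2 * α * f R < f (Finset.range n \ P) then 1 else 0

open Classical in
/-- The indicator of large values on a subcube. -/
def highTest (f : Finset ℕ → ℝ) (n : ℕ) (P R : Finset ℕ) : ℝ :=
  if Box P ∅ R ∧ f (Finset.range n \ P) ≤ 2 * f R then 1 else 0

theorem le_of_box (hf : IsSetCoverage f) (hR : R ⊆ Finset.range n) (h : Box P N R) :
    f R ≤ f (Finset.range n \ P) :=
  hf.mono (Finset.subset_sdiff.2 ⟨hR, h.1.symm⟩)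

theorem div_mul_self_of_box (hf : IsSetCoverage f) (hR : R ⊆ Finset.range n) (h : Box P N R) :
    f R / f (Finset.range n \ P) * f (Finset.range n \ P) = f R :=
  div_mul_cancel_of_imp fun h0 => le_antisymm (h0 ▸ hf.le_of_box hR h) (hf.nonneg R)

/-- The sets in a subcube are `N ∪ R`, where `R` is a set of free coordinates. -/
theorem sum_box (hPN : Disjoint P N) (hN : N ⊆ Finset.range n) (φ : Finset ℕ → ℝ) :
    ∑ R ∈ (Finset.range n).powerset, (if Box P N R then φ R else 0) =
      ∑ R ∈ (Finset.range n \ (P ∪ N)).powerset, φ (N ∪ R) := by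
  rw [← Finset.sum_filter]
  refine Finset.sum_bij' (fun R _ => R \ N) (fun R _ => N ∪ R) ?_ ?_ ?_ ?_ ?_
  · intro R hR
    simp only [Finset.mem_filter, Finset.mem_powerset] at hR ⊢
    intro i hi
    have h1 := Finset.mem_sdiff.1 hi
    have h2 := Finset.disjoint_right.1 hR.2.1 h1.1
    simp only [Finset.mem_sdiff, Finset.mem_union, not_or]
    exact ⟨hR.1 h1.1, h2, h1.2⟩
  · intro R hR
    simp only [Finset.mem_filter, Finset.mem_powerset] at hR ⊢
    refine ⟨Finset.union_subset hN (hR.trans Finset.sdiff_subset),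
      Finset.disjoint_union_right.2 ⟨hPN, ?_⟩, Finset.subset_union_left⟩
    exact (Finset.disjoint_of_subset_right hR Finset.disjoint_sdiff).mono_left
      Finset.subset_union_left
  · intro R hR
    simp only [Finset.mem_filter, Finset.mem_powerset] at hR ⊢
    exact Finset.union_sdiff_of_subset hR.2.2
  · intro R hR
    simp only [Finset.mem_powerset] at hR ⊢
    refine Finset.union_sdiff_cancel_left ?_
    exact (Finset.disjoint_of_subset_right hR Finset.disjoint_sdiff).mono_left
      Finset.subset_union_right
  · intro R hR
    simp only [Finset.mem_filter, Finset.mem_powerset] at hR ⊢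
    rw [Finset.union_sdiff_of_subset hR.2.2]

theorem card_free (hPN : Disjoint P N) (hP : P ⊆ Finset.range n) (hN : N ⊆ Finset.range n) :
    (Finset.range n \ (P ∪ N)).card + (P.card + N.card) = n := by
  rw [← Finset.card_union_of_disjoint hPN, Finset.card_sdiff_add_card_eq_card
    (Finset.union_subset hP hN), Finset.card_range]

theorem union_free (hPN : Disjoint P N) (hN : N ⊆ Finset.range n) :
    N ∪ (Finset.range n \ (P ∪ N)) = Finset.range n \ P := by
  ext i
  have h1 := @hN i
  have h2 : i ∈ N → i ∉ P := fun h => Finset.disjoint_right.1 hPN h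
  simp only [Finset.mem_union, Finset.mem_sdiff]
  tauto

/-- Some sample has at least half of the maximal value. -/
theorem exists_sample_le (hf : IsSetCoverage f) (hm : 0 < m) (hP : P ⊆ Finset.range n)
    (hQ : 2 * 2 ^ P.card < Q) (h : Accurate n m Q Rs (highTest f n P)) :
    ∃ j < m, Box P ∅ (Rs j) ∧ f (Finset.range n \ P) ≤ 2 * f (Rs j) := by
  by_contra! hc
  have hm' : (0 : ℝ) < m := Nat.cast_pos.2 hm
  have hQ0 : 0 < Q := (by positivity : (0 : ℝ) < 2 * 2 ^ P.card).trans hQ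
  classical
  have h1 : ∑ j ∈ Finset.range m, highTest f n P (Rs j) = 0 :=
    Finset.sum_eq_zero fun j hj => by
      rw [highTest, if_neg]
      rintro ⟨hb, hl⟩
      exact absurd hl (not_le.2 (hc j (Finset.mem_range.1 hj) hb))
  -- At least half of the subcube has large values, a fraction of the cube greater than `1 / Q`;
  -- accurate samples cannot miss it altogether.
  have h2 : (2 : ℝ) ^ (Finset.range n \ P).card ≤
      2 * ∑ R ∈ (Finset.range n).powerset, highTest f n P R := by
    simp only [highTest, ite_and]
    rw [sum_box (Finset.disjoint_empty_right P) (Finset.empty_subset _), Finset.union_empty,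
      ← Finset.sum_filter]
    simp only [Finset.empty_union]
    rw [Finset.sum_const, nsmul_one]
    exact_mod_cast hf.le_two_mul_card_le (Finset.range n \ P)
  have h3 : (2 : ℝ) ^ n = 2 ^ (Finset.range n \ P).card * 2 ^ P.card := by
    rw [← pow_add, Finset.card_sdiff_add_card_eq_card hP, Finset.card_range]
  rw [Accurate, h1, zero_sub, abs_neg, abs_of_nonneg, le_div_iff₀ hQ0, mul_assoc] at h
  · have h4 := le_of_mul_le_mul_left (h.trans_eq (mul_one _).symm) hm'
    rw [div_mul_eq_mul_div, div_le_one (by positivity), h3] at h4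
    have h5 : (0 : ℝ) < 2 ^ (Finset.range n \ P).card := by positivity
    nlinarith [mul_lt_mul_of_pos_left hQ h5]
  · refine mul_nonneg hm'.le (div_nonneg (Finset.sum_nonneg fun R _ => ?_) (by positivity))
    rw [highTest]
    split_ifs <;> simp

/-- If no sample is small then small values are rare. -/
theorem card_low_le (hm : 0 < m) (h : Accurate n m Q Rs (lowTest f n α P N))
    (hs : ∀ j < m, Box P N (Rs j) → f (Finset.range n \ P) ≤ 2 * α * f (Rs j)) :
    (((Finset.range n).powerset.filter fun R =>
      Box P N R ∧ 2 * α * f R < f (Finset.range n \ P)).card : ℝ) ≤ 2 ^ n * (1 / Q) := by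
  have hm' : (0 : ℝ) < m := Nat.cast_pos.2 hm
  classical
  have h1 : ∑ j ∈ Finset.range m, lowTest f n α P N (Rs j) = 0 :=
    Finset.sum_eq_zero fun j hj => by
      rw [lowTest, if_neg]
      rintro ⟨hb, hl⟩
      exact absurd hl (not_lt.2 (hs j (Finset.mem_range.1 hj) hb))
  rw [Accurate, h1, zero_sub, abs_neg, abs_of_nonneg, div_eq_mul_one_div (m : ℝ)] at h
  · have h4 := le_of_mul_le_mul_left h hm'
    rw [div_le_iff₀ (by positivity), mul_comm] at h4
    refine le_trans (le_of_eq ?_) h4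
    simp [lowTest, ← Finset.sum_filter]
  · refine mul_nonneg hm'.le (div_nonneg (Finset.sum_nonneg fun R _ => ?_) (by positivity))
    rw [lowTest]
    split_ifs <;> simp

/-- If the values at singletons are small then small values are rare. -/
theorem card_low_le_exp (hf : IsSetCoverage f) (hα : 0 < α)
    (hs : ∀ i ∈ Finset.range n \ P, α * f {i} ≤ f (Finset.range n \ P)) :
    (((Finset.range n).powerset.filter fun R =>
      Box P ∅ R ∧ 2 * α * f R < f (Finset.range n \ P)).card : ℝ) ≤
        2 ^ n * Real.exp (1 / 2 - 3 / 8 * α) := by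
  have h1 : ((Finset.range n).powerset.filter fun R =>
      Box P ∅ R ∧ 2 * α * f R < f (Finset.range n \ P)) ⊆
      (Finset.range n \ P).powerset.filter fun R => 2 * α * f R < f (Finset.range n \ P) := by
    intro R hR
    simp only [Finset.mem_filter, Finset.mem_powerset] at hR ⊢
    exact ⟨Finset.subset_sdiff.2 ⟨hR.1, hR.2.1.1.symm⟩, hR.2.2⟩
  refine (Nat.cast_le.2 (Finset.card_le_card h1)).trans ((hf.card_lt_le hα hs).trans ?_)
  gcongr
  · exact one_le_two
  · exact (Finset.card_le_card Finset.sdiff_subset).trans_eq (Finset.card_range n)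

/-- The sum of the labels times the character of `T` over the samples in a subcube. -/
def boxCorr (f : Finset ℕ → ℝ) (m : ℕ) (Rs : ℕ → Finset ℕ) (P N T : Finset ℕ) : ℝ :=
  ∑ j ∈ Finset.range m, if Box P N (Rs j) then f (Rs j) * chi T (Rs j) else 0

/-- The test was normalized by the maximum on the subcube to be bounded by 1. Multiplying back by
the maximum, and by the inverse measure `2 ^ (P.card + N.card)` of the subcube, gives the error for
the Fourier coefficients on the subcube. -/
theorem abs_boxCorr_sub_le (hf : IsSetCoverage f) (hRs : ∀ j, Rs j ⊆ Finset.range n)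
    (hm : 0 < m) (hPN : Disjoint P N) (hP : P ⊆ Finset.range n) (hN : N ⊆ Finset.range n)
    (hT : T ⊆ Finset.range n \ (P ∪ N)) (h : Accurate n m Q Rs (corrTest f n P N T)) :
    |2 ^ (Finset.range n \ (P ∪ N)).card * (2 ^ (P.card + N.card) / m * boxCorr f m Rs P N T) -
      ∑ R ∈ (Finset.range n \ (P ∪ N)).powerset, f (N ∪ R) * chi T R| ≤
    2 ^ (Finset.range n \ (P ∪ N)).card * (2 ^ (P.card + N.card) / Q * f (Finset.range n \ P)) := by
  have hm' : (0 : ℝ) < m := Nat.cast_pos.2 hm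
  have hM := hf.nonneg (Finset.range n \ P)
  have key : ∀ R ⊆ Finset.range n, corrTest f n P N T R * f (Finset.range n \ P) =
      if Box P N R then f R * chi T R else 0 := by
    intro R hR
    rw [corrTest]
    split_ifs with hb
    · rw [mul_right_comm, hf.div_mul_self_of_box hR hb]
    · rw [zero_mul]
  have h1 : (∑ R ∈ (Finset.range n).powerset, corrTest f n P N T R) * f (Finset.range n \ P) =
      ∑ R ∈ (Finset.range n \ (P ∪ N)).powerset, f (N ∪ R) * chi T R := by
    rw [Finset.sum_mul, Finset.sum_congr rfl fun R hR => key R (Finset.mem_powerset.1 hR),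
      sum_box hPN hN]
    refine Finset.sum_congr rfl fun R _ => ?_
    congr 1
    refine chi_congr fun i hi => ?_
    have h2 := (Finset.mem_sdiff.1 (hT hi)).2
    simp only [Finset.mem_union, not_or] at h2 ⊢
    tauto
  have h2 : (∑ j ∈ Finset.range m, corrTest f n P N T (Rs j)) * f (Finset.range n \ P) =
      boxCorr f m Rs P N T := by
    rw [Finset.sum_mul, boxCorr]
    exact Finset.sum_congr rfl fun j _ => key _ (hRs j)
  have h3 := mul_le_mul_of_nonneg_right h hM
  rw [← abs_of_nonneg hM, ← abs_mul, abs_of_nonneg hM, sub_mul, h2, mul_assoc,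
    div_mul_eq_mul_div, h1] at h3
  have h4 : (2 : ℝ) ^ n = 2 ^ (Finset.range n \ (P ∪ N)).card * 2 ^ (P.card + N.card) := by
    rw [← pow_add, card_free hPN hP hN]
  have h5 := mul_le_mul_of_nonneg_left h3 (show (0 : ℝ) ≤ 2 ^ n / m by positivity)
  rw [← abs_of_nonneg (show (0 : ℝ) ≤ 2 ^ n / m by positivity), ← abs_mul,
    abs_of_nonneg (show (0 : ℝ) ≤ 2 ^ n / m by positivity)] at h5
  have h6 : (m : ℝ) ≠ 0 := hm'.ne'
  refine le_of_eq_of_le (congrArg abs ?_) (h5.trans_eq ?_)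
  · rw [mul_sub, h4]
    congr 1 <;> field_simp
  · have h7 : (2 : ℝ) ^ n / m * (m / Q * f (Finset.range n \ P)) =
        2 ^ n / Q * f (Finset.range n \ P) := by
      field_simp
    rw [h7, h4]
    ring

end IsSetCoverage

namespace IsSetCoverage

open Learner

variable {f : Finset ℕ → ℝ} {P N : Finset ℕ} {n m k Q : ℕ} {α g κ Mh : ℝ}
  {Rs : ℕ → Finset ℕ} {marked : ℕ → Prop} {ok : Finset ℕ → Prop}

/-- The approximation found by the search has the required accuracy on most of a subcube. -/
theorem card_leaf_not_le (hf : IsSetCoverage f) (hRs : ∀ j, Rs j ⊆ Finset.range n) (hm : 0 < m)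
    (hPN : Disjoint P N) (hP : P ⊆ Finset.range n) (hN : N ⊆ Finset.range n)
    (hW : ∀ i, i ∈ Finset.range n \ (P ∪ N) ↔ i < n ∧ ¬ marked i)
    (hQ : 2 ^ (P.card + N.card) ≤ Q) (hQk : Q < 2 ^ (k + 1)) (hM : f (Finset.range n \ P) ≤ 2 * Mh)
    (hM' : Mh ≤ f (Finset.range n \ P)) (hα : 0 < α) (hg : 0 < g) (hg1 : g ≤ 1)
    (hcorr : ∀ T ⊆ Finset.range n \ (P ∪ N), T.card ≤ k + 1 →
      Accurate n m Q Rs (corrTest f n P N T))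
    (hlow : (((Finset.range n).powerset.filter fun R =>
      Box P N R ∧ 2 * α * f R < f (Finset.range n \ P)).card : ℝ) ≤ 2 ^ n * κ)
    (hκ : 448 * α ^ 2 ≤ κ * (Q * g ^ 2))
    (hok : ∀ T ⊆ Finset.range n \ (P ∪ N), ok T ↔ boxCorr f m Rs P N T + 4 * Mh * m / Q < 0)
    {h : Finset ℕ → ℝ} (hh : ∀ R, h R = ∑ T ∈ (search (Q + 2) ok marked n).toFinset,
      boxCorr f m Rs P N T * (2 ^ (P.card + N.card) / (m * (1 + g / 4))) * chi T R) :
    (((Finset.range n).powerset.filter fun R =>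
      Box P N R ∧ ¬(h R ≤ f R ∧ f R ≤ (1 + g) * h R)).card : ℝ) ≤ 2 ^ n * (2 * κ) := by
  set e := P.card + N.card with he
  set W := Finset.range n \ (P ∪ N) with hWdef
  set M := f (Finset.range n \ P) with hMdef
  have hm' : (0 : ℝ) < m := Nat.cast_pos.2 hm
  have hQ0' : 0 < Q := (by positivity : 0 < 2 ^ e).trans_le hQ
  have hQ0 : (0 : ℝ) < Q := Nat.cast_pos.2 hQ0'
  have hQ' : (2 : ℝ) ^ e ≤ Q := by exact_mod_cast hQ
  have hQk' : (Q : ℝ) < 2 ^ (k + 1) := by exact_mod_cast hQk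
  have hM0 : 0 ≤ M := hf.nonneg _
  have hWM : f (N ∪ W) = M := by rw [hWdef, union_free hPN hN]
  have hcard : (2 : ℝ) ^ W.card * 2 ^ e = 2 ^ n := by rw [← pow_add, card_free hPN hP hN]
  set b : Finset ℕ → ℝ := fun T => 2 ^ e / m * boxCorr f m Rs P N T with hb
  set h0 : Finset ℕ → ℝ := fun R => ∑ T ∈ (search (Q + 2) ok marked n).toFinset, b T * chi T R
    with hh0
  have h01 : ∀ R, h0 R = (1 + g / 4) * h R := by
    intro R
    rw [hh, hh0, Finset.mul_sum]
    refine Finset.sum_congr rfl fun T _ => ?_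
    have : 1 + g / 4 ≠ 0 := by positivity
    simp only [hb]
    field_simp
  have hsq : ∑ R ∈ W.powerset, (h0 R - f (N ∪ R)) ^ 2 ≤
      2 ^ W.card * (7 * (2 ^ e / Q) * M ^ 2) := by
    rw [← hWM]
    -- Here θ is `2 ^ e / Q`, so `1 / θ + 1 ≤ Q + 1` is below the capacity `Q + 2`.
    refine hf.sum_sq_search_sub_le (k := k) (by positivity) ((div_le_one hQ0).2 hQ') ?_ ?_ hW
      (hWM ▸ hM) (hWM ▸ hM') ?_ ?_
    · have h1 : (1 : ℝ) ≤ 2 ^ e := one_le_pow₀ one_le_two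
      rw [mul_div_assoc', lt_div_iff₀ hQ0]
      nlinarith
    · have h1 : (1 : ℝ) ≤ 2 ^ e := one_le_pow₀ one_le_two
      rw [one_div_div]
      have := div_le_self hQ0.le h1
      push_cast
      linarith
    · intro T hT hc
      rw [hWM]
      exact hf.abs_boxCorr_sub_le hRs hm hPN hP hN hT (hcorr T hT hc)
    · intro T hT
      have h1 : b T = 2 ^ e / m * boxCorr f m Rs P N T := rfl
      have h2 : -(4 * (2 ^ e / Q) * Mh) = 2 ^ e / m * -(4 * Mh * m / Q) := by
        field_simp
      rw [hok T hT, h1, h2, mul_lt_mul_iff_of_pos_left (by positivity), lt_neg_iff_add_neg]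
  have hchi : ∀ R, R ⊆ W → h0 (N ∪ R) = h0 R := by
    intro R _
    refine Finset.sum_congr rfl fun T hT => ?_
    rw [chi_congr fun i hi => ?_]
    have h2 := (Finset.mem_sdiff.1 ((hW i).2 ((mem_search (List.mem_toFinset.1 hT)).1 i hi))).2
    simp only [Finset.mem_union, not_or] at h2 ⊢
    tauto
  have hsq' : ∑ R ∈ (Finset.range n).powerset, (if Box P N R then (h0 R - f R) ^ 2 else 0) ≤
      2 ^ W.card * (7 * (2 ^ e / Q) * M ^ 2) := by
    rw [sum_box hPN hN]
    refine le_of_eq_of_le (Finset.sum_congr rfl fun R hR => ?_) hsq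
    rw [hchi R (Finset.mem_powerset.1 hR)]
  rw [← Finset.sum_filter] at hsq'
  -- Chebyshev's inequality for an error above `g / 4` times the lower bound `M / (2 * α)`. The
  -- constant 448 is `8 ^ 2 * 7`.
  have hcheb : (((Finset.range n).powerset.filter fun R =>
      Box P N R ∧ g * M < 8 * α * |h0 R - f R|).card : ℝ) ≤ 2 ^ n * κ := by
    have hsub : ((Finset.range n).powerset.filter fun R =>
        Box P N R ∧ g * M < 8 * α * |h0 R - f R|) ⊆
        (Finset.range n).powerset.filter fun R => Box P N R := fun R hR => by
      simp only [Finset.mem_filter] at hR ⊢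
      exact ⟨hR.1, hR.2.1⟩
    rcases hM0.eq_or_lt with hz | hpos
    -- If the maximum is zero then so is the mean square error, and there is no bad point.
    · rw [Finset.filter_false_of_mem, Finset.card_empty, Nat.cast_zero]
      · have : 0 ≤ κ * (Q * g ^ 2) := le_trans (by positivity) hκ
        have := nonneg_of_mul_nonneg_left this (by positivity)
        positivity
      · rintro R hR ⟨hb, hlt⟩
        have h1 := (Finset.single_le_sum (f := fun R => (h0 R - f R) ^ 2)
          (fun _ _ => sq_nonneg _) (Finset.mem_filter.2 ⟨hR, hb⟩)).trans hsq'
        rw [← hz] at h1 hlt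
        have h2 : (h0 R - f R) ^ 2 ≤ 0 := by simpa using h1
        have h3 : h0 R - f R = 0 := pow_eq_zero_iff two_ne_zero |>.1 (le_antisymm h2 (sq_nonneg _))
        simp [h3] at hlt
    · have h1 : (((Finset.range n).powerset.filter fun R =>
          Box P N R ∧ g * M < 8 * α * |h0 R - f R|).card : ℝ) * (g * M) ^ 2 ≤
          64 * α ^ 2 * (2 ^ W.card * (7 * (2 ^ e / Q) * M ^ 2)) := by
        refine le_trans ?_ (mul_le_mul_of_nonneg_left hsq' (by positivity))
        rw [← nsmul_eq_mul, ← Finset.sum_const, Finset.mul_sum]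
        refine (Finset.sum_le_sum fun R hR => ?_).trans
          (Finset.sum_le_sum_of_subset_of_nonneg hsub fun _ _ _ => by positivity)
        have h2 := (Finset.mem_filter.1 hR).2.2.le
        calc (g * M) ^ 2 ≤ (8 * α * |h0 R - f R|) ^ 2 := pow_le_pow_left₀ (by positivity) h2 2
          _ = 64 * α ^ 2 * (h0 R - f R) ^ 2 := by rw [mul_pow, sq_abs]; ring
      have h2 : 64 * α ^ 2 * (2 ^ W.card * (7 * (2 ^ e / Q) * M ^ 2)) =
          2 ^ n * (448 * α ^ 2 / Q) * M ^ 2 := by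
        rw [← hcard]
        ring
      have h3 : 448 * α ^ 2 / Q ≤ κ * g ^ 2 := by
        rw [div_le_iff₀ hQ0]
        linarith
      have h4 : 2 ^ n * (448 * α ^ 2 / Q) * M ^ 2 ≤ 2 ^ n * (κ * g ^ 2) * M ^ 2 := by gcongr
      have h5 : (0 : ℝ) < (g * M) ^ 2 := by positivity
      refine le_of_mul_le_mul_right ((h1.trans_eq h2).trans (h4.trans_eq ?_)) h5
      ring
  have hsub : ((Finset.range n).powerset.filter fun R =>
      Box P N R ∧ ¬(h R ≤ f R ∧ f R ≤ (1 + g) * h R)) ⊆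
      ((Finset.range n).powerset.filter fun R => Box P N R ∧ 2 * α * f R < M) ∪
      ((Finset.range n).powerset.filter fun R =>
        Box P N R ∧ g * M < 8 * α * |h0 R - f R|) := by
    intro R hR
    simp only [Finset.mem_filter, Finset.mem_union] at hR ⊢
    obtain ⟨hR, hb, hbad⟩ := hR
    by_contra hc
    simp only [hR, hb, true_and, not_or, not_lt] at hc
    refine hbad ?_
    -- Off both exceptional sets the additive error is relative: `M ≤ 2 * α * f R`.
    have h1 : |h0 R - f R| ≤ g / 4 * f R := by
      have := mul_le_mul_of_nonneg_left hc.1 hg.le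
      refine le_of_mul_le_mul_left (hc.2.trans (this.trans_eq ?_))
        (show 0 < 8 * α by positivity)
      ring
    have h2 := abs_le.1 h1
    rw [h01] at h2
    have hfR := hf.nonneg R
    constructor
    · refine le_of_mul_le_mul_left ?_ (show 0 < 1 + g / 4 by positivity)
      linarith [h2.2]
    · refine le_of_mul_le_mul_left ?_ (show 0 < 1 + g / 4 by positivity)
      have h3 := mul_le_mul_of_nonneg_left h2.1 (show 0 ≤ 1 + g by positivity)
      -- This is `(1 + g) * (1 - g / 4) ≥ 1 + g / 4`, the price of making the error one-sided; it
      -- uses `g ≤ 1`.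
      have h4 : 0 ≤ (g / 2 - g ^ 2 / 4) * f R := mul_nonneg (by nlinarith) hfR
      linarith
  have hfin := (Finset.card_le_card hsub).trans (Finset.card_union_le _ _)
  have hfin' : (((Finset.range n).powerset.filter fun R =>
      Box P N R ∧ ¬(h R ≤ f R ∧ f R ≤ (1 + g) * h R)).card : ℝ) ≤ _ := Nat.cast_le.2 hfin
  rw [Nat.cast_add] at hfin'
  linarith

end IsSetCoverage

/-! ### From points of the cube to sets, and the leaves of the decision list. -/

namespace Learner

open IsSetCoverage

variable {n : ℕ}

/-- The set of the coordinates `-1` of a point. -/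
def negSet (x : Cube n) : Finset ℕ := (Finset.range n).filter fun i => ext x i = -1

theorem negSet_subset (x : Cube n) : negSet x ⊆ Finset.range n := Finset.filter_subset _ _

theorem ext_eq_ite (x : Cube n) {i : ℕ} (hi : i < n) :
    ext x i = if i ∈ negSet x then -1 else 1 := by
  have : ext x i = 1 ∨ ext x i = -1 := by
    rcases Int.units_eq_one_or (x ⟨i, hi⟩) with h | h <;> simp [ext, hi, h]
  rcases this with h | h <;> simp [negSet, hi, h]

theorem ext_of_le (x : Cube n) {i : ℕ} (hi : n ≤ i) : ext x i = -1 := by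
  simp [ext, hi.not_gt]

theorem prod_ext (x : Cube n) {T : Finset ℕ} (hT : T ⊆ Finset.range n) :
    ∏ i ∈ T, ext x i = chi T (negSet x) :=
  Finset.prod_congr rfl fun _ hi => ext_eq_ite x (Finset.mem_range.1 (hT hi))

theorem mem_negSet (x : Cube n) (i : Fin n) : (i : ℕ) ∈ negSet x ↔ x i = -1 := by
  rcases Int.units_eq_one_or (x i) with h | h
  · simp [negSet, ext, h]
    norm_num
  · simp [negSet, ext, h]

theorem sum_negSet (φ : Finset ℕ → ℝ) :
    ∑ x : Cube n, φ (negSet x) = ∑ R ∈ (Finset.range n).powerset, φ R := by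
  refine Finset.sum_bij' (fun x _ => negSet x) (fun R _ i => if (i : ℕ) ∈ R then -1 else 1)
    ?_ ?_ ?_ ?_ ?_
  · intro x _
    exact Finset.mem_powerset.2 (negSet_subset x)
  · simp
  · intro x _
    funext i
    rcases Int.units_eq_one_or (x i) with h | h <;> simp [mem_negSet, h]
  · intro R hR
    ext i
    by_cases hi : i < n
    · have := mem_negSet (fun i : Fin n => if (i : ℕ) ∈ R then (-1 : ℤˣ) else 1) ⟨i, hi⟩
      rw [this]
      by_cases h : i ∈ R <;> simp [h]
    · exact iff_of_false (fun h => hi (Finset.mem_range.1 (negSet_subset _ h)))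
        fun h => hi (Finset.mem_range.1 (Finset.mem_powerset.1 hR h))
  · simp

theorem card_filter_negSet (p : Finset ℕ → Prop) [DecidablePred p] :
    ((Finset.univ.filter fun x : Cube n => p (negSet x)).card : ℝ) =
      ((Finset.range n).powerset.filter p).card := by
  have := sum_negSet (n := n) fun R => if p R then 1 else 0
  simpa using this

theorem exists_isSetCoverage {c : Cube n → ℝ} (hc : IsCoverage c) :
    ∃ f, IsSetCoverage f ∧ ∀ x, c x = f (negSet x) := by
  obtain ⟨N, w, A, a, hw, ha, h⟩ := hc
  let S : Fin N → Finset ℕ := fun u => (Finset.univ.filter fun i => u ∈ A i).map Fin.valEmbedding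
  refine ⟨fun R => a + ∑ u, if Disjoint (S u) R then 0 else w u,
    ⟨N, w, S, a, hw, ha, fun _ => rfl⟩, fun x => ?_⟩
  rw [h]
  congr 1
  simp only [← ite_not (p := Disjoint _ _), ← Finset.sum_filter]
  refine Finset.sum_congr ?_ fun _ _ => rfl
  ext u
  simp only [Finset.mem_biUnion, Finset.mem_filter, Finset.mem_univ, true_and,
    Finset.not_disjoint_iff, S, Finset.mem_map, Fin.valEmbedding_apply]
  constructor
  · rintro ⟨i, hi, hu⟩
    exact ⟨i, ⟨i, hu, rfl⟩, (mem_negSet x i).2 hi⟩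
  · rintro ⟨_, ⟨i, hu, rfl⟩, hi⟩
    exact ⟨i, (mem_negSet x i).1 hi, hu⟩

variable {ℓ : ℕ → ℕ} {d : ℕ}

theorem active_ext (x : Cube n) (h : ∀ e < d, ℓ e < n) :
    active ℓ d (ext x) = if Disjoint ((Finset.range d).image ℓ) (negSet x) then 1 else 0 := by
  rw [active]
  split_ifs with hd
  · refine Finset.prod_eq_one fun e he => ?_
    rw [ext_eq_ite x (h e (Finset.mem_range.1 he)),
      if_neg (Finset.disjoint_left.1 hd (Finset.mem_image_of_mem _ he))]
    norm_num
  · obtain ⟨i, hi, hx⟩ := Finset.not_disjoint_iff.1 hd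
    obtain ⟨e, he, rfl⟩ := Finset.mem_image.1 hi
    refine Finset.prod_eq_zero he ?_
    rw [ext_eq_ite x (h e (Finset.mem_range.1 he)), if_pos hx]
    norm_num

theorem active_eq_zero (x : Cube n) {e : ℕ} (he : e < d) (h : n ≤ ℓ e) :
    active ℓ d (ext x) = 0 :=
  Finset.prod_eq_zero (Finset.mem_range.2 he) (by rw [ext_of_le x h]; norm_num)

/-- The dummy coordinate is filtered out of the set of fixed `-1`s: it is `-1` at every point and
imposes no condition. -/
theorem leafInd_ext (x : Cube n) (h : ∀ e < d, ℓ e < n) :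
    leafInd ℓ d (ext x) = if Box ((Finset.range d).image ℓ) (({ℓ d} : Finset ℕ).filter (· < n))
      (negSet x) then 1 else 0 := by
  rw [leafInd, active_ext x h]
  by_cases h1 : Disjoint ((Finset.range d).image ℓ) (negSet x)
  · by_cases h2 : ℓ d < n
    · rw [ext_eq_ite x h2]
      by_cases h3 : ℓ d ∈ negSet x <;>
        simp [Box, h1, h2, h3, Finset.filter_singleton]
    · rw [ext_of_le x (not_lt.1 h2)]
      simp [Box, h1, h2, Finset.filter_singleton]
  · simp [Box, h1]

/-- A telescoping sum: a leaf is the difference of consecutive active sets. -/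
theorem active_add_sum_leafInd (ℓ : ℕ → ℕ) (D : ℕ) (x : ℕ → ℝ) :
    active ℓ D x + ∑ d ∈ Finset.range D, leafInd ℓ d x = 1 := by
  induction D with
  | zero => simp [active]
  | succ D ih =>
    rw [Finset.sum_range_succ, ← ih, leafInd]
    have : active ℓ (D + 1) x = active ℓ D x * ((1 + x (ℓ D)) / 2) := Finset.prod_range_succ _ _
    rw [this]
    ring

open IsSetCoverage

variable {n m D k Q : ℕ} {f : Finset ℕ → ℝ} {α g κ M : ℝ} {c : Cube n → ℝ} {ω : ℕ → Cube n}
  {ℓ : ℕ → ℕ} {d : ℕ}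

/-- The samples estimate the expectations of all test functions on subcubes accurately. -/
structure Good (f : Finset ℕ → ℝ) (n m D k Q : ℕ) (α : ℝ) (Rs : ℕ → Finset ℕ) : Prop where
  corr : ∀ P N T, P ⊆ Finset.range n → N ⊆ Finset.range n → T ⊆ Finset.range n → P.card ≤ D →
    N.card ≤ 1 → T.card ≤ k → Accurate n m Q Rs (corrTest f n P N T)
  low : ∀ P N, P ⊆ Finset.range n → N ⊆ Finset.range n → P.card ≤ D → N.card ≤ 1 →
    Accurate n m Q Rs (lowTest f n α P N)
  high : ∀ P, P ⊆ Finset.range n → P.card ≤ D → Accurate n m Q Rs (highTest f n P)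

theorem corr_leafInd (hc : ∀ x, c x = f (negSet x)) (h : ∀ e < d, ℓ e < n) {T : Finset ℕ}
    (hT : T ⊆ Finset.range n) :
    corr m (fun j => ext (ω j)) (fun j => c (ω j)) (leafInd ℓ d) T =
      boxCorr f m (fun j => negSet (ω j)) ((Finset.range d).image ℓ)
        (({ℓ d} : Finset ℕ).filter (· < n)) T := by
  refine Finset.sum_congr rfl fun j _ => ?_
  rw [leafInd_ext _ h, prod_ext _ hT]
  simp only [hc]
  split_ifs <;> simp

/-- Translates the specification of a round into the hypotheses of `card_leaf_not_le`. The two kinds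
of leaf differ only in why small values are rare on them. -/
theorem card_leaf_bad_le (hf : IsSetCoverage f) (hc : ∀ x, c x = f (negSet x)) (hm : 0 < m)
    (hG : Good f n m D (k + 1) Q α fun j => negSet (ω j)) (hd : d < D) (hlt : ∀ e < d, ℓ e < n)
    (hnew : ∀ e < d, ∀ e' < e, ℓ e' ≠ ℓ e)
    (hr : Round n m (fun j => ext (ω j)) (fun j => c (ω j)) (2 * α) ℓ d M)
    (hQ : 2 ^ D < Q) (hQk : Q < 2 ^ (k + 1)) (hα : 0 < α) (hg : 0 < g) (hg1 : g ≤ 1)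
    (hκ1 : 1 / (Q : ℝ) ≤ κ) (hκ2 : Real.exp (1 / 2 - 3 / 8 * α) ≤ κ)
    (hκ3 : 448 * α ^ 2 ≤ κ * (Q * g ^ 2)) :
    ((Finset.univ.filter fun x : Cube n => leafInd ℓ d (ext x) = 1 ∧
      ¬(leafHyp n m Q (fun j => ext (ω j)) (fun j => c (ω j)) g ℓ d M (ext x) ≤ c x ∧
        c x ≤ (1 + g) * leafHyp n m Q (fun j => ext (ω j)) (fun j => c (ω j)) g ℓ d M
          (ext x))).card : ℝ) ≤ 2 ^ n * (2 * κ) := by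
  classical
  set P := (Finset.range d).image ℓ with hPdef
  set N := ({ℓ d} : Finset ℕ).filter (· < n) with hNdef
  set Rs : ℕ → Finset ℕ := fun j => negSet (ω j) with hRsdef
  have hRs : ∀ j, Rs j ⊆ Finset.range n := fun j => negSet_subset _
  have hP : P ⊆ Finset.range n := fun i hi => by
    obtain ⟨e, he, rfl⟩ := Finset.mem_image.1 hi
    exact Finset.mem_range.2 (hlt e (Finset.mem_range.1 he))
  have hN : N ⊆ Finset.range n := fun i hi => Finset.mem_range.2 (Finset.mem_filter.1 hi).2
  have hPc : P.card = d := by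
    rw [hPdef, Finset.card_image_of_injOn, Finset.card_range]
    intro e he e' he' h
    have he := Finset.mem_range.1 (Finset.mem_coe.1 he)
    have he' := Finset.mem_range.1 (Finset.mem_coe.1 he')
    rcases lt_trichotomy e e' with hl | hl | hl
    · exact absurd h (hnew e' he' e hl)
    · exact hl
    · exact absurd h.symm (hnew e he e' hl)
  have hNc : N.card = if ℓ d < n then 1 else 0 := by
    rw [hNdef, Finset.filter_singleton]
    split_ifs <;> simp
  have hPN : Disjoint P N := by
    rw [Finset.disjoint_left]
    intro i hi hi'
    obtain ⟨e, he, rfl⟩ := Finset.mem_image.1 hi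
    obtain ⟨h1, h2⟩ := Finset.mem_filter.1 hi'
    rw [Finset.mem_singleton] at h1
    exact hr.new (h1 ▸ h2) e (Finset.mem_range.1 he) h1
  have hNc1 : N.card ≤ 1 := by rw [hNc]; split_ifs <;> simp
  have hact : ∀ j, active ℓ d (ext (ω j)) = if Disjoint P (Rs j) then 1 else 0 :=
    fun j => active_ext (ω j) hlt
  set MP := f (Finset.range n \ P) with hMP
  have hMP0 : 0 ≤ MP := hf.nonneg _
  -- Active labels are bounded by the value of the largest set in the active subcube, by
  -- monotonicity.
  have hM' : M ≤ MP := by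
    rcases hr.max_eq with h | ⟨j, _, h⟩
    · rwa [h]
    · rw [h, hact]
      split_ifs with hd
      · rw [one_mul, hc]
        exact hf.le_of_box (N := ∅) (hRs j) ⟨hd, Finset.empty_subset _⟩
      · rwa [zero_mul]
  have hM : MP ≤ 2 * M := by
    obtain ⟨j, hj, hb, hl⟩ := hf.exists_sample_le (Q := Q) hm hP (by
      rw [hPc]
      exact_mod_cast lt_of_le_of_lt (by
        rw [← pow_succ']
        exact Nat.pow_le_pow_right two_pos hd) hQ) (hG.high P hP (by omega))
    have h1 := hr.le_max j hj
    rw [hact, if_pos hb.1, one_mul, hc] at h1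
    linarith
  have hlow : (((Finset.range n).powerset.filter fun R =>
      Box P N R ∧ 2 * α * f R < MP).card : ℝ) ≤ 2 ^ n * κ := by
    -- A split leaf: no sample in it has a small label, so accuracy of the test for small values
    -- suffices. On the last leaf the Chernoff bound is used instead.
    by_cases hl : ℓ d < n
    · refine (card_low_le (Q := Q) hm (hG.low P N hP hN (by omega) hNc1) ?_).trans (by gcongr)
      intro j hj hb
      have h1 := hr.large hl j hj
      have h2 : ℓ d ∈ Rs j := hb.2 (Finset.mem_filter.2 ⟨Finset.mem_singleton_self _, hl⟩)
      rw [hact, if_pos hb.1, ext_eq_ite _ hl, if_pos h2, hc] at h1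
      change 1 * (1 - -1) * M ≤ 2 * α * f (Rs j) at h1
      linarith
    · have hNe : N = ∅ := Finset.card_eq_zero.1 (by rw [hNc, if_neg hl])
      have hle : ℓ d = n := le_antisymm hr.le (not_lt.1 hl)
      rw [hNe]
      refine (hf.card_low_le_exp hα fun i hi => ?_).trans (by gcongr)
      obtain ⟨hi, hiP⟩ := Finset.mem_sdiff.1 hi
      have hi := Finset.mem_range.1 hi
      -- The sample that ruled out `i` is active, contains `i` and has a small label; by
      -- monotonicity this bounds the value of the singleton.
      obtain ⟨j, _, hj⟩ := hr.small i (hle ▸ hi) fun e he h =>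
        hiP (h ▸ Finset.mem_image_of_mem _ (Finset.mem_range.2 he))
      have hy := hf.nonneg (Rs j)
      rw [hact, ext_eq_ite _ hi, hc] at hj
      change 2 * α * f (Rs j) < _ at hj
      have h0 : 0 ≤ 2 * α * f (Rs j) := by positivity
      by_cases h1 : Disjoint P (Rs j) <;> by_cases h2 : i ∈ negSet (ω j) <;>
        simp only [h1, h2, if_true, if_false, zero_mul, sub_self, mul_zero] at hj
      · have h3 := hf.mono (Finset.singleton_subset_iff.2 h2)
        change f {i} ≤ f (Rs j) at h3
        nlinarith
      all_goals linarith
  set xs : ℕ → ℕ → ℝ := fun j => ext (ω j) with hxs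
  set y : ℕ → ℝ := fun j => c (ω j) with hy
  set l := leafSets n m Q xs y ℓ d M with hl
  set h : Finset ℕ → ℝ := fun R => ∑ T ∈ l.toFinset,
    boxCorr f m Rs P N T * (2 ^ (P.card + N.card) / (m * (1 + g / 4))) * chi T R with hh
  have hhyp : ∀ x : Cube n, leafInd ℓ d (ext x) = 1 →
      leafHyp n m Q xs y g ℓ d M (ext x) = h (negSet x) := by
    intro x hx
    have hnd : (leafSets n m Q xs y ℓ d M).Nodup := nodup_search
    rw [leafHyp, leafSum, ← List.sum_toFinset _ hnd]
    refine Finset.sum_congr rfl fun T hT => ?_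
    have hTn : T ⊆ Finset.range n := fun i hi =>
      Finset.mem_range.2 ((mem_search (List.mem_toFinset.1 hT)).1 i hi).1
    rw [corr_leafInd hc hlt hTn, hx, one_mul, prod_ext x hTn, hPc, hNc]
    congr 3
    split_ifs <;> simp [pow_succ, mul_comm]
  refine le_trans ?_ (hf.card_leaf_not_le (k := k) (h := h) (g := g) (α := α) hRs hm hPN hP hN
    (marked := fun i => ∃ e ≤ d, ℓ e = i) (Mh := M) (Q := Q) ?_ ?_ hQk hM hM' hα hg hg1 ?_ hlow hκ3
    (ok := fun T => corr m xs y (leafInd ℓ d) T + 4 * M * m / Q < 0) ?_ fun _ => rfl)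
  · rw [← card_filter_negSet (n := n)]
    refine Nat.cast_le.2 (Finset.card_le_card fun x hx => ?_)
    simp only [Finset.mem_filter, Finset.mem_univ, true_and] at hx ⊢
    rw [hhyp x hx.1, hc] at hx
    refine ⟨?_, hx.2⟩
    have h1 := hx.1
    rw [leafInd_ext x hlt] at h1
    by_contra hb
    rw [if_neg hb] at h1
    exact zero_ne_one h1
  · intro i
    simp only [Finset.mem_sdiff, Finset.mem_range, Finset.mem_union, not_or, hPdef, hNdef,
      Finset.mem_image, Finset.mem_filter, Finset.mem_singleton]
    refine and_congr_right fun hi => ?_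
    constructor
    · rintro ⟨h1, h2⟩ ⟨e, he, rfl⟩
      rcases he.lt_or_eq with he | rfl
      · exact h1 ⟨e, he, rfl⟩
      · exact h2 ⟨rfl, hi⟩
    · intro h1
      exact ⟨fun ⟨e, he, h⟩ => h1 ⟨e, he.le, h⟩, fun h2 => h1 ⟨d, le_rfl, h2.1.symm⟩⟩
  · refine le_trans (Nat.pow_le_pow_right two_pos ?_) hQ.le
    omega
  · intro T hT hTc
    exact hG.corr P N T hP hN (hT.trans Finset.sdiff_subset) (by omega) hNc1 hTc
  · intro T hT
    rw [corr_leafInd hc hlt (hT.trans Finset.sdiff_subset)]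

open IsSetCoverage

variable {n m D k Q : ℕ} {f : Finset ℕ → ℝ} {α g κ : ℝ} {c : Cube n → ℝ} {ω : ℕ → Cube n}
  {ℓ : ℕ → ℕ} {M : ℕ → ℝ} {d : ℕ}

theorem ext_eq_one_or (x : Cube n) (i : ℕ) : ext x i = 1 ∨ ext x i = -1 := by
  by_cases hi : i < n
  · rcases Int.units_eq_one_or (x ⟨i, hi⟩) with h | h <;> simp [ext, hi, h]
  · exact Or.inr (ext_of_le x (not_lt.1 hi))

theorem active_eq_zero_or_one (x : Cube n) (ℓ : ℕ → ℕ) (d : ℕ) :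
    active ℓ d (ext x) = 0 ∨ active ℓ d (ext x) = 1 := by
  by_cases h : ∃ e < d, ext x (ℓ e) = -1
  · obtain ⟨e, he, h⟩ := h
    exact Or.inl (Finset.prod_eq_zero (Finset.mem_range.2 he) (by rw [h]; norm_num))
  · push Not at h
    refine Or.inr (Finset.prod_eq_one fun e he => ?_)
    rw [(ext_eq_one_or x (ℓ e)).resolve_right (h e (Finset.mem_range.1 he))]
    norm_num

theorem leafInd_eq_zero_or_one (x : Cube n) (ℓ : ℕ → ℕ) (d : ℕ) :
    leafInd ℓ d (ext x) = 0 ∨ leafInd ℓ d (ext x) = 1 := by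
  rw [leafInd]
  rcases active_eq_zero_or_one x ℓ d with h | h <;> rcases ext_eq_one_or x (ℓ d) with h' | h' <;>
    rw [h, h'] <;> norm_num

/-- Real coordinates in the list are distinct, and `D` of them equal `1` on a fraction `2 ^ (-D)` of
the cube. If the dummy coordinate occurs, nothing stays active. -/
theorem card_active_le (hnew : ∀ e < D, ℓ e < n → ∀ e' < e, ℓ e' ≠ ℓ e) :
    ((Finset.univ.filter fun x : Cube n => active ℓ D (ext x) = 1).card : ℝ) ≤
      2 ^ n * (1 / 2 ^ D) := by
  by_cases h : ∀ e < D, ℓ e < n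
  · have hcard : ((Finset.range D).image ℓ).card = D := by
      rw [Finset.card_image_of_injOn, Finset.card_range]
      intro e he e' he' heq
      have he := Finset.mem_range.1 (Finset.mem_coe.1 he)
      have he' := Finset.mem_range.1 (Finset.mem_coe.1 he')
      rcases lt_trichotomy e e' with hl | hl | hl
      · exact absurd heq (hnew e' he' (h e' he') e hl)
      · exact hl
      · exact absurd heq.symm (hnew e he (h e he) e' hl)
    have hsub : (Finset.range D).image ℓ ⊆ Finset.range n := fun i hi => by
      obtain ⟨e, he, rfl⟩ := Finset.mem_image.1 hi
      exact Finset.mem_range.2 (h e (Finset.mem_range.1 he))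
    have h1 : (Finset.univ.filter fun x : Cube n => active ℓ D (ext x) = 1) =
        Finset.univ.filter fun x : Cube n => Disjoint ((Finset.range D).image ℓ) (negSet x) := by
      refine Finset.filter_congr fun x _ => ?_
      rw [active_ext x h]
      split_ifs with hd <;> simp [hd]
    rw [h1, card_filter_negSet]
    have h2 : (Finset.range n).powerset.filter (Disjoint ((Finset.range D).image ℓ)) ⊆
        (Finset.range n \ (Finset.range D).image ℓ).powerset := by
      intro R hR
      rw [Finset.mem_filter, Finset.mem_powerset] at hR
      exact Finset.mem_powerset.2 (Finset.subset_sdiff.2 ⟨hR.1, hR.2.symm⟩)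
    refine (Nat.cast_le.2 (Finset.card_le_card h2)).trans ?_
    have h3 := Finset.card_sdiff_add_card_eq_card hsub
    rw [hcard, Finset.card_range] at h3
    have h4 : (2 : ℝ) ^ n = 2 ^ (Finset.range n \ (Finset.range D).image ℓ).card * 2 ^ D := by
      rw [← pow_add, h3]
    rw [Finset.card_powerset, mul_one_div, le_div_iff₀ (by positivity), h4]
    simp
  · push Not at h
    obtain ⟨e, he, h⟩ := h
    rw [Finset.filter_false_of_mem]
    · simp only [Finset.card_empty, Nat.cast_zero]
      positivity
    · intro x _
      rw [active_eq_zero x he h]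
      exact zero_ne_one

theorem leafHyp_eq_zero {xs : ℕ → ℕ → ℝ} {y : ℕ → ℝ} {x : ℕ → ℝ} {M : ℝ}
    (h : leafInd ℓ d x = 0) : leafHyp n m Q xs y g ℓ d M x = 0 := by
  simp [leafHyp, leafSum, h]

/-- A point is still active or lies in exactly one leaf. In the latter case the hypotheses of all
other leaves vanish at it, so the errors of the leaves just add up. -/
theorem card_bad_le (hf : IsSetCoverage f) (hc : ∀ x, c x = f (negSet x)) (hm : 0 < m)
    (hG : Good f n m D (k + 1) Q α fun j => negSet (ω j))
    (hr : ∀ d < D, Round n m (fun j => ext (ω j)) (fun j => c (ω j)) (2 * α) ℓ d (M d))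
    (hQ : 2 ^ D < Q) (hQk : Q < 2 ^ (k + 1)) (hα : 0 < α) (hg : 0 < g) (hg1 : g ≤ 1)
    (hκ1 : 1 / (Q : ℝ) ≤ κ) (hκ2 : Real.exp (1 / 2 - 3 / 8 * α) ≤ κ)
    (hκ3 : 448 * α ^ 2 ≤ κ * (Q * g ^ 2)) {h : Cube n → ℝ}
    (hh : ∀ x, h x = ∑ d ∈ Finset.range D,
      leafHyp n m Q (fun j => ext (ω j)) (fun j => c (ω j)) g ℓ d (M d) (ext x)) :
    ((Finset.univ.filter fun x : Cube n => ¬(h x ≤ c x ∧ c x ≤ (1 + g) * h x)).card : ℝ) ≤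
      2 ^ n * (D * (2 * κ) + 1 / 2 ^ D) := by
  classical
  set B : ℕ → Finset (Cube n) := fun d => Finset.univ.filter fun x : Cube n =>
    leafInd ℓ d (ext x) = 1 ∧
      ¬(leafHyp n m Q (fun j => ext (ω j)) (fun j => c (ω j)) g ℓ d (M d) (ext x) ≤ c x ∧
        c x ≤ (1 + g) * leafHyp n m Q (fun j => ext (ω j)) (fun j => c (ω j)) g ℓ d (M d)
          (ext x)) with hBdef
  have hB : ∀ d ∈ Finset.range D, ((B d).card : ℝ) ≤ 2 ^ n * (2 * κ) := by
    intro d hd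
    have hd := Finset.mem_range.1 hd
    by_cases hlt : ∀ e < d, ℓ e < n
    · exact card_leaf_bad_le hf hc hm hG hd hlt
        (fun e he => (hr e (he.trans hd)).new (hlt e he)) (hr d hd) hQ hQk hα hg hg1 hκ1 hκ2 hκ3
    · push Not at hlt
      obtain ⟨e, he, h⟩ := hlt
      have : B d = ∅ := Finset.filter_false_of_mem fun x _ hx => by
        rw [leafInd, active_eq_zero x he h, zero_mul] at hx
        exact zero_ne_one hx.1
      rw [this, Finset.card_empty, Nat.cast_zero]
      have : 0 ≤ κ := (Real.exp_nonneg _).trans hκ2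
      positivity
  have hsub : (Finset.univ.filter fun x : Cube n => ¬(h x ≤ c x ∧ c x ≤ (1 + g) * h x)) ⊆
      (Finset.range D).biUnion B ∪ Finset.univ.filter fun x : Cube n =>
        active ℓ D (ext x) = 1 := by
    intro x hx
    simp only [Finset.mem_filter, Finset.mem_union, Finset.mem_univ, true_and,
      Finset.mem_biUnion] at hx ⊢
    rcases active_eq_zero_or_one x ℓ D with h0 | h1
    · refine Or.inl ?_
      have hsum := active_add_sum_leafInd ℓ D (ext x)
      rw [h0, zero_add] at hsum
      obtain ⟨d, hd, hne⟩ := Finset.exists_ne_zero_of_sum_ne_zero (hsum.trans_ne one_ne_zero)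
      have hd1 := (leafInd_eq_zero_or_one x ℓ d).resolve_left hne
      rw [← Finset.add_sum_erase _ _ hd, hd1] at hsum
      have hz := (Finset.sum_eq_zero_iff_of_nonneg fun e _ => by
        rcases leafInd_eq_zero_or_one x ℓ e with h | h <;> rw [h]
        exact zero_le_one).1 (show ∑ e ∈ (Finset.range D).erase d, leafInd ℓ e (ext x) = 0 by
          linarith)
      have hhx : h x = leafHyp n m Q (fun j => ext (ω j)) (fun j => c (ω j)) g ℓ d (M d)
          (ext x) := by
        rw [hh, ← Finset.add_sum_erase _ _ hd, Finset.sum_eq_zero, add_zero]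
        exact fun e he => leafHyp_eq_zero (hz e he)
      refine ⟨d, hd, ?_⟩
      rw [hBdef]
      simp only [Finset.mem_filter, Finset.mem_univ, true_and]
      exact ⟨hd1, by rwa [← hhx]⟩
    · exact Or.inr h1
  have h1 := (Finset.card_le_card hsub).trans ((Finset.card_union_le _ _).trans
    (Nat.add_le_add_right Finset.card_biUnion_le _))
  refine (Nat.cast_le.2 h1).trans ?_
  rw [Nat.cast_add, Nat.cast_sum, mul_add]
  refine add_le_add ((Finset.sum_le_sum hB).trans_eq ?_) (card_active_le fun e he => (hr e he).new)
  rw [Finset.sum_const, Finset.card_range, nsmul_eq_mul]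
  ring

/-! ### The probability that all tests are accurate. -/

theorem card_cube (n : ℕ) : Fintype.card (Cube n) = 2 ^ n := by
  rw [Fintype.card_fun, Fintype.card_fin, Fintype.card_units_int]

theorem uniformCube_real (p : Cube n → Prop) [DecidablePred p] :
    (uniformCube n).real {x | p x} = (Finset.univ.filter p).card / 2 ^ n := by
  have h : {x | p x} = ((Finset.univ.filter p : Finset (Cube n)) : Set (Cube n)) := by
    ext x
    simp
  rw [measureReal_def, uniformCube, uniformOn_univ, h, Measure.count_apply_finset, card_cube,
    ENNReal.toReal_div]
  simp

theorem integral_uniformCube (F : Cube n → ℝ) :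
    ∫ x, F x ∂uniformCube n = (∑ x, F x) / 2 ^ n := by
  classical
  rw [integral_fintype Integrable.of_finite, Finset.sum_div]
  refine Finset.sum_congr rfl fun x _ => ?_
  have h : ({x} : Set (Cube n)) = {y | y = x} := rfl
  rw [h, uniformCube_real, Finset.filter_eq' Finset.univ x, if_pos (Finset.mem_univ x),
    Finset.card_singleton, Nat.cast_one, smul_eq_mul, one_div_mul_eq_div]

/-- The numbers below `n` in a tuple. -/
def pts (v : Fin k → Fin (n + 1)) : Finset ℕ :=
  (Finset.univ.image fun i => (v i : ℕ)).filter (· < n)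

/-- Sets of at most `k` elements are enumerated by `k`-tuples with `n` as padding. Repetitions do no
harm in a union bound, and the number of tests is a plain power of `n + 1`. -/
theorem exists_pts_eq {T : Finset ℕ} (hT : T ⊆ Finset.range n) (hk : T.card ≤ k) :
    ∃ v : Fin k → Fin (n + 1), pts v = T := by
  have hlt : ∀ i ∈ T, i < n := fun i hi => Finset.mem_range.1 (hT hi)
  refine ⟨fun j => if h : (j : ℕ) < T.card then
    ⟨T.equivFin.symm ⟨j, h⟩, (hlt _ (T.equivFin.symm ⟨j, h⟩).2).trans n.lt_succ_self⟩
      else Fin.last n, ?_⟩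
  ext i
  simp only [pts, Finset.mem_filter, Finset.mem_image, Finset.mem_univ, true_and]
  constructor
  · rintro ⟨⟨j, rfl⟩, hj⟩
    split_ifs at hj ⊢ with h
    · exact (T.equivFin.symm ⟨j, h⟩).2
    · simp at hj
  · intro hi
    have h := (T.equivFin ⟨i, hi⟩).2
    refine ⟨⟨⟨T.equivFin ⟨i, hi⟩, h.trans_le hk⟩, ?_⟩, hlt i hi⟩
    simp [h]

/-- The test functions. -/
def testFun (f : Finset ℕ → ℝ) (n D k : ℕ) (α : ℝ) :
    (Fin D → Fin (n + 1)) × (Fin 1 → Fin (n + 1)) × (Fin k → Fin (n + 1)) × Fin 3 →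
      Finset ℕ → ℝ
  | (u, v, t, s), R => match s with
    | 0 => corrTest f n (pts u) (pts v) (pts t) R
    | 1 => lowTest f n α (pts u) (pts v) R
    | 2 => highTest f n (pts u) R

theorem abs_testFun_le (hf : IsSetCoverage f)
    (i : (Fin D → Fin (n + 1)) × (Fin 1 → Fin (n + 1)) × (Fin k → Fin (n + 1)) × Fin 3)
    {R : Finset ℕ} (hR : R ⊆ Finset.range n) : |testFun f n D k α i R| ≤ 1 := by
  obtain ⟨u, v, t, s⟩ := i
  fin_cases s
  · change |corrTest f n (pts u) (pts v) (pts t) R| ≤ 1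
    rw [corrTest]
    split_ifs with h
    · rw [abs_mul, abs_chi, mul_one, abs_of_nonneg (div_nonneg (hf.nonneg _) (hf.nonneg _))]
      exact div_le_one_of_le₀ (hf.le_of_box hR h) (hf.nonneg _)
    · simp
  · change |lowTest f n α (pts u) (pts v) R| ≤ 1
    rw [lowTest]
    split_ifs <;> simp
  · change |highTest f n (pts u) R| ≤ 1
    rw [highTest]
    split_ifs <;> simp

theorem good_of_forall {Rs : ℕ → Finset ℕ} (h : ∀ i, Accurate n m Q Rs (testFun f n D k α i)) :
    Good f n m D k Q α Rs where
  corr P N T hP hN hT hPc hNc hTc := by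
    obtain ⟨u, rfl⟩ := exists_pts_eq hP hPc
    obtain ⟨v, rfl⟩ := exists_pts_eq hN hNc
    obtain ⟨t, rfl⟩ := exists_pts_eq hT hTc
    exact h (u, v, t, 0)
  low P N hP hN hPc hNc := by
    obtain ⟨u, rfl⟩ := exists_pts_eq hP hPc
    obtain ⟨v, rfl⟩ := exists_pts_eq hN hNc
    exact h (u, v, fun _ => 0, 1)
  high P hP hPc := by
    obtain ⟨u, rfl⟩ := exists_pts_eq hP hPc
    exact h (u, fun _ => 0, fun _ => 0, 2)

/-- The family of tests is fixed before the samples are drawn and covers every subcube and character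
the learner can need, so the union bound also covers its adaptive choices. -/
theorem le_exampleLaw_good (hf : IsSetCoverage f) (n m D k Q : ℕ) (α : ℝ) :
    1 - (n + 1 : ℝ) ^ (D + 1 + k) * 6 * Real.exp (-(m / Q : ℝ) ^ 2 / (2 * m)) ≤
      (exampleLaw n).real {ω | Good f n m D k Q α fun j => negSet (ω j)} := by
  have h1 := le_measure_infinitePi_forall_abs_sum_le (μ := uniformCube n)
    (F := fun i x => testFun f n D k α i (negSet x)) (fun i => measurable_of_finite _)
    (fun i x => abs_testFun_le hf i (negSet_subset x)) m (ε := m / Q) (by positivity)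
  have h2 : (Fintype.card ((Fin D → Fin (n + 1)) × (Fin 1 → Fin (n + 1)) ×
      (Fin k → Fin (n + 1)) × Fin 3) : ℝ) = (n + 1 : ℝ) ^ (D + 1 + k) * 3 := by
    simp only [Fintype.card_prod, Fintype.card_fun, Fintype.card_fin]
    push_cast
    ring
  rw [h2] at h1
  refine le_trans (le_of_eq (by ring)) (h1.trans (measureReal_mono ?_))
  intro ω hω
  refine good_of_forall fun i => ?_
  have h3 := hω i
  rw [integral_uniformCube, sum_negSet] at h3
  exact h3

/-! ### The numerical choice of the parameters. -/

section Parameters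

variable {n m L K Q : ℕ} {g δ : ℝ}

/-- With `α = 8 * (L + 2)` the tail is `exp (-3 * L - 11 / 2)`, which beats the factor `2 ^ L * (4 *
(L + 2)) ≤ exp (3 * L + 4)`. -/
theorem exp_le_tol (L : ℕ) (h : 1 ≤ 2 ^ L * δ) :
    Real.exp (1 / 2 - 3 / 8 * (8 * (L + 2))) ≤ δ / (4 * (L + 2)) := by
  have h1 : (2 : ℝ) ^ L ≤ Real.exp L := by
    rw [← mul_one (L : ℝ), Real.exp_nat_mul]
    exact pow_le_pow_left₀ zero_le_two (by linarith [Real.add_one_le_exp 1]) L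
  have h2 : (L + 3 : ℝ) ^ 2 ≤ Real.exp (2 * L + 4) := by
    have h3 := pow_le_pow_left₀ (by positivity) (Real.add_one_le_exp (L + 2 : ℝ)) 2
    rw [← Real.exp_nat_mul] at h3
    calc (L + 3 : ℝ) ^ 2 = (L + 2 + 1) ^ 2 := by ring
      _ ≤ _ := h3
      _ = _ := by push_cast; ring_nf
  have h3 : 2 ^ L * (4 * (L + 2 : ℝ)) ≤ Real.exp (3 * L + 4) := by
    calc 2 ^ L * (4 * (L + 2 : ℝ)) ≤ Real.exp L * Real.exp (2 * L + 4) := by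
          refine mul_le_mul h1 (le_trans ?_ h2) (by positivity) (Real.exp_nonneg _)
          nlinarith [sq_nonneg (L : ℝ), (Nat.cast_nonneg L : (0 : ℝ) ≤ L)]
      _ = _ := by rw [← Real.exp_add]; ring_nf
  have h4 : Real.exp (1 / 2 - 3 / 8 * (8 * (L + 2))) * Real.exp (3 * L + 4) ≤ 1 := by
    rw [← Real.exp_add, Real.exp_le_one_iff]
    linarith
  have hE := Real.exp_nonneg (1 / 2 - 3 / 8 * (8 * ((L : ℝ) + 2)))
  rw [le_div_iff₀ (by positivity)]
  have h5 := (mul_le_mul_of_nonneg_left h3 hE).trans h4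
  have h6 : (0 : ℝ) < 2 ^ L := by positivity
  refine le_of_mul_le_mul_left ?_ h6
  linarith

theorem invTol_cast (L : ℕ) : (invTol L : ℝ) = 131072 * (L + 2) ^ 3 * 4 ^ L := by
  simp [invTol]

theorem one_div_invTol_le (L : ℕ) (h : 1 ≤ 2 ^ L * δ) :
    1 / (invTol L : ℝ) ≤ δ / (4 * (L + 2)) := by
  have h4 : (4 : ℝ) ^ L = 2 ^ L * 2 ^ L := by rw [← mul_pow]; norm_num
  have h1 : (1 : ℝ) ≤ 2 ^ L := one_le_pow₀ one_le_two
  rw [invTol_cast, div_le_div_iff₀ (by positivity) (by positivity), h4]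
  have h2 : (1 : ℝ) ≤ δ * (2 ^ L * 2 ^ L) := by nlinarith
  have h3 : (4 * (L + 2) : ℝ) ≤ 131072 * (L + 2) ^ 3 := by
    have h0 : (0 : ℝ) ≤ L := Nat.cast_nonneg L
    have : (1 : ℝ) ≤ (L + 2) ^ 2 := one_le_pow₀ (by linarith)
    nlinarith
  calc 1 * (4 * (L + 2) : ℝ) ≤ 131072 * (L + 2) ^ 3 * 1 := by linarith
    _ ≤ 131072 * (L + 2) ^ 3 * (δ * (2 ^ L * 2 ^ L)) := by gcongr
    _ = _ := by ring

/-- The requirement of Chebyshev's inequality, which dictates `invTol`: `131072 / 4 = 32768` must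
exceed `448 * 64 = 28672`, and `4 ^ L * g ^ 2 * δ ≥ (2 ^ L * (g * δ)) ^ 2` since `δ ≤ 1`. -/
theorem sq_le_tol_mul (L : ℕ) (hδ : 0 < δ) (hδ1 : δ ≤ 1) (hg : 0 < g) (h : 1 ≤ 2 ^ L * (g * δ)) :
    448 * (8 * (L + 2)) ^ 2 ≤ δ / (4 * (L + 2)) * (invTol L * g ^ 2) := by
  have h4 : (4 : ℝ) ^ L = 2 ^ L * 2 ^ L := by rw [← mul_pow]; norm_num
  have h1 : 1 ≤ 4 ^ L * g ^ 2 * δ := by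
    have h2 : (1 : ℝ) ≤ (2 ^ L * (g * δ)) ^ 2 := one_le_pow₀ h
    calc (1 : ℝ) ≤ (4 ^ L * g ^ 2 * δ) * δ := by rw [h4]; linarith
      _ ≤ (4 ^ L * g ^ 2 * δ) * 1 := by gcongr
      _ = _ := mul_one _
  have h2 : δ / (4 * (L + 2)) * (invTol L * g ^ 2) =
      32768 * (L + 2) ^ 2 * (4 ^ L * g ^ 2 * δ) := by
    rw [invTol_cast]
    field_simp
    ring
  rw [h2]
  calc 448 * (8 * (L + 2 : ℝ)) ^ 2 ≤ 32768 * (L + 2) ^ 2 * 1 := by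
        nlinarith [sq_nonneg (L + 2 : ℝ)]
    _ ≤ _ := by gcongr

theorem pow_lt_invTol (L : ℕ) : 2 ^ (L + 2) < invTol L := by
  have h1 : 2 ^ L ≤ 4 ^ L := Nat.pow_le_pow_left (by norm_num) L
  have h2 : 1 ≤ (L + 2) ^ 3 := Nat.one_le_pow _ _ (by omega)
  have h3 : 131072 * 1 * 4 ^ L ≤ 131072 * (L + 2) ^ 3 * 4 ^ L := by gcongr
  have h4 : 1 ≤ 4 ^ L := Nat.one_le_pow _ _ (by norm_num)
  unfold invTol
  rw [pow_add]
  omega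

/-- Fixes the degree `5 * L + 21` up to which correlations must be estimated; it comes from `L + 2 ≤
2 * 2 ^ L`. -/
theorem invTol_lt_pow (L : ℕ) : invTol L < 2 ^ (5 * L + 20 + 1) := by
  have h1 : L + 2 ≤ 2 * 2 ^ L := by
    have : L + 1 ≤ 2 ^ L := Nat.lt_two_pow_self
    omega
  have h2 := Nat.pow_le_pow_left h1 3
  have h3 : 131072 * (L + 2) ^ 3 * 4 ^ L ≤ 131072 * (2 * 2 ^ L) ^ 3 * 4 ^ L := by gcongr
  have h4 : 131072 * (2 * 2 ^ L) ^ 3 * 4 ^ L = 2 ^ (5 * L + 20) := by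
    have h5 : (4 : ℕ) ^ L = 2 ^ (2 * L) := by rw [pow_mul]; norm_num
    have h6 : (131072 : ℕ) = 2 ^ 17 := by norm_num
    rw [h5, h6, ← pow_succ', ← pow_mul, ← pow_add, ← pow_add]
    congr 1
    ring
  rw [pow_succ]
  have h7 : 0 < 2 ^ (5 * L + 20) := by positivity
  unfold invTol
  omega

/-- With `t = (L + 2) * (K + 1)` the number of tests grows at most like `2 ^ (12 * t)`, and the
constant 34 in `sampleSize` makes each fail with probability of order `exp (-17 * t)`. -/
theorem failure_le (hK : n ≤ 2 ^ K) :
    (n + 1 : ℝ) ^ (L + 2 + 1 + (5 * L + 20 + 1)) * 6 *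
      Real.exp (-(sampleSize L K / invTol L : ℝ) ^ 2 / (2 * sampleSize L K)) ≤ 1 / 3 := by
  have hQ : (0 : ℝ) < invTol L := by
    rw [invTol_cast]
    positivity
  set t := (L + 2) * (K + 1) with ht
  have h1 : -(sampleSize L K / invTol L : ℝ) ^ 2 / (2 * sampleSize L K) =
      ((17 * t : ℕ) : ℝ) * -1 := by
    simp only [sampleSize, ht]
    push_cast
    field_simp
    ring
  have h2 : (n + 1 : ℝ) ^ (L + 2 + 1 + (5 * L + 20 + 1)) ≤ 2 ^ (12 * t) := by
    have h3 : (n + 1 : ℝ) ≤ 2 ^ (K + 1) := by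
      have h4 : n + 1 ≤ 2 ^ (K + 1) := by
        have : 1 ≤ 2 ^ K := Nat.one_le_two_pow
        rw [pow_succ]
        omega
      exact_mod_cast h4
    calc (n + 1 : ℝ) ^ (L + 2 + 1 + (5 * L + 20 + 1))
        ≤ (2 ^ (K + 1)) ^ (L + 2 + 1 + (5 * L + 20 + 1)) :=
          pow_le_pow_left₀ (by positivity) h3 _
      _ ≤ (2 ^ (K + 1)) ^ (12 * (L + 2)) :=
          pow_le_pow_right₀ (one_le_pow₀ one_le_two) (by omega)
      _ = 2 ^ (12 * t) := by
          rw [← pow_mul, ht]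
          ring_nf
  have h3 : Real.exp (((17 * t : ℕ) : ℝ) * -1) ≤ (1 / 2) ^ (17 * t) := by
    rw [Real.exp_nat_mul]
    refine pow_le_pow_left₀ (Real.exp_nonneg _) ?_ _
    rw [Real.exp_neg, one_div]
    exact inv_anti₀ two_pos (by linarith [Real.add_one_le_exp 1])
  have ht2 : 2 ≤ t := by
    have := Nat.mul_le_mul (show 2 ≤ L + 2 by omega) (show 1 ≤ K + 1 by omega)
    omega
  rw [h1]
  calc _ ≤ (2 : ℝ) ^ (12 * t) * 6 * (1 / 2) ^ (17 * t) := by gcongr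
    _ = 6 * (1 / 32) ^ t := by
      rw [pow_mul 2 12 t, pow_mul _ 17 t, mul_right_comm, ← mul_pow]
      norm_num [mul_comm]
    _ ≤ 6 * (1 / 32) ^ 2 := by
      gcongr 6 * ?_
      exact pow_le_pow_of_le_one (by norm_num) (by norm_num) ht2
    _ ≤ 1 / 3 := by norm_num

/-- Storing the samples costs `m * n`, and each leaf costs `m * n` for the scans and `m * Q ^ 2` for
the scans of the list. -/
theorem learnTime_le (hn : 0 < n) (hm : 0 < m) (hQ : 0 < Q) (hK : K ≤ m) :
    learnTime n m Q L K ≤ 10000 * ((L + 2) * (m * (n + Q ^ 2))) := by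
  have h1 : m ≤ m * n := Nat.le_mul_of_pos_right m hn
  have h2 : n ≤ m * n := Nat.le_mul_of_pos_left n hm
  have h3 : (Q + 2) * ((Q + 2) * (80 * m + 200) + 50) ≤ 2670 * (m * Q ^ 2) := by
    calc (Q + 2) * ((Q + 2) * (80 * m + 200) + 50)
        ≤ (3 * Q) * ((3 * Q) * (280 * m) + 50 * (m * Q)) := by
          gcongr
          · omega
          · omega
          · omega
          · have := Nat.mul_le_mul hm hQ
            omega
      _ = _ := by ring
  have h4 : roundTime n m Q ≤ 4000 * (m * (n + Q ^ 2)) := by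
    unfold roundTime leafTime
    have h5 : 100 * (n * (m + 1)) + (n * (80 * m + 300)) = 180 * (m * n) + 400 * n := by ring
    rw [mul_add m]
    generalize (Q + 2) * ((Q + 2) * (80 * m + 200) + 50) = a at h3 ⊢
    generalize m * Q ^ 2 = b at h3 ⊢
    generalize n * (80 * m + 300) = d at h5 ⊢
    generalize n * (m + 1) = d' at h5 ⊢
    generalize m * n = q at *
    omega
  have h5 : 1 ≤ m * (n + Q ^ 2) := Nat.mul_le_mul hm (show 1 ≤ n + Q ^ 2 by omega)
  have h6 : (L + 2) * (roundTime n m Q + 20) ≤ 4020 * ((L + 2) * (m * (n + Q ^ 2))) := by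
    calc (L + 2) * (roundTime n m Q + 20)
        ≤ (L + 2) * (4020 * (m * (n + Q ^ 2))) := Nat.mul_le_mul_left _ (by omega)
      _ = _ := by ring
  have h7 : L + 2 ≤ (L + 2) * (m * (n + Q ^ 2)) := Nat.le_mul_of_pos_right _ h5
  have h8 : m * (n + Q ^ 2) ≤ (L + 2) * (m * (n + Q ^ 2)) :=
    Nat.le_mul_of_pos_left _ (by omega)
  have h9 : m * (40 * n + 120) = 40 * (m * n) + 120 * m := by ring
  have h10 : m * n ≤ m * (n + Q ^ 2) := Nat.mul_le_mul_left m (by omega)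
  unfold learnTime
  rw [h9]
  generalize (L + 2) * (m * (n + Q ^ 2)) = X at *
  generalize (L + 2) * (roundTime n m Q + 20) = Y at *
  generalize m * (n + Q ^ 2) = Z at *
  generalize m * n = q at *
  omega

/-- The factor 2 comes from `log 2 ≥ 1 / 2`. -/
theorem le_one_add_two_mul_log {k : ℕ} {x : ℝ} (hx : 1 ≤ x) (h : 2 ^ k ≤ 2 * x) :
    (k : ℝ) ≤ 1 + 2 * Real.log x := by
  have h1 := Real.log_le_log (by positivity) h
  rw [Real.log_pow, Real.log_mul two_ne_zero (by linarith)] at h1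
  have h2 : (1 : ℝ) / 2 ≤ Real.log 2 := by linarith [Real.log_two_gt_d9]
  have h3 := Real.log_nonneg hx
  rcases Nat.eq_zero_or_pos k with rfl | hk
  · push_cast
    linarith
  · have : (1 : ℝ) ≤ k := Nat.one_le_cast.2 hk
    nlinarith

theorem invTol_sq_le {E l : ℝ} (hE : (2 ^ L) ^ 4 ≤ 16 * E) (hl : (L + 2 : ℝ) ≤ 3 * l) :
    (invTol L : ℝ) ^ 2 ≤ 2 ^ 38 * 3 ^ 6 * l ^ 6 * E := by
  have h4 : ((4 : ℝ) ^ L) ^ 2 = (2 ^ L) ^ 4 := by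
    rw [← pow_mul, ← pow_mul, show (4 : ℝ) = 2 ^ 2 by norm_num, ← pow_mul]
    ring_nf
  have h0 : (0 : ℝ) ≤ 3 * l := le_trans (by positivity) hl
  calc (invTol L : ℝ) ^ 2 = 2 ^ 34 * (L + 2) ^ 6 * (2 ^ L) ^ 4 := by
        rw [invTol_cast, ← h4]
        ring
    _ ≤ 2 ^ 34 * (3 * l) ^ 6 * (16 * E) := by gcongr
    _ = _ := by ring

theorem sampleSize_le {E l r : ℝ} (hE : (2 ^ L) ^ 4 ≤ 16 * E) (hl : (L + 2 : ℝ) ≤ 3 * l)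
    (hr : (K + 1 : ℝ) ≤ 6 * r) :
    (sampleSize L K : ℝ) ≤ 34 * 2 ^ 39 * 3 ^ 8 * (r * (E * l ^ 7)) := by
  have h1 := invTol_sq_le hE hl
  have h0 : (0 : ℝ) ≤ 3 * l := le_trans (by positivity) hl
  calc (sampleSize L K : ℝ) = 34 * (invTol L : ℝ) ^ 2 * (L + 2) * (K + 1) := by simp [sampleSize]
    _ ≤ 34 * (2 ^ 38 * 3 ^ 6 * l ^ 6 * E) * (3 * l) * (6 * r) := by
        have : 0 ≤ 2 ^ 38 * 3 ^ 6 * l ^ 6 * E := (sq_nonneg _).trans h1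
        gcongr
    _ = _ := by ring

/-- The exponent 15 of `l` collects one factor for the number of leaves, eight from the sample size
and six from `invTol L ^ 2`. -/
theorem learnTime_sampleSize_le {E l : ℝ} (hn : 0 < n) (h1E : 1 ≤ E) (h1l : 1 ≤ l)
    (hE : (2 ^ L) ^ 4 ≤ 16 * E) (hl : (L + 2 : ℝ) ≤ 3 * l) (hr : (K + 1 : ℝ) ≤ 6 * l) :
    (learnTime n (sampleSize L K) (invTol L) L K : ℝ) ≤
      30000 * (34 * 2 ^ 39 * 3 ^ 8) * (2 ^ 38 * 3 ^ 6) * ((n * E + E ^ 2) * l ^ 15) := by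
  have hQ : 0 < invTol L := by
    unfold invTol
    positivity
  have hK : K + 1 ≤ sampleSize L K := Nat.le_mul_of_pos_left _ (by positivity)
  have h1 := learnTime_le (L := L) hn (by omega) hQ (show K ≤ sampleSize L K by omega)
  have h2 := sampleSize_le hE hl hr
  have h3 := invTol_sq_le hE hl
  have h4 : (n : ℝ) + (invTol L : ℝ) ^ 2 ≤ 2 ^ 38 * 3 ^ 6 * l ^ 6 * (n + E) := by
    have : (1 : ℝ) ≤ 2 ^ 38 * 3 ^ 6 * l ^ 6 := by
      have : 1 ≤ l ^ 6 := one_le_pow₀ h1l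
      linarith
    rw [mul_add]
    have := mul_le_mul_of_nonneg_right this (Nat.cast_nonneg (α := ℝ) n)
    linarith
  calc (learnTime n (sampleSize L K) (invTol L) L K : ℝ)
      ≤ (10000 * ((L + 2) * (sampleSize L K * (n + invTol L ^ 2))) : ℕ) := Nat.cast_le.2 h1
    _ = 10000 * ((L + 2) * (sampleSize L K * (n + (invTol L : ℝ) ^ 2))) := by push_cast; rfl
    _ ≤ 10000 * (3 * l * (34 * 2 ^ 39 * 3 ^ 8 * (l * (E * l ^ 7)) *
          (2 ^ 38 * 3 ^ 6 * l ^ 6 * (n + E)))) := by gcongr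
    _ = _ := by ring

end Parameters

/-! ### Assembly. -/

open IsSetCoverage

instance isProbabilityMeasure_exampleLaw (n : ℕ) : IsProbabilityMeasure (exampleLaw n) :=
  inferInstanceAs (IsProbabilityMeasure (Measure.infinitePi fun _ : ℕ => uniformCube n))

/-- With probability `2 / 3` the specification of the rounds determines a good hypothesis. -/
theorem two_thirds_le_exampleLaw {n L K : ℕ} {g δ : ℝ} {c : Cube n → ℝ} (hc : IsCoverage c)
    (hg : 0 < g) (hg1 : g ≤ 1) (hδ : 0 < δ) (hδ1 : δ ≤ 1) (hL : 1 ≤ 2 ^ L * (g * δ))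
    (hK : n ≤ 2 ^ K) {h : (ℕ → Cube n) → Cube n → ℝ}
    (hh : ∀ ω, ∃ (ℓ : ℕ → ℕ) (M : ℕ → ℝ), (∀ d < L + 2, Round n (sampleSize L K)
        (fun j => ext (ω j)) (fun j => c (ω j)) (16 * (L + 2)) ℓ d (M d)) ∧
      ∀ x, h ω x = ∑ d ∈ Finset.range (L + 2), leafHyp n (sampleSize L K) (invTol L)
        (fun j => ext (ω j)) (fun j => c (ω j)) g ℓ d (M d) (ext x)) :
    2 / 3 ≤ (exampleLaw n).real
      {ω | 1 - δ ≤ (uniformCube n).real {x | h ω x ≤ c x ∧ c x ≤ (1 + g) * h ω x}} := by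
  classical
  obtain ⟨f, hf, hcf⟩ := exists_isSetCoverage hc
  have h1 := le_exampleLaw_good hf n (sampleSize L K) (L + 2) (5 * L + 20 + 1) (invTol L)
    (8 * (L + 2))
  have h2 := failure_le (L := L) hK
  refine le_trans (by linarith) (h1.trans (measureReal_mono fun ω hω => ?_))
  obtain ⟨ℓ, M, hr, hx⟩ := hh ω
  have h2L : (0 : ℝ) < 2 ^ L := by positivity
  have hgδ : g * δ ≤ δ := mul_le_of_le_one_left hδ.le hg1
  have hLδ : 1 ≤ 2 ^ L * δ := hL.trans (by gcongr)
  have hm : 0 < sampleSize L K := by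
    unfold sampleSize invTol
    positivity
  have hα : 2 * (8 * ((L : ℝ) + 2)) = 16 * (L + 2) := by ring
  have hbad := card_bad_le hf hcf hm hω (fun d hd => by rw [hα]; exact hr d hd) (pow_lt_invTol L)
    (invTol_lt_pow L) (by positivity) hg hg1 (one_div_invTol_le L hLδ) (exp_le_tol L hLδ)
    (sq_le_tol_mul L hδ hδ1 hg hL) hx
  -- The error budget: half of `δ` for all leaves together, half for the points in no leaf.
  have h3 : ((L + 2 : ℕ) : ℝ) * (2 * (δ / (4 * (L + 2)))) + 1 / 2 ^ (L + 2) ≤ δ := by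
    have h4 : ((L + 2 : ℕ) : ℝ) * (2 * (δ / (4 * (L + 2)))) = δ / 2 := by
      push_cast
      field_simp
      norm_num
    have h5 : 1 / (2 : ℝ) ^ (L + 2) ≤ δ / 2 := by
      rw [div_le_div_iff₀ (by positivity) two_pos, pow_add]
      linarith
    linarith
  have h4 := Finset.card_filter_add_card_filter_not (s := (Finset.univ : Finset (Cube n)))
    fun x => h ω x ≤ c x ∧ c x ≤ (1 + g) * h ω x
  rw [Finset.card_univ, card_cube] at h4
  have h5 : (((Finset.univ.filter fun x => h ω x ≤ c x ∧ c x ≤ (1 + g) * h ω x).card : ℕ) : ℝ) +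
      (Finset.univ.filter fun x => ¬(h ω x ≤ c x ∧ c x ≤ (1 + g) * h ω x)).card = 2 ^ n := by
    exact_mod_cast h4
  change 1 - δ ≤ (uniformCube n).real {x | h ω x ≤ c x ∧ c x ≤ (1 + g) * h ω x}
  rw [uniformCube_real, le_div_iff₀ (by positivity)]
  have h6 := hbad.trans (mul_le_mul_of_nonneg_left h3 (by positivity))
  linarith

/-- The least exponent: its minimality gives both the stopping condition of the doubling loops and
the upper bound needed for the running time. -/
theorem exists_pow_le {x : ℝ} (hx : 1 ≤ x) :
    ∃ k : ℕ, x ≤ 2 ^ k ∧ (∀ j < k, 2 ^ j < x) ∧ 2 ^ k ≤ 2 * x := by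
  classical
  have h : ∃ k : ℕ, x ≤ 2 ^ k := pow_unbounded_of_one_lt x one_lt_two |>.imp fun _ h => h.le
  have hlt : ∀ j < Nat.find h, 2 ^ j < x := fun j hj => not_le.1 (Nat.find_min h hj)
  refine ⟨Nat.find h, Nat.find_spec h, hlt, ?_⟩
  rcases hk : Nat.find h with _ | k
  · linarith
  · rw [pow_succ, mul_comm]
    have := hlt k (by omega)
    linarith

end Learner

open Learner in
theorem mainTheorem1 :
    ∃ (L E : Cmd) (C : ℝ) (k : ℕ), E.DrawFree ∧
      ∀ (n : ℕ), 2 ≤ n → ∀ (γ δ : ℝ), 0 < γ → 0 < δ →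
        ∀ (c : Cube n → ℝ), IsCoverage c →
          ∃ h : (ℕ → Cube n) → (Cube n → ℝ),
            (∀ ω : ℕ → Cube n,
              Outputs L E γ δ c ω
                (softO C k (n / ((min γ 1) ^ 4 * (min δ 1) ^ 4)
                  + 1 / ((min γ 1) ^ 8 * (min δ 1) ^ 8)))
                (Real.log n * softO C k (1 / ((min γ 1) ^ 4 * (min δ 1) ^ 4)))
                (h ω)) ∧
            2 / 3 ≤ (exampleLaw n).real
              {ω | 1 - δ ≤ (uniformCube n).real {x | h ω x ≤ c x ∧ c x ≤ (1 + γ) * h ω x}} := by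
  refine ⟨learn, evaluate, 30000 * (34 * 2 ^ 39 * 3 ^ 8) * (2 ^ 38 * 3 ^ 6), 15,
    evaluate_drawFree, fun n hn γ δ hγ hδ c hc => ?_⟩
  set g := min γ 1 with hgdef
  set d := min δ 1 with hddef
  have hg : 0 < g := lt_min hγ one_pos
  have hg1 : g ≤ 1 := min_le_right _ _
  have hd : 0 < d := lt_min hδ one_pos
  have hd1 : d ≤ 1 := min_le_right _ _
  have hgd : 0 < g * d := mul_pos hg hd
  have hgd1 : g * d ≤ 1 := mul_le_one₀ hg1 hd.le hd1
  have hn1 : (1 : ℝ) ≤ n := by exact_mod_cast (by omega : 1 ≤ n)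
  have hn2 : (2 : ℝ) ≤ n := by exact_mod_cast hn
  obtain ⟨L, hL, hL', hL2⟩ := exists_pow_le (x := 1 / (g * d)) ((one_le_div hgd).2 hgd1)
  obtain ⟨K, hK, hK', hK2⟩ := exists_pow_le hn1
  set E := 1 / (g ^ 4 * d ^ 4) with hE
  have hEe : E = (1 / (g * d)) ^ 4 := by rw [hE, div_pow, one_pow, mul_pow]
  have h1E : 1 ≤ E := by
    rw [hEe]
    exact one_le_pow₀ ((one_le_div hgd).2 hgd1)
  have hLE : ((2 : ℝ) ^ L) ^ 4 ≤ 16 * E := by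
    calc ((2 : ℝ) ^ L) ^ 4 ≤ (2 * (1 / (g * d))) ^ 4 := by gcongr
      _ = 16 * E := by rw [mul_pow, ← hEe]; norm_num
  have hlogE : 0 ≤ Real.log E := Real.log_nonneg h1E
  have hLlog : (L + 2 : ℝ) ≤ 3 * (1 + Real.log E) := by
    have h1 := le_one_add_two_mul_log ((one_le_div hgd).2 hgd1) hL2
    rw [hEe, Real.log_pow] at hlogE ⊢
    push_cast at hlogE ⊢
    linarith
  -- Constants are absorbed into `log n`, which is at least `log 2`; here `n ≥ 2` matters.
  have hKlog : (K + 1 : ℝ) ≤ 6 * Real.log n := by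
    have h1 := le_one_add_two_mul_log hn1 hK2
    have h2 := Real.log_le_log two_pos hn2
    linarith [Real.log_two_gt_d9]
  have hF : n / (g ^ 4 * d ^ 4) + 1 / (g ^ 8 * d ^ 8) = n * E + E ^ 2 := by
    rw [hE]
    field_simp
  -- The argument of the time bound is at least `n`, so the factor `log n` of the sample size
  -- disappears among its logarithms.
  have hnE : (n : ℝ) ≤ n * E + E ^ 2 := by nlinarith
  have hEF : E ≤ n * E + E ^ 2 := by nlinarith
  have hlogEF := Real.log_le_log (by linarith) hEF
  have hlognF := Real.log_le_log (by linarith) hnE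
  have hT : (learnTime n (sampleSize L K) (invTol L) L K : ℝ) ≤
      softO (30000 * (34 * 2 ^ 39 * 3 ^ 8) * (2 ^ 38 * 3 ^ 6)) 15
        (n / (g ^ 4 * d ^ 4) + 1 / (g ^ 8 * d ^ 8)) := by
    rw [hF, softO, mul_assoc]
    exact learnTime_sampleSize_le (by omega) h1E (by linarith) hLE (by linarith) (by linarith)
  have hB : (sampleSize L K : ℝ) ≤ Real.log n *
      softO (30000 * (34 * 2 ^ 39 * 3 ^ 8) * (2 ^ 38 * 3 ^ 6)) 15 E := by
    refine (sampleSize_le hLE hLlog hKlog).trans ?_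
    have h1 : (1 + Real.log E) ^ 7 ≤ (1 + Real.log E) ^ 15 :=
      pow_le_pow_right₀ (by linarith) (by norm_num)
    have h2 : 0 ≤ Real.log n := Real.log_nonneg hn1
    rw [softO]
    calc 34 * 2 ^ 39 * 3 ^ 8 * (Real.log n * (E * (1 + Real.log E) ^ 7))
        ≤ 30000 * (34 * 2 ^ 39 * 3 ^ 8) * (2 ^ 38 * 3 ^ 6) *
          (Real.log n * (E * (1 + Real.log E) ^ 15)) := by
          refine mul_le_mul (by norm_num) ?_ (by positivity) (by norm_num)
          gcongr
      _ = _ := by ring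
  have hL1 : 1 ≤ 2 ^ L * (g * d) := (div_le_iff₀ hgd).1 hL
  have hL1' : ∀ j < L, 2 ^ j * (g * d) < 1 := fun j hj => (lt_div_iff₀ hgd).1 (hL' j hj)
  have hK1 : n ≤ 2 ^ K := by exact_mod_cast hK
  have hK1' : ∀ j < K, 2 ^ j < n := fun j hj => by exact_mod_cast hK' j hj
  -- The hypothesis is defined for every sequence of examples; probability enters only through its
  -- specification.
  choose h hout hspec using fun ω : ℕ → Cube n =>
    exists_outputs (c := c) (ω := ω) hL1 hL1' hK1 hK1' hT hB
  refine ⟨h, hout, (two_thirds_le_exampleLaw hc hg hg1 hd hd1 hL1 hK1 hspec).trans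
    (measureReal_mono fun ω hω => ?_)⟩
  change 1 - δ ≤ _
  change 1 - d ≤ _ at hω
  refine le_trans (by linarith [min_le_left δ 1]) (hω.trans (measureReal_mono ?_))
  rintro x ⟨h1, h2⟩
  refine ⟨h1, h2.trans ?_⟩
  have hc0 : 0 ≤ c x := by
    obtain ⟨f, hf, hcf⟩ := exists_isSetCoverage hc
    rw [hcf]
    exact hf.nonneg _
  -- Enlarging `min γ 1` to `γ` needs `h ω x ≥ 0`, which follows at good points from `0 ≤ c x ≤ (1 +
  -- g) * h ω x`.
  have h0 : 0 ≤ h ω x := nonneg_of_mul_nonneg_right (hc0.trans h2) (by positivity)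
  gcongr
  exact min_le_left _ _

end
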